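/- **Theorem.** Let $\mathbb{K}$ be $\mathbb{R}$ or $\mathbb{C}$, let $p \geq 1$ be a computable real number with $p \neq 2$, let $n \geq 1$ be an integer, and let $\mathbf{d}$ be a c.e. Turing degree. Let $\mathcal{B} = \ell^p_n \oplus L^p[0,1]$ be the $L^p$-sum over $\mathbb{K}$, with norm $\|(u,f)\| = (\|u\|_p^p + \|f\|_p^p)^{1/p}$. Then there is a computable presentation $\mathcal{B}^\#$ of $\mathcal{B}$ such that every Turing degree that computes a linear isometric isomorphism of (the standard presentation of) $\mathcal{B}$ onto $\mathcal{B}^\#$ also computes $\mathbf{d}$. Here a *presentation* of a Banach space $\mathcal{B}$ is a pair $\mathcal{B}^\# = (\mathcal{B},R)$, where $R : \mathbb{N} \to \mathcal{B}$ has a range whose linear span is dense. Its *rational vectors* are the sums $\sum_{j \leq M} \alpha_j R(j)$ with $\alpha_j$ in $\mathbb{Q}(i)$ (in $\mathbb{Q}$ if $\mathbb{K} = \mathbb{R}$), and its *rational balls* are the open balls with a rational vector as centre and a positive rational radius. It is *computable* if there is an algorithm that, given $\alpha_0,\dots,\alpha_M$ and $k \in \mathbb{N}$, produces a rational number $q$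 with $\left|\left\|\sum_{j \leq M}\alpha_j R(j)\right\| - q\right| < 2^{-k}$. The *standard presentation* of $\ell^p_n \oplus L^p[0,1]$ lists the vectors $(e_j,0)$ for $j<n$, where $e_0,\dots,e_{n-1}$ is the standard basis, followed by the vectors $(0,\chi_I)$ for the dyadic intervals $I = [j2^{-k},(j+1)2^{-k}]$ with $k \in \mathbb{N}$ and $0 \leq j < 2^k$, in a fixed computable enumeration. A Turing degree $\mathbf{x}$ *computes* a map $T$ from $\mathcal{B}_0^\#$ to $\mathcal{B}_1^\#$ if, for some (equivalently, any) set $X$ of degree $\mathbf{x}$, there is an algorithm with oracle $X$ that, given a rational ball $B$ of $\mathcal{B}_0^\#$, either does not halt or outputs a rational ball $B'$ of $\mathcal{B}_1^\#$ with $T[B] \subseteq B'$, and such that for every vector $v$ and every neighbourhood $U$ of $T(v)$ there is a rational ball $B \ni v$ on which the algorithm outputs a ball $B' \subseteq U$. -/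

import Mathlib

open MeasureTheory
open scoped ENNReal Topology

namespace CompBanach

noncomputable section

/-! ### Turing degrees of sets of natural numbers -/

/-- The characteristic function of a set of natural numbers, as an oracle. -/
def charFun (A : Set ℕ) : ℕ →. ℕ :=
  open Classical in fun n => Part.some (if n ∈ A then 1 else 0)

/-- The Turing degree of a set of natural numbers. -/
def degree (A : Set ℕ) : TuringDegree :=
  toAntisymmetrization TuringReducible (charFun A)

/-- A Turing degree is c.e. if it contains a computably enumerable set. -/
def IsCEDegree (d : TuringDegree) : Prop :=
  ∃ A : Set ℕ, REPred (fun n => n ∈ A) ∧ degree A = d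

/-! ### Rational numbers and computable reals -/

/-- A code `(a, b)` for the rational number `a / (b + 1)`. -/
abbrev RatCode := ℤ × ℕ

/-- The rational number with code `c`. -/
def ratVal (c : RatCode) : ℚ := (c.1 : ℚ) / ((c.2 : ℚ) + 1)

/-- A real number is computable if some algorithm produces, from `k`, a rational number
within `2 ^ (-k)` of it. -/
def IsComputableReal (x : ℝ) : Prop :=
  ∃ f : ℕ → RatCode, Computable f ∧ ∀ k : ℕ, |x - (ratVal (f k) : ℝ)| < (2 : ℝ)⁻¹ ^ k

/-! ### Presentations of Banach spaces -/

/-- A code for a rational scalar: a pair of codes, for its real and its imaginary part. -/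
abbrev ScalarCode := RatCode × RatCode

/-- The rational scalar with code `c`: an arbitrary element of `ℚ(i)` if `𝕜 = ℂ`, and an arbitrary
element of `ℚ` if `𝕜 = ℝ` (where `RCLike.I = 0`). -/
def scalarVal (𝕜 : Type*) [RCLike 𝕜] (c : ScalarCode) : 𝕜 :=
  ((ratVal c.1 : ℚ) : 𝕜) + ((ratVal c.2 : ℚ) : 𝕜) * RCLike.I

section Presentations

variable (𝕜 : Type*) [RCLike 𝕜]
variable {B B₀ B₁ : Type*} [NormedAddCommGroup B] [NormedSpace 𝕜 B]
  [NormedAddCommGroup B₀] [NormedSpace 𝕜 B₀] [NormedAddCommGroup B₁] [NormedSpace 𝕜 B₁]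

/-- The sequence `R` is a structure on `B`, i.e. `(B, R)` is a presentation of `B`: the range of `R`
is linearly dense. -/
def IsPresentation (R : ℕ → B) : Prop :=
  Dense (Submodule.span 𝕜 (Set.range R) : Set B)

/-- The rational vector `∑ j, α_j R(j)` of `(B, R)` whose list of coefficients `α_0, α_1, …`
is coded by `l`. -/
def ratVec (R : ℕ → B) (l : List ScalarCode) : B :=
  ∑ j : Fin l.length, scalarVal 𝕜 (l.get j) • R j

/-- The presentation `(B, R)` is computable: there is an algorithm that, given the coefficients of
a rational vector and `k`, produces a rational number within `2 ^ (-k)` of its norm. -/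
def IsComputablePresentation (R : ℕ → B) : Prop :=
  IsPresentation 𝕜 R ∧
    ∃ f : List ScalarCode × ℕ → RatCode, Computable f ∧
      ∀ (l : List ScalarCode) (k : ℕ),
        |‖ratVec 𝕜 R l‖ - (ratVal (f (l, k)) : ℝ)| < (2 : ℝ)⁻¹ ^ k

/-- A code for a rational ball: the coefficients of its centre, and a pair `(a, b)` that stands for
the radius `(a + 1) / (b + 1)`. -/
abbrev BallCode := List ScalarCode × (ℕ × ℕ)

/-- The open rational ball of `(B, R)` with code `c`. -/
def ratBall (R : ℕ → B) (c : BallCode) : Set B :=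
  Metric.ball (ratVec 𝕜 R c.1) (((c.2.1 : ℝ) + 1) / ((c.2.2 : ℝ) + 1))

/-- The map `T` is an `X`-computable map of `(B₀, R₀)` into `(B₁, R₁)`: there is an algorithm with
oracle `X` that, given a rational ball of `(B₀, R₀)`, either does not halt or produces a rational
ball of `(B₁, R₁)` which contains the image under `T` of the given ball, and that produces
arbitrarily small neighbourhoods of `T v` from balls that contain `v`. -/
def IsComputableMapIn (X : Set ℕ) (R₀ : ℕ → B₀) (R₁ : ℕ → B₁) (T : B₀ → B₁) : Prop :=
  ∃ P : BallCode →. BallCode, RecursiveIn {charFun X} P ∧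
    (∀ c c' : BallCode, c' ∈ P c → T '' ratBall 𝕜 R₀ c ⊆ ratBall 𝕜 R₁ c') ∧
    (∀ v : B₀, ∀ U ∈ 𝓝 (T v), ∃ c c' : BallCode,
      c' ∈ P c ∧ v ∈ ratBall 𝕜 R₀ c ∧ ratBall 𝕜 R₁ c' ⊆ U)

/-- The Turing degree `x` computes the map `T` of `(B₀, R₀)` into `(B₁, R₁)`. (This does not depend
on the choice of the set `X` of degree `x`.) -/
def DegreeComputes (x : TuringDegree) (R₀ : ℕ → B₀) (R₁ : ℕ → B₁) (T : B₀ → B₁) : Prop :=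
  ∃ X : Set ℕ, degree X = x ∧ IsComputableMapIn 𝕜 X R₀ R₁ T

end Presentations

/-! ### The space `ℓ^p_n ⊕ L^p[0,1]` and its standard presentation -/

section Space

variable (𝕜 : Type*) [RCLike 𝕜] (p : ℝ≥0∞) (n : ℕ)

/-- The space `ℓ^p_n`. -/
abbrev SmallLp := PiLp p (fun _ : Fin n => 𝕜)

/-- The space `L^p[0,1]`. -/
abbrev LpUnit := Lp 𝕜 p (volume.restrict (Set.Icc (0 : ℝ) 1))

/-- The `L^p`-sum `ℓ^p_n ⊕ L^p[0,1]`. -/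
abbrev HybridLp := WithLp p (SmallLp 𝕜 p n × LpUnit 𝕜 p)

/-- The characteristic function of the dyadic interval `[j / 2 ^ k, (j + 1) / 2 ^ k]`, as a vector
of `L^p[0,1]`. -/
def dyadicIndicator (k j : ℕ) : LpUnit 𝕜 p :=
  indicatorConstLp p
    (measurableSet_Icc (a := (j : ℝ) / 2 ^ k) (b := ((j : ℝ) + 1) / 2 ^ k))
    (measure_ne_top _ _) (1 : 𝕜)

/-- The standard structure on `L^p[0,1]`: `m`, read as a pair `(k, j)`, is sent to the characteristic
function of the dyadic subinterval of `[0,1]` of length `2 ^ (-k)` with index `j mod 2 ^ k`. -/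
def standardLpUnit (m : ℕ) : LpUnit 𝕜 p :=
  dyadicIndicator 𝕜 p m.unpair.1 (m.unpair.2 % 2 ^ m.unpair.1)

/-- The standard structure on `ℓ^p_n ⊕ L^p[0,1]`: first the standard basis vectors `(e_j, 0)` for
`j < n`, then the vectors `(0, g)` for `g` in the standard structure on `L^p[0,1]`. -/
def standardHybrid (m : ℕ) : HybridLp 𝕜 p n :=
  if h : m < n then
    WithLp.toLp p (WithLp.toLp p (Pi.single (⟨m, h⟩ : Fin n) (1 : 𝕜)), 0)
  else
    WithLp.toLp p (0, standardLpUnit 𝕜 p (m - n))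

end Space

end

end CompBanach

/-! Let A be a c.e. set in the given degree and put m = 3/4 - ∑_{k ∈ A} 2^(-(k+2)), a real number in
(0,1). Enumerating A yields rational approximations to m from above. Lower bounds for m decide A:
once a stage s > k is known to have approximation below m + 2^(-(k+2)), the number k cannot enter A
later, since its entry would push the approximations below m (`exists_cutReal`). It remains to build
a computable presentation from which every isometry reveals lower bounds for m.

In L^p[0,1] consider the functions that are constant on [0,m]. There [0,m] acts as an atom of mass m
and [m,1] is a rescaled copy of [0,1], so together with the remaining basis vectors of the ℓ^p
summand this is a copy of the given space. Take as structure the constant function 1, the remaining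
basis vectors, and the indicators of (q,1] for rational q in (m,1); these q can be enumerated from
the upper cut of m (`cutStructure`). A rational vector is then an ordinary step function with
rational breakpoints, plus finitely many rational coordinates, and its norm can be computed without
knowledge of m (`norm_rpow_ratVec_cutStructure`, `compReal_norm_ratVec`). The unit atom e_0,
however, is hidden: the coefficient α of the constant function contributes the coordinate α m^(1/p).

For p ≠ 2 the equality case of Clarkson's inequality characterizes disjointness by norms
(`disjointVec_iff`), so isometries preserve disjointness. A basis vector is not a sum of two
disjoint nonzero vectors, while nonzero vectors of L^p[0,1] always are. Hence some e_j is sent to a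
unimodular multiple θ e_0, and (T u)_0 = θ u_j for all u (`exists_coordinate_of_isometry`). If a
computation of T sends a ball to a ball of radius r', then the centres' coefficients satisfy ||α| -
|α'| m^(1/p)| < r'. This produces rational lower bounds for m^(1/p) (`lt_root_of_ballsCertify`),
arbitrarily good ones near e_j (`exists_ballsCertify`). So the oracle enumerates the lower cut of m
and decides A.

On the recursion-theoretic side, a halting oracle computation consults only an initial segment of
the oracle (`exists_functional`), which turns the argument into an unbounded search
(`turingReducible_of_search`). -/

open MeasureTheory
open scoped ENNReal Topology

namespace CompBanach

/-! ### Semidecidable predicates -/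

section Semi

variable {α β γ : Type*} [Primcodable α] [Primcodable β] [Primcodable γ]

/-- A predicate is semidecidable if it is the projection of a decidable relation. -/
def Semi (P : α → Prop) : Prop :=
  ∃ D : α × ℕ → Bool, Computable D ∧ ∀ a, P a ↔ ∃ n, D (a, n) = true

theorem Semi.of_eq {P Q : α → Prop} (hP : Semi P) (h : ∀ a, P a ↔ Q a) : Semi Q := by
  obtain rfl : P = Q := funext fun a => propext (h a)
  exact hP

theorem Semi.of_primrec {P : α → Prop} (hP : PrimrecPred P) : Semi P := by
  obtain ⟨i, hi⟩ := hP
  exact ⟨fun x => decide (P x.1), hi.to_comp.comp Computable.fst, fun a => by simp⟩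

theorem Semi.comp {P : β → Prop} (hP : Semi P) {f : α → β} (hf : Computable f) :
    Semi fun a => P (f a) := by
  obtain ⟨D, hD, h⟩ := hP
  exact ⟨fun x => D (f x.1, x.2), hD.comp ((hf.comp .fst).pair .snd), fun a => h _⟩

/-- Dovetailing: one natural number codes both a candidate witness and a stage that confirms it. -/
theorem Semi.exists {P : α × β → Prop} (hP : Semi P) : Semi fun a => ∃ b, P (a, b) := by
  obtain ⟨D, hD, h⟩ := hP
  refine ⟨fun x => ((Encodable.decode (α := β) x.2.unpair.1).map
    fun b => D ((x.1, b), x.2.unpair.2)).getD false, ?_, fun a => ?_⟩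
  · refine Computable.option_getD (Computable.option_map ?_ ?_) (Computable.const false)
    · exact Computable.decode.comp (Computable.fst.comp (Computable.unpair.comp .snd))
    · exact hD.comp (((Computable.fst.comp .fst).pair .snd).pair
        (Computable.snd.comp (Computable.unpair.comp (Computable.snd.comp .fst))))
  · constructor
    · rintro ⟨b, hb⟩
      obtain ⟨n, hn⟩ := (h _).1 hb
      exact ⟨Nat.pair (Encodable.encode b) n, by simpa using hn⟩
    · rintro ⟨n, hn⟩
      dsimp only at hn
      cases hb : (Encodable.decode (α := β) n.unpair.1) with
      | none => simp [hb] at hn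
      | some b => exact ⟨b, (h _).2 ⟨n.unpair.2, by simpa [hb] using hn⟩⟩

theorem Semi.and {P Q : α → Prop} (hP : Semi P) (hQ : Semi Q) : Semi fun a => P a ∧ Q a := by
  obtain ⟨D, hD, h⟩ := hP
  obtain ⟨E, hE, h'⟩ := hQ
  refine ⟨fun x => D (x.1, x.2.unpair.1) && E (x.1, x.2.unpair.2), ?_, fun a => ?_⟩
  · exact (Primrec.and.to_comp).comp
      (hD.comp (Computable.fst.pair (Computable.fst.comp (Computable.unpair.comp .snd))))
      (hE.comp (Computable.fst.pair (Computable.snd.comp (Computable.unpair.comp .snd))))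
  · simp only [h, h']
    constructor
    · rintro ⟨⟨n, hn⟩, k, hk⟩
      exact ⟨Nat.pair n k, by simp [hn, hk]⟩
    · rintro ⟨n, hn⟩
      rw [Bool.and_eq_true] at hn
      exact ⟨⟨_, hn.1⟩, _, hn.2⟩

/-- Effective choice by unbounded search. -/
theorem Semi.choice {P : α × β → Prop} (hP : Semi P) (h : ∀ a, ∃ b, P (a, b)) :
    ∃ f : α → β, Computable f ∧ ∀ a, P (a, f a) := by
  obtain ⟨D, hD, hPD⟩ := hP
  let F : α → ℕ → Option β := fun a n => (Encodable.decode (α := β) n.unpair.1).bind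
    fun b => cond (D ((a, b), n.unpair.2)) (some b) none
  have hF : Computable₂ F := by
    refine Computable.option_bind ?_ ?_
    · exact Computable.decode.comp (Computable.fst.comp (Computable.unpair.comp .snd))
    · refine Computable.cond (hD.comp (((Computable.fst.comp (Computable.fst)).pair .snd).pair
        (Computable.snd.comp (Computable.unpair.comp (Computable.snd.comp .fst)))))
        (Computable.option_some.comp .snd) (Computable.const none)
  have hFP : ∀ {a n b}, b ∈ F a n → P (a, b) := by
    intro a n b hb
    simp only [F, Option.mem_def, Option.bind_eq_some_iff] at hb
    obtain ⟨b', -, hb'⟩ := hb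
    cases hd : D ((a, b'), n.unpair.2) with
    | false => simp [hd] at hb'
    | true =>
      rw [hd] at hb'
      obtain rfl : b' = b := by simpa using hb'
      exact (hPD _).2 ⟨_, hd⟩
  have hdom : ∀ a, (Nat.rfindOpt (F a)).Dom := by
    intro a
    rw [Nat.rfindOpt_dom]
    obtain ⟨b, hb⟩ := h a
    obtain ⟨n, hn⟩ := (hPD _).1 hb
    exact ⟨Nat.pair (Encodable.encode b) n, b, by simp [F, hn]⟩
  refine ⟨fun a => (Nat.rfindOpt (F a)).get (hdom a),
    (Partrec.rfindOpt hF).of_eq_tot fun a => Part.get_mem _, fun a => ?_⟩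
  obtain ⟨n, hn⟩ := Nat.rfindOpt_spec (Part.get_mem (hdom a))
  exact hFP hn

/-- The graph of a partial recursive function is semidecidable. -/
theorem Semi.graph {f : α →. β} (hf : Partrec f) : Semi fun x : α × β => x.2 ∈ f x.1 := by
  obtain ⟨c, hc⟩ := Nat.Partrec.Code.exists_code.1 hf
  -- The stage is the resource bound of `evaln`, which makes the simulation total and primitive
  -- recursive.
  refine ⟨fun x => decide (Nat.Partrec.Code.evaln x.2 c (Encodable.encode x.1.1) =
    some (Encodable.encode x.1.2)), ?_, fun x => ?_⟩
  · refine Primrec.to_comp (Primrec.eq.decide.comp ?_ ?_)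
    · exact Nat.Partrec.Code.primrec_evaln.comp
        ((Primrec.snd.pair (Primrec.const c)).pair
          (Primrec.encode.comp (Primrec.fst.comp .fst)))
    · exact Primrec.option_some.comp (Primrec.encode.comp (Primrec.snd.comp .fst))
  · have := Nat.Partrec.Code.evaln_complete (c := c) (n := Encodable.encode x.1)
      (x := Encodable.encode x.2)
    simp only [decide_eq_true_eq]
    rw [hc] at this
    simpa using this

theorem _root_.REPred.semi {P : α → Prop} (hP : REPred P) : Semi P := by
  have := Semi.graph hP
  refine (this.comp (Computable.id.pair (Computable.const ()))).of_eq fun a => ?_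
  simp [Part.mem_assert_iff]

/-- A nonempty semidecidable predicate is the range of a computable sequence. -/
theorem Semi.enumeration {P : α → Prop} (hP : Semi P) (a₀ : α) (h₀ : P a₀) :
    ∃ f : ℕ → α, Computable f ∧ ∀ a, P a ↔ ∃ n, f n = a := by
  obtain ⟨D, hD, h⟩ := hP
  -- An index that does not code an element together with a confirming stage outputs `a₀`, which is
  -- harmless because `P a₀` holds.
  refine ⟨fun n => ((Encodable.decode (α := α) n.unpair.1).bind
    fun b => cond (D (b, n.unpair.2)) (some b) none).getD a₀, ?_, fun a => ?_⟩
  · refine Computable.option_getD (Computable.option_bind ?_ ?_) (Computable.const a₀)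
    · exact Computable.decode.comp (Computable.fst.comp Computable.unpair)
    · exact Computable.cond (hD.comp (Computable.snd.pair
        (Computable.snd.comp (Computable.unpair.comp .fst))))
        (Computable.option_some.comp .snd) (Computable.const none)
  · constructor
    · intro ha
      obtain ⟨n, hn⟩ := (h a).1 ha
      exact ⟨Nat.pair (Encodable.encode a) n, by simp [hn]⟩
    · rintro ⟨n, rfl⟩
      cases hb : (Encodable.decode (α := α) n.unpair.1) with
      | none => simpa [hb] using h₀
      | some b =>
        cases hd : D (b, n.unpair.2) with
        | false => simpa [hb, hd] using h₀
        | true => simpa [hb, hd] using (h b).2 ⟨_, hd⟩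

end Semi

/-! ### Primitive recursive arithmetic of integers and rational numbers -/

section Arithmetic

/-- Integers are encoded by n ↦ 2n and -(n+1) ↦ 2n+1. The integer operations below are reduced to
this difference by splitting into positive and negative parts. -/
theorem primrec_natSub_int : Primrec₂ fun a b : ℕ => (a : ℤ) - (b : ℤ) := by
  have h : Primrec fun x : ℕ × ℕ => if x.2 ≤ x.1 then 2 * (x.1 - x.2) else
      2 * (x.2 - x.1 - 1) + 1 := by
    refine Primrec.ite (Primrec.nat_le.comp .snd .fst) ?_ ?_
    · exact Primrec.nat_mul.comp (Primrec.const 2) (Primrec.nat_sub.comp .fst .snd)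
    · exact Primrec.succ.comp (Primrec.nat_mul.comp (Primrec.const 2)
        (Primrec.nat_sub.comp (Primrec.nat_sub.comp .snd .fst) (Primrec.const 1)))
  refine Primrec.encode_iff.1 (h.of_eq fun x => ?_)
  split_ifs with hx
  · have : ((x.1 : ℤ) - x.2) = ((x.1 - x.2 : ℕ) : ℤ) := by omega
    dsimp only; rw [this]; rfl
  · have : ((x.1 : ℤ) - x.2) = Int.negSucc (x.2 - x.1 - 1) := by omega
    dsimp only; rw [this]; rfl

theorem primrec_int_toNat : Primrec Int.toNat := by
  have h : Primrec fun z : ℤ => if Encodable.encode z % 2 = 0 then Encodable.encode z / 2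
      else 0 := by
    refine Primrec.ite (Primrec.eq.comp (Primrec.nat_mod.comp .encode (Primrec.const 2))
      (Primrec.const 0)) (Primrec.nat_div.comp .encode (Primrec.const 2)) (Primrec.const 0)
  refine h.of_eq fun z => ?_
  cases z with
  | ofNat n =>
    have : Encodable.encode (Int.ofNat n) = 2 * n := rfl
    rw [this]; simp
  | negSucc n =>
    have : Encodable.encode (Int.negSucc n) = 2 * n + 1 := rfl
    rw [this, if_neg (by omega)]; simp

theorem primrec_int_neg_toNat : Primrec fun z : ℤ => (-z).toNat := by
  have h : Primrec fun z : ℤ => if Encodable.encode z % 2 = 0 then 0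
      else Encodable.encode z / 2 + 1 := by
    refine Primrec.ite (Primrec.eq.comp (Primrec.nat_mod.comp .encode (Primrec.const 2))
      (Primrec.const 0)) (Primrec.const 0)
      (Primrec.succ.comp (Primrec.nat_div.comp .encode (Primrec.const 2)))
  refine h.of_eq fun z => ?_
  cases z with
  | ofNat n =>
    have : Encodable.encode (Int.ofNat n) = 2 * n := rfl
    rw [this]; simp
  | negSucc n =>
    have : Encodable.encode (Int.negSucc n) = 2 * n + 1 := rfl
    rw [this, if_neg (by omega)]; simp; omega

theorem primrec_natCast_int : Primrec fun n : ℕ => (n : ℤ) :=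
  (primrec_natSub_int.comp .id (Primrec.const 0)).of_eq fun n => by simp

theorem primrec_int_neg : Primrec fun z : ℤ => -z :=
  (primrec_natSub_int.comp primrec_int_neg_toNat primrec_int_toNat).of_eq fun z => by omega

theorem primrec_int_add : Primrec₂ fun z w : ℤ => z + w :=
  (primrec_natSub_int.comp
    (Primrec.nat_add.comp (primrec_int_toNat.comp .fst) (primrec_int_toNat.comp .snd))
    (Primrec.nat_add.comp (primrec_int_neg_toNat.comp .fst)
      (primrec_int_neg_toNat.comp .snd))).of_eq fun x => by push_cast; omega

theorem primrec_int_mul : Primrec₂ fun z w : ℤ => z * w := by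
  refine (primrec_natSub_int.comp
    (Primrec.nat_add.comp
      (Primrec.nat_mul.comp (primrec_int_toNat.comp .fst) (primrec_int_toNat.comp .snd))
      (Primrec.nat_mul.comp (primrec_int_neg_toNat.comp .fst) (primrec_int_neg_toNat.comp .snd)))
    (Primrec.nat_add.comp
      (Primrec.nat_mul.comp (primrec_int_toNat.comp .fst) (primrec_int_neg_toNat.comp .snd))
      (Primrec.nat_mul.comp (primrec_int_neg_toNat.comp .fst)
        (primrec_int_toNat.comp .snd)))).of_eq fun x => ?_
  have h1 : x.1 = (x.1.toNat : ℤ) - ((-x.1).toNat : ℤ) := by omega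
  have h2 : x.2 = (x.2.toNat : ℤ) - ((-x.2).toNat : ℤ) := by omega
  conv_rhs => rw [h1, h2]
  push_cast; ring

theorem primrec_int_le : PrimrecRel fun z w : ℤ => z ≤ w :=
  (Primrec.nat_le.comp
    (Primrec.nat_add.comp (primrec_int_toNat.comp .fst) (primrec_int_neg_toNat.comp .snd))
    (Primrec.nat_add.comp (primrec_int_toNat.comp .snd)
      (primrec_int_neg_toNat.comp .fst))).of_eq fun x => by omega

/-- Addition of codes of rational numbers. -/
def ratAdd (x y : RatCode) : RatCode :=
  (x.1 * ((y.2 + 1 : ℕ) : ℤ) + y.1 * ((x.2 + 1 : ℕ) : ℤ), (x.2 + 1) * (y.2 + 1) - 1)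

/-- Multiplication of codes of rational numbers. -/
def ratMul (x y : RatCode) : RatCode := (x.1 * y.1, (x.2 + 1) * (y.2 + 1) - 1)

/-- Negation of codes of rational numbers. -/
def ratNeg (x : RatCode) : RatCode := (-x.1, x.2)

/-- Powers of codes of rational numbers. -/
def ratPow (x : RatCode) (n : ℕ) : RatCode := n.rec (1, 0) fun _ y => ratMul y x

/-- The code `n / (k + 1)`. -/
def ratNat (n k : ℕ) : RatCode := ((n : ℤ), k)

/-- A code stores its denominator minus one; the truncated subtraction is exact because a product of
denominators is positive. -/
theorem natCast_mul_succ_sub_one (a b : ℕ) :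
    (((a + 1) * (b + 1) - 1 : ℕ) : ℚ) + 1 = (a + 1) * (b + 1) := by
  have : 1 ≤ (a + 1) * (b + 1) := Nat.mul_pos (by omega) (by omega)
  rw [Nat.cast_sub this]; push_cast; ring

@[simp] theorem ratVal_ratAdd (x y : RatCode) : ratVal (ratAdd x y) = ratVal x + ratVal y := by
  have h1 : (x.2 : ℚ) + 1 ≠ 0 := by positivity
  have h2 : (y.2 : ℚ) + 1 ≠ 0 := by positivity
  simp only [ratVal, ratAdd, natCast_mul_succ_sub_one]
  push_cast
  field_simp

@[simp] theorem ratVal_ratMul (x y : RatCode) : ratVal (ratMul x y) = ratVal x * ratVal y := by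
  simp only [ratVal, ratMul, natCast_mul_succ_sub_one]
  push_cast
  rw [mul_div_mul_comm]

@[simp] theorem ratVal_ratNeg (x : RatCode) : ratVal (ratNeg x) = -ratVal x := by
  simp [ratVal, ratNeg, neg_div]

@[simp] theorem ratVal_one : ratVal (1, 0) = 1 := by simp [ratVal]

@[simp] theorem ratVal_zero : ratVal (0, 0) = 0 := by simp [ratVal]

@[simp] theorem ratVal_ratPow (x : RatCode) (n : ℕ) : ratVal (ratPow x n) = ratVal x ^ n := by
  induction n with
  | zero => simp [ratPow]
  | succ n ih =>
    have : ratPow x (n + 1) = ratMul (ratPow x n) x := rfl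
    rw [this, ratVal_ratMul, ih, pow_succ]

@[simp] theorem ratVal_ratNat (n k : ℕ) : ratVal (ratNat n k) = (n : ℚ) / (k + 1) := by
  simp [ratVal, ratNat]

theorem ratVal_surjective : Function.Surjective ratVal := by
  intro q
  refine ⟨(q.num, q.den - 1), ?_⟩
  have : 1 ≤ q.den := q.pos
  simp only [ratVal]
  rw [Nat.cast_sub this]
  simp [Rat.num_div_den]

theorem primrec_ratAdd : Primrec₂ ratAdd := by
  refine Primrec.pair (primrec_int_add.comp ?_ ?_) (Primrec.nat_sub.comp (Primrec.nat_mul.comp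
    ?_ ?_) (Primrec.const 1))
  · exact primrec_int_mul.comp (Primrec.fst.comp .fst)
      (primrec_natCast_int.comp (Primrec.succ.comp (Primrec.snd.comp .snd)))
  · exact primrec_int_mul.comp (Primrec.fst.comp .snd)
      (primrec_natCast_int.comp (Primrec.succ.comp (Primrec.snd.comp .fst)))
  · exact Primrec.succ.comp (Primrec.snd.comp .fst)
  · exact Primrec.succ.comp (Primrec.snd.comp .snd)

theorem primrec_ratMul : Primrec₂ ratMul := by
  refine Primrec.pair (primrec_int_mul.comp (Primrec.fst.comp .fst) (Primrec.fst.comp .snd))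
    (Primrec.nat_sub.comp (Primrec.nat_mul.comp ?_ ?_) (Primrec.const 1))
  · exact Primrec.succ.comp (Primrec.snd.comp .fst)
  · exact Primrec.succ.comp (Primrec.snd.comp .snd)

theorem primrec_ratNeg : Primrec ratNeg :=
  Primrec.pair (primrec_int_neg.comp .fst) .snd

theorem primrec_ratPow : Primrec₂ ratPow :=
  Primrec.nat_rec' Primrec.snd (Primrec.const (1, 0))
    (primrec_ratMul.comp (Primrec.snd.comp .snd) (Primrec.fst.comp .fst)).to₂

theorem primrec_ratNat : Primrec₂ ratNat :=
  Primrec.pair (primrec_natCast_int.comp .fst) .snd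

theorem primrec_ratVal_le : PrimrecRel fun x y : RatCode => ratVal x ≤ ratVal y := by
  refine (primrec_int_le.comp
    (primrec_int_mul.comp (Primrec.fst.comp .fst)
      (primrec_natCast_int.comp (Primrec.succ.comp (Primrec.snd.comp .snd))))
    (primrec_int_mul.comp (Primrec.fst.comp .snd)
      (primrec_natCast_int.comp (Primrec.succ.comp (Primrec.snd.comp .fst))))).of_eq
    fun x => ?_
  have h1 : (0 : ℚ) < (x.1.2 : ℚ) + 1 := by positivity
  have h2 : (0 : ℚ) < (x.2.2 : ℚ) + 1 := by positivity
  simp only [ratVal]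
  rw [div_le_div_iff₀ h1 h2]
  exact_mod_cast Iff.rfl

theorem primrec_ratVal_lt : PrimrecRel fun x y : RatCode => ratVal x < ratVal y :=
  (PrimrecPred.not (primrec_ratVal_le.comp .snd .fst)).of_eq fun _ => not_le

/-- The code of `2 ^ (-k)`. -/
def ratHalfPow (k : ℕ) : RatCode := ratPow (1, 1) k

@[simp] theorem ratVal_ratHalfPow (k : ℕ) : ratVal (ratHalfPow k) = (2⁻¹ : ℚ) ^ k := by
  rw [ratHalfPow, ratVal_ratPow]; norm_num [ratVal]

theorem primrec_ratHalfPow : Primrec ratHalfPow := primrec_ratPow.comp (Primrec.const _) .id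

/-- Finite sums of codes of rational numbers. -/
def ratSum (x : ℕ → RatCode) (N : ℕ) : RatCode := N.rec (0, 0) fun i s => ratAdd s (x i)

@[simp] theorem ratVal_ratSum (x : ℕ → RatCode) (N : ℕ) :
    ratVal (ratSum x N) = ∑ i ∈ Finset.range N, ratVal (x i) := by
  induction N with
  | zero => simp [ratSum]
  | succ N ih =>
    have : ratSum x (N + 1) = ratAdd (ratSum x N) (x N) := rfl
    rw [this, ratVal_ratAdd, ih, Finset.sum_range_succ]

theorem computable_ratSum {α : Type*} [Primcodable α] {x : α → ℕ → RatCode} (hx : Computable₂ x)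
    {N : α → ℕ} (hN : Computable N) : Computable fun a => ratSum (x a) (N a) := by
  have h : Computable₂ fun (a : α) (y : ℕ × RatCode) => ratAdd y.2 (x a y.1) :=
    primrec_ratAdd.to_comp.comp (Computable.snd.comp .snd)
      (hx.comp .fst (Computable.fst.comp .snd))
  exact Computable.nat_rec hN (Computable.const (0, 0)) h

end Arithmetic

/-! ### Computations with an oracle -/

section Oracle

/-- The list of the first `l` values of `g`. -/
def initialSegment (g : ℕ → ℕ) (l : ℕ) : List ℕ := (List.range l).map g

theorem getElem?_initialSegment (g : ℕ → ℕ) {l a : ℕ} (h : a < l) :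
    (initialSegment g l)[a]? = some (g a) := by
  simp [initialSegment, h]

theorem eq_of_mem_getElem?_initialSegment (g : ℕ → ℕ) {l a b : ℕ}
    (h : b ∈ (initialSegment g l)[a]?) : b = g a := by
  simp only [initialSegment, List.getElem?_map, Option.mem_def, Option.map_eq_some_iff] at h
  obtain ⟨c, hc, rfl⟩ := h
  rw [List.getElem?_eq_some_iff] at hc
  obtain ⟨_, hc⟩ := hc
  simp at hc
  rw [hc]

/-- A function which is recursive in an oracle is the limit of a partial recursive functional
applied to the initial segments of the oracle. -/
theorem exists_functional (g : ℕ → ℕ) {f : ℕ →. ℕ}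
    (hf : Nat.RecursiveIn {fun n => Part.some (g n)} f) :
    ∃ Φ : List ℕ → ℕ →. ℕ, Partrec₂ Φ ∧
      (∀ l a b, b ∈ Φ (initialSegment g l) a → b ∈ f a) ∧
      ∀ a b, b ∈ f a → ∀ᶠ l in Filter.atTop, b ∈ Φ (initialSegment g l) a := by
  induction hf with
  | zero =>
    exact ⟨fun _ => (pure 0 : ℕ →. ℕ), (Computable.const 0).partrec, fun _ _ _ h => h,
      fun _ _ h => Filter.Eventually.of_forall fun _ => h⟩
  | succ =>
    exact ⟨fun _ => Nat.succ, (Computable.succ.comp .snd).partrec, fun _ _ _ h => h,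
      fun _ _ h => Filter.Eventually.of_forall fun _ => h⟩
  | left =>
    exact ⟨fun _ n => Part.some n.unpair.1, (Computable.fst.comp
      (Computable.unpair.comp .snd)).partrec, fun _ _ _ h => h,
      fun _ _ h => Filter.Eventually.of_forall fun _ => h⟩
  | right =>
    exact ⟨fun _ n => Part.some n.unpair.2, (Computable.snd.comp
      (Computable.unpair.comp .snd)).partrec, fun _ _ _ h => h,
      fun _ _ h => Filter.Eventually.of_forall fun _ => h⟩
  | oracle f hf =>
    obtain rfl : f = _ := hf
    -- A query beyond the end of the segment diverges, so short segments never give wrong answers.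
    refine ⟨fun σ a => (σ[a]? : Part ℕ), (Computable.list_getElem?.comp .fst .snd).ofOption, ?_, ?_⟩
    · intro l a b h
      rw [Part.mem_ofOption] at h
      exact Part.mem_some_iff.2 (eq_of_mem_getElem?_initialSegment g h)
    · intro a b h
      rw [Part.mem_some_iff] at h
      filter_upwards [Filter.eventually_gt_atTop a] with l hl
      rw [Part.mem_ofOption, getElem?_initialSegment g hl, h]
      rfl
  | @pair f h _ _ ihf ihh =>
    obtain ⟨Φ, hΦ, hΦ1, hΦ2⟩ := ihf
    obtain ⟨Ψ, hΨ, hΨ1, hΨ2⟩ := ihh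
    have key : ∀ (f h : ℕ →. ℕ) (n b : ℕ), b ∈ (Nat.pair <$> f n <*> h n) ↔
        ∃ x ∈ f n, ∃ y ∈ h n, b = Nat.pair x y := by
      intro f h n b
      simp [Seq.seq, eq_comm]
    refine ⟨fun σ n => Nat.pair <$> Φ σ n <*> Ψ σ n, ?_, ?_, ?_⟩
    · refine (Partrec.bind hΦ (Partrec.map (f := fun x : (List ℕ × ℕ) × ℕ => Ψ x.1.1 x.1.2)
        (g := fun x y => Nat.pair x.2 y) ?_ ?_).to₂).of_eq fun x => ?_
      · exact hΨ.comp (Computable.fst.comp .fst) (Computable.snd.comp .fst)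
      · exact (Primrec₂.natPair.to_comp).comp (Computable.snd.comp .fst) .snd
      · apply Part.ext
        intro b
        rw [key]
        simp [eq_comm]
    · intro l a b hb
      rw [key] at hb ⊢
      obtain ⟨x, hx, y, hy, rfl⟩ := hb
      exact ⟨x, hΦ1 _ _ _ hx, y, hΨ1 _ _ _ hy, rfl⟩
    · intro a b hb
      rw [key] at hb
      obtain ⟨x, hx, y, hy, rfl⟩ := hb
      filter_upwards [hΦ2 _ _ hx, hΨ2 _ _ hy] with l h1 h2
      rw [key]
      exact ⟨x, h1, y, h2, rfl⟩
  | @comp f h _ _ ihf ihh =>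
    obtain ⟨Φ, hΦ, hΦ1, hΦ2⟩ := ihf
    obtain ⟨Ψ, hΨ, hΨ1, hΨ2⟩ := ihh
    refine ⟨fun σ n => Ψ σ n >>= Φ σ, ?_, ?_, ?_⟩
    · exact Partrec.bind hΨ (hΦ.comp (Computable.fst.comp .fst) .snd)
    · intro l a b hb
      obtain ⟨x, hx, hb⟩ := Part.mem_bind_iff.1 hb
      exact Part.mem_bind_iff.2 ⟨x, hΨ1 _ _ _ hx, hΦ1 _ _ _ hb⟩
    · intro a b hb
      obtain ⟨x, hx, hb⟩ := Part.mem_bind_iff.1 hb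
      filter_upwards [hΦ2 _ _ hb, hΨ2 _ _ hx] with l h1 h2
      exact Part.mem_bind_iff.2 ⟨x, h2, h1⟩
  | @prec f h _ _ ihf ihh =>
    obtain ⟨Φ, hΦ, hΦ1, hΦ2⟩ := ihf
    obtain ⟨Ψ, hΨ, hΨ1, hΨ2⟩ := ihh
    refine ⟨fun σ p => (p.unpair.2.rec (Φ σ p.unpair.1) fun y IH => IH.bind fun i =>
      Ψ σ (Nat.pair p.unpair.1 (Nat.pair y i)) : Part ℕ), ?_, ?_, ?_⟩
    · refine Partrec.nat_rec (f := fun x : List ℕ × ℕ => x.2.unpair.2)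
        (g := fun x : List ℕ × ℕ => Φ x.1 x.2.unpair.1)
        (h := fun (x : List ℕ × ℕ) (y : ℕ × ℕ) =>
          Ψ x.1 (Nat.pair x.2.unpair.1 (Nat.pair y.1 y.2))) ?_ ?_ ?_
      · exact Computable.snd.comp (Computable.unpair.comp .snd)
      · exact hΦ.comp .fst (Computable.fst.comp (Computable.unpair.comp .snd))
      · refine hΨ.comp (Computable.fst.comp .fst) ?_
        refine Primrec₂.natPair.to_comp.comp
          (Computable.fst.comp (Computable.unpair.comp (Computable.snd.comp .fst))) ?_
        exact Primrec₂.natPair.to_comp.comp (Computable.fst.comp .snd) (Computable.snd.comp .snd)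
    · intro l p b
      dsimp only
      generalize p.unpair.2 = n
      induction n generalizing b with
      | zero => exact hΦ1 _ _ _
      | succ n ih =>
        intro hb
        rw [Part.mem_bind_iff] at hb
        obtain ⟨i, hi, hb⟩ := hb
        exact Part.mem_bind_iff.2 ⟨i, ih _ hi, hΨ1 _ _ _ hb⟩
    · intro p b
      dsimp only
      generalize p.unpair.2 = n
      induction n generalizing b with
      | zero => exact hΦ2 _ _
      | succ n ih =>
        intro hb
        obtain ⟨i, hi, hb⟩ := Part.mem_bind_iff.1 hb
        filter_upwards [ih _ hi, hΨ2 _ _ hb] with l h1 h2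
        exact Part.mem_bind_iff.2 ⟨i, h1, h2⟩
  | @rfind f _ ihf =>
    obtain ⟨Φ, hΦ, hΦ1, hΦ2⟩ := ihf
    refine ⟨fun σ a => Nat.rfind fun n => (fun m => decide (m = 0)) <$> Φ σ (Nat.pair a n),
      ?_, ?_, ?_⟩
    · refine Partrec.rfind (p := fun (x : List ℕ × ℕ) n =>
        (Φ x.1 (Nat.pair x.2 n)).map fun m => decide (m = 0)) (Partrec.map ?_ ?_)
      · exact hΦ.comp (Computable.fst.comp .fst)
          (Primrec₂.natPair.to_comp.comp (Computable.snd.comp .fst) .snd)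
      · exact (Primrec.eq.decide.comp Primrec.snd (Primrec.const 0)).to_comp
    · intro l a b hb
      replace hb := Nat.mem_rfind.1 hb
      refine Nat.mem_rfind.2 ?_
      simp only [Part.map_eq_map, Part.mem_map_iff] at hb ⊢
      refine ⟨?_, fun hm => ?_⟩
      · obtain ⟨m, hm, h⟩ := hb.1
        exact ⟨m, hΦ1 _ _ _ hm, h⟩
      · obtain ⟨m, hm, h⟩ := hb.2 hm
        exact ⟨m, hΦ1 _ _ _ hm, h⟩
    · intro a b hb
      replace hb := Nat.mem_rfind.1 hb
      simp only [Part.map_eq_map, Part.mem_map_iff] at hb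
      obtain ⟨⟨m, hm, h⟩, hb⟩ := hb
      -- A successful search has made finitely many tests, so one sufficiently long segment serves
      -- them all.
      have hb' : ∀ᶠ l in Filter.atTop, ∀ k ∈ Finset.range b,
          ∃ m ∈ Φ (initialSegment g l) (Nat.pair a k), decide (m = 0) = false := by
        rw [Filter.eventually_all_finset]
        intro k hk
        obtain ⟨m, hm, h⟩ := hb (Finset.mem_range.1 hk)
        filter_upwards [hΦ2 _ _ hm] with l hl
        exact ⟨m, hl, h⟩
      filter_upwards [hb', hΦ2 _ _ hm] with l h1 h2
      refine Nat.mem_rfind.2 ?_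
      simp only [Part.map_eq_map, Part.mem_map_iff]
      exact ⟨⟨m, h2, h⟩, fun hk => h1 _ (Finset.mem_range.2 hk)⟩

/-- The graph of a function which is recursive in an oracle is semidecidable from the initial
segments of the oracle. -/
theorem exists_semi_graph {α β : Type*} [Primcodable α] [Primcodable β] (g : ℕ → ℕ) {f : α →. β}
    (hf : RecursiveIn {fun n => Part.some (g n)} f) :
    ∃ S : List ℕ × α × β → Prop, Semi S ∧
      ∀ a b, b ∈ f a ↔ ∃ l, S (initialSegment g l, a, b) := by
  obtain ⟨Φ, hΦ, h1, h2⟩ := exists_functional g hf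
  refine ⟨fun x => Encodable.encode x.2.2 ∈ Φ x.1 (Encodable.encode x.2.1), ?_, fun a b => ?_⟩
  · refine (Semi.graph hΦ).comp (f := fun x : List ℕ × α × β =>
      ((x.1, Encodable.encode x.2.1), Encodable.encode x.2.2)) ?_
    exact (Computable.fst.pair (Computable.encode.comp (Computable.fst.comp .snd))).pair
      (Computable.encode.comp (Computable.snd.comp .snd))
  · constructor
    · intro hb
      exact (h2 (Encodable.encode a) (Encodable.encode b) (by simpa using hb)).exists
    · rintro ⟨l, hl⟩
      simpa using h1 _ _ _ hl

/-- The segment is built by primitive recursion on its length, with one oracle query per step. -/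
theorem recursiveIn_initialSegment (g : ℕ → ℕ) :
    Nat.RecursiveIn {fun n => Part.some (g n)}
      fun l => Part.some (Encodable.encode (initialSegment g l)) := by
  have hO : Nat.RecursiveIn {fun n => Part.some (g n)} fun n => Part.some (g n) :=
    .oracle _ rfl
  have hstep : Nat.Primrec fun n : ℕ => Encodable.encode
      (((Encodable.decode (α := List ℕ) n.unpair.1).getD []) ++ [n.unpair.2]) := by
    rw [← Primrec.nat_iff]
    refine Primrec.encode.comp (Primrec.list_append.comp
      (Primrec.option_getD.comp (Primrec.decode.comp (Primrec.fst.comp Primrec.unpair))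
        (Primrec.const [])) (Primrec.list_cons.comp (Primrec.snd.comp Primrec.unpair)
        (Primrec.const [])))
  have hy : Nat.RecursiveIn {fun n => Part.some (g n)} fun p => Part.some p.unpair.2.unpair.1 :=
    ((Nat.Primrec.left.comp .right)).recursiveIn
  have hi : Nat.RecursiveIn {fun n => Part.some (g n)} fun p => Part.some p.unpair.2.unpair.2 :=
    ((Nat.Primrec.right.comp .right)).recursiveIn
  have hgy := Nat.RecursiveIn.comp hO hy
  have hrec := (Nat.RecursiveIn.prec (f := fun _ => Part.some (Encodable.encode ([] : List ℕ)))
    (Nat.Primrec.const _).recursiveIn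
    (Nat.RecursiveIn.comp hstep.recursiveIn (Nat.RecursiveIn.pair hi hgy))).comp
    (Nat.RecursiveIn.pair (Nat.Primrec.const 0).recursiveIn Nat.Primrec.id.recursiveIn)
  refine hrec.of_eq fun l => ?_
  have : ∀ l : ℕ, (Nat.rec (Part.some (Encodable.encode ([] : List ℕ))) (fun y IH => IH.bind
      fun i => Part.some (Encodable.encode
        (((Encodable.decode (α := List ℕ) i).getD []) ++ [g y]))) l : Part ℕ) =
      Part.some (Encodable.encode (initialSegment g l)) := by
    intro l
    induction l with
    | zero => rfl
    | succ l ih =>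
      simp only [ih]
      simp [initialSegment, List.range_succ]
  rw [← this]
  simp [Seq.seq]

end Oracle

/-! ### Unbounded search relative to an oracle -/

section OracleSearch

variable {O : Set (ℕ →. ℕ)}

theorem natRecursiveIn_comp_computable {F u : ℕ → ℕ} (hF : Computable F)
    (hu : Nat.RecursiveIn O (u : ℕ →. ℕ)) :
    Nat.RecursiveIn O ((fun n => F (u n) : ℕ → ℕ) : ℕ →. ℕ) := by
  refine (Nat.RecursiveIn.comp (Nat.Partrec.recursiveIn (Partrec.nat_iff.1 hF.partrec)) hu).of_eq
    fun n => Part.bind_some _ _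

theorem natRecursiveIn_pair {u v : ℕ → ℕ} (hu : Nat.RecursiveIn O (u : ℕ →. ℕ))
    (hv : Nat.RecursiveIn O (v : ℕ →. ℕ)) :
    Nat.RecursiveIn O ((fun n => Nat.pair (u n) (v n) : ℕ → ℕ) : ℕ →. ℕ) := by
  refine (Nat.RecursiveIn.pair hu hv).of_eq fun n => ?_
  simp [Seq.seq]

/-- Unbounded search with an oracle. -/
theorem natRecursiveIn_search {t : ℕ → ℕ} (ht : Nat.RecursiveIn O (t : ℕ →. ℕ))
    (hex : ∀ k, ∃ N, t (Nat.pair k N) = 0) :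
    ∃ u : ℕ → ℕ, Nat.RecursiveIn O (u : ℕ →. ℕ) ∧ ∀ k, t (Nat.pair k (u k)) = 0 := by
  let q : ℕ → ℕ →. Bool := fun k n => Part.some (decide (t (Nat.pair k n) = 0))
  have hdom : ∀ k, (Nat.rfind (q k)).Dom := by
    intro k
    obtain ⟨N, hN⟩ := hex k
    exact Nat.rfind_dom.2 ⟨N, by simp [q, hN], fun _ => trivial⟩
  refine ⟨fun k => (Nat.rfind (q k)).get (hdom k), ?_, fun k => ?_⟩
  · refine (Nat.RecursiveIn.rfind ht).of_eq_tot fun k => ?_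
    have := Part.get_mem (hdom k)
    simpa [q] using this
  · have := Nat.rfind_spec (Part.get_mem (hdom k))
    simpa [q] using this

/-- The values of the characteristic function of a set. -/
noncomputable def charVal (X : Set ℕ) (n : ℕ) : ℕ := open Classical in if n ∈ X then 1 else 0

theorem charFun_eq (X : Set ℕ) : charFun X = fun n => Part.some (charVal X n) := rfl

/-- A set is reducible to an oracle `X` if membership of `k` can be decided from any `s` that
satisfies a relation to `k` which is semidecidable from initial segments of `X`. -/
theorem turingReducible_of_search {A X : Set ℕ} {S : List ℕ × ℕ × ℕ → Prop} (hS : Semi S)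
    {E : ℕ → ℕ → Bool} (hE : Computable₂ E)
    (hex : ∀ k, ∃ l s, S (initialSegment (charVal X) l, k, s))
    (hdec : ∀ k l s, S (initialSegment (charVal X) l, k, s) → (k ∈ A ↔ E k s = true)) :
    TuringReducible (charFun A) (charFun X) := by
  obtain ⟨D, hD, hSD⟩ := hS
  have hid : Nat.RecursiveIn {charFun X} ((fun n => n : ℕ → ℕ) : ℕ →. ℕ) :=
    Nat.Primrec.id.recursiveIn
  -- The input codes ((k, N), segment) with N = (l, (s, t)): a segment length, a candidate answer
  -- and a stage of `D`. The value 0 signals success.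
  let F : ℕ → ℕ := fun n => cond
      (D ((((Encodable.decode (α := List ℕ) n.unpair.2).getD []), n.unpair.1.unpair.1,
        n.unpair.1.unpair.2.unpair.2.unpair.1), n.unpair.1.unpair.2.unpair.2.unpair.2)) 0 1
  have hF : Computable F := by
    have h1 : Computable fun n : ℕ => n.unpair.1.unpair :=
      Computable.unpair.comp (Computable.fst.comp .unpair)
    have h2 : Computable fun n : ℕ => n.unpair.1.unpair.2.unpair.2.unpair :=
      Computable.unpair.comp (Computable.snd.comp (Computable.unpair.comp (Computable.snd.comp h1)))
    refine Computable.cond (hD.comp ((Computable.pair ?_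
      ((Computable.fst.comp h1).pair (Computable.fst.comp h2))).pair (Computable.snd.comp h2)))
      (Computable.const 0) (Computable.const 1)
    exact Computable.option_getD (Computable.decode.comp (Computable.snd.comp .unpair))
      (Computable.const [])
  have hsegm : Nat.RecursiveIn {charFun X} ((fun p => Encodable.encode
      (initialSegment (charVal X) p.unpair.2.unpair.1) : ℕ → ℕ) : ℕ →. ℕ) := by
    rw [charFun_eq]
    refine ((recursiveIn_initialSegment (charVal X)).comp
      (Nat.Primrec.left.comp .right).recursiveIn).of_eq fun p => ?_
    simp
  obtain ⟨u, hu, hut⟩ := natRecursiveIn_search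
    (natRecursiveIn_comp_computable hF (natRecursiveIn_pair hid hsegm)) (by
      intro k
      obtain ⟨l, s, h⟩ := hex k
      obtain ⟨n, hn⟩ := (hSD _).1 h
      exact ⟨Nat.pair l (Nat.pair s n), by simp [F, hn]⟩)
  let G : ℕ → ℕ := fun n => cond (E n.unpair.1 n.unpair.2.unpair.2.unpair.1) 1 0
  have hG : Computable G := by
    have h2 : Computable fun n : ℕ => n.unpair.2.unpair.2.unpair :=
      Computable.unpair.comp (Computable.snd.comp (Computable.unpair.comp
        (Computable.snd.comp .unpair)))
    exact Computable.cond (hE.comp (Computable.fst.comp .unpair)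
      (Computable.fst.comp h2)) (Computable.const 1) (Computable.const 0)
  have hfin := natRecursiveIn_comp_computable hG (natRecursiveIn_pair hid hu)
  rw [TuringReducible, RecursiveIn.iff_nat, charFun_eq A]
  refine hfin.of_eq fun k => ?_
  have hk : k ∈ A ↔ E k (u k).unpair.2.unpair.1 = true := by
    refine hdec k (u k).unpair.1 _ ((hSD _).2 ⟨(u k).unpair.2.unpair.2, ?_⟩)
    have := hut k
    simp only [F, Nat.unpair_pair, Encodable.encodek, Option.getD_some] at this
    by_contra hne
    rw [Bool.not_eq_true] at hne
    simp [hne] at this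
  refine congrArg Part.some ?_
  simp only [G, Nat.unpair_pair, charVal]
  by_cases hA : k ∈ A
  · simp [hA, hk.1 hA]
  · have : E k (u k).unpair.2.unpair.1 = false := by
      rw [← Bool.not_eq_true]; exact fun h => hA (hk.2 h)
    simp [hA, this]

end OracleSearch

/-! ### Computable families of real numbers -/

section ComputableReals

variable {α β : Type*} [Primcodable α] [Primcodable β]

/-- A family of real numbers is computable if rational approximations to its members can be
computed uniformly. -/
def CompReal (x : α → ℝ) : Prop :=
  ∃ f : α × ℕ → RatCode, Computable f ∧
    ∀ a k, |x a - (ratVal (f (a, k)) : ℝ)| < (2 : ℝ)⁻¹ ^ k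

theorem CompReal.comp {x : α → ℝ} (hx : CompReal x) {g : β → α} (hg : Computable g) :
    CompReal fun b => x (g b) := by
  obtain ⟨f, hf, h⟩ := hx
  exact ⟨fun y => f (g y.1, y.2), hf.comp ((hg.comp .fst).pair .snd), fun b k => h _ _⟩

theorem CompReal.ratVal {q : α → RatCode} (hq : Computable q) :
    CompReal fun a => (ratVal (q a) : ℝ) :=
  ⟨fun y => q y.1, hq.comp .fst, fun a k => by simp⟩

theorem CompReal.const {x : ℝ} (hx : IsComputableReal x) : CompReal fun _ : α => x := by
  obtain ⟨f, hf, h⟩ := hx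
  exact ⟨fun y => f y.2, hf.comp .snd, fun _ k => h k⟩

theorem Semi.ratVal_le {f g : α → RatCode} (hf : Computable f) (hg : Computable g) :
    Semi fun a => CompBanach.ratVal (f a) ≤ CompBanach.ratVal (g a) :=
  (Semi.of_primrec (P := fun w : RatCode × RatCode =>
    CompBanach.ratVal w.1 ≤ CompBanach.ratVal w.2) primrec_ratVal_le).comp
    (f := fun a => (f a, g a)) (hf.pair hg)

theorem Semi.ratVal_lt {f g : α → RatCode} (hf : Computable f) (hg : Computable g) :
    Semi fun a => CompBanach.ratVal (f a) < CompBanach.ratVal (g a) :=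
  (Semi.of_primrec (P := fun w : RatCode × RatCode =>
    CompBanach.ratVal w.1 < CompBanach.ratVal w.2) primrec_ratVal_lt).comp
    (f := fun a => (f a, g a)) (hf.pair hg)

theorem exists_inv_two_pow_lt {ε : ℝ} (hε : 0 < ε) : ∃ k : ℕ, (2 : ℝ)⁻¹ ^ k < ε :=
  exists_pow_lt_of_lt_one hε (by norm_num)

/-- Strict inequality between computable real numbers is semidecidable. -/
theorem CompReal.lt {x y : α → ℝ} (hx : CompReal x) (hy : CompReal y) :
    Semi fun a => x a < y a := by
  obtain ⟨f, hf, hfx⟩ := hx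
  obtain ⟨g, hg, hgy⟩ := hy
  have h : Semi fun z : α × ℕ =>
      CompBanach.ratVal (ratAdd (f z) (ratHalfPow z.2)) ≤
        CompBanach.ratVal (ratAdd (g z) (ratNeg (ratHalfPow z.2))) := by
    exact Semi.ratVal_le
      (primrec_ratAdd.to_comp.comp hf (primrec_ratHalfPow.to_comp.comp .snd))
      (primrec_ratAdd.to_comp.comp hg
        (primrec_ratNeg.to_comp.comp (primrec_ratHalfPow.to_comp.comp .snd)))
  refine h.exists.of_eq fun a => ?_
  have hcast : ∀ k, CompBanach.ratVal (ratAdd (f (a, k)) (ratHalfPow k)) ≤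
      CompBanach.ratVal (ratAdd (g (a, k)) (ratNeg (ratHalfPow k))) ↔
      (CompBanach.ratVal (f (a, k)) : ℝ) + 2⁻¹ ^ k ≤ CompBanach.ratVal (g (a, k)) - 2⁻¹ ^ k := by
    intro k
    rw [← Rat.cast_le (K := ℝ)]
    simp [sub_eq_add_neg]
  simp only [hcast]
  constructor
  · rintro ⟨k, hk⟩
    have h1 := abs_lt.1 (hfx a k)
    have h2 := abs_lt.1 (hgy a k)
    linarith
  · intro hlt
    -- Each side loses 2^(-k) to approximation and another 2^(-k) to the margin in the test, four in
    -- all.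
    obtain ⟨k, hk⟩ := exists_inv_two_pow_lt (show 0 < (y a - x a) / 4 by linarith)
    refine ⟨k, ?_⟩
    have h1 := abs_lt.1 (hfx a k)
    have h2 := abs_lt.1 (hgy a k)
    linarith

/-- A family of real numbers is computable if arbitrarily small enclosures can be enumerated. -/
theorem CompReal.of_enclosure {x : α → ℝ} {P : α × RatCode × RatCode → Prop} (hP : Semi P)
    (hx : ∀ a lo hi, P (a, lo, hi) → (CompBanach.ratVal lo : ℝ) ≤ x a ∧
      x a ≤ CompBanach.ratVal hi)
    (hex : ∀ a (ε : ℝ), 0 < ε → ∃ lo hi, P (a, lo, hi) ∧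
      (CompBanach.ratVal hi : ℝ) - CompBanach.ratVal lo < ε) : CompReal x := by
  let Q : (α × ℕ) × RatCode × RatCode → Prop := fun z => P (z.1.1, z.2) ∧
    CompBanach.ratVal z.2.2 < CompBanach.ratVal (ratAdd z.2.1 (ratHalfPow z.1.2))
  have hQ : Semi Q := by
    refine (hP.comp (f := fun z : (α × ℕ) × RatCode × RatCode => (z.1.1, z.2))
      ((Computable.fst.comp .fst).pair .snd)).and ?_
    exact Semi.ratVal_lt (Computable.snd.comp .snd) (primrec_ratAdd.to_comp.comp
      (Computable.fst.comp .snd) (primrec_ratHalfPow.to_comp.comp (Computable.snd.comp .fst)))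
  obtain ⟨f, hf, h⟩ := hQ.choice (by
    rintro ⟨a, k⟩
    obtain ⟨lo, hi, h1, h2⟩ := hex a ((2 : ℝ)⁻¹ ^ k) (by positivity)
    refine ⟨(lo, hi), h1, ?_⟩
    rw [← Rat.cast_lt (K := ℝ)]
    simp
    simp at h2
    linarith)
  refine ⟨fun z => (f z).1, Computable.fst.comp hf, fun a k => ?_⟩
  obtain ⟨h1, h2⟩ := h (a, k)
  have h3 := hx _ _ _ h1
  dsimp only at h2
  rw [← Rat.cast_lt (K := ℝ)] at h2
  simp only [ratVal_ratAdd, ratVal_ratHalfPow] at h2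
  push_cast at h2
  rw [abs_lt]
  have : (0 : ℝ) < 2⁻¹ ^ k := by positivity
  constructor <;> linarith

/-- A family of real numbers is computable if both of its cuts are semidecidable. -/
theorem CompReal.of_cuts {x : α → ℝ}
    (hlo : Semi fun z : α × RatCode => (CompBanach.ratVal z.2 : ℝ) < x z.1)
    (hhi : Semi fun z : α × RatCode => x z.1 < (CompBanach.ratVal z.2 : ℝ)) : CompReal x := by
  refine CompReal.of_enclosure (P := fun z : α × RatCode × RatCode =>
    (CompBanach.ratVal z.2.1 : ℝ) < x z.1 ∧ x z.1 < (CompBanach.ratVal z.2.2 : ℝ)) ?_ ?_ ?_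
  · exact (hlo.comp (f := fun z : α × RatCode × RatCode => (z.1, z.2.1))
      (Computable.fst.pair (Computable.fst.comp .snd))).and
      (hhi.comp (f := fun z : α × RatCode × RatCode => (z.1, z.2.2))
      (Computable.fst.pair (Computable.snd.comp .snd)))
  · exact fun a lo hi h => ⟨h.1.le, h.2.le⟩
  · intro a ε hε
    obtain ⟨q, hq1, hq2⟩ := exists_rat_btwn (show x a - ε / 2 < x a by linarith)
    obtain ⟨r, hr1, hr2⟩ := exists_rat_btwn (show x a < x a + ε / 2 by linarith)
    obtain ⟨q, rfl⟩ := ratVal_surjective q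
    obtain ⟨r, rfl⟩ := ratVal_surjective r
    exact ⟨q, r, ⟨hq2, hr1⟩, by linarith⟩

theorem CompReal.sum {x : α → ℕ → ℝ} (hx : CompReal fun z : α × ℕ => x z.1 z.2) {N : α → ℕ}
    (hN : Computable N) : CompReal fun a => ∑ i ∈ Finset.range (N a), x a i := by
  obtain ⟨f, hf, h⟩ := hx
  -- Computing each term to `N` extra bits suffices, because N 2^(-N) < 1.
  refine ⟨fun z => ratSum (fun i => f ((z.1, i), z.2 + N z.1)) (N z.1), ?_, fun a k => ?_⟩
  · refine computable_ratSum (x := fun (z : α × ℕ) i => f ((z.1, i), z.2 + N z.1)) ?_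
      (hN.comp .fst)
    refine hf.comp (((Computable.fst.comp .fst).pair .snd).pair ?_)
    exact Primrec.nat_add.to_comp.comp (Computable.snd.comp .fst)
      (hN.comp (Computable.fst.comp .fst))
  · simp only [ratVal_ratSum, Rat.cast_sum]
    rw [← Finset.sum_sub_distrib]
    refine (Finset.abs_sum_le_sum_abs _ _).trans_lt ?_
    calc _ ≤ ∑ i ∈ Finset.range (N a), (2 : ℝ)⁻¹ ^ (k + N a) :=
          Finset.sum_le_sum fun i _ => (h (a, i) _).le
      _ = (N a * 2⁻¹ ^ N a) * 2⁻¹ ^ k := by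
          rw [Finset.sum_const, Finset.card_range, nsmul_eq_mul, pow_add]; ring
      _ < 1 * 2⁻¹ ^ k := by
          refine mul_lt_mul_of_pos_right ?_ (by positivity)
          rw [inv_pow, ← div_eq_mul_inv, div_lt_one (by positivity)]
          exact_mod_cast Nat.lt_two_pow_self
      _ = _ := one_mul _

theorem CompReal.add {x y : α → ℝ} (hx : CompReal x) (hy : CompReal y) :
    CompReal fun a => x a + y a := by
  obtain ⟨f, hf, hfx⟩ := hx
  obtain ⟨g, hg, hgy⟩ := hy
  have hs : Computable fun z : α × ℕ => (z.1, z.2 + 1) :=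
    Computable.fst.pair (Computable.succ.comp .snd)
  refine ⟨fun z => ratAdd (f (z.1, z.2 + 1)) (g (z.1, z.2 + 1)),
    primrec_ratAdd.to_comp.comp (hf.comp hs) (hg.comp hs), fun a k => ?_⟩
  have h1 := abs_lt.1 (hfx a (k + 1))
  have h2 := abs_lt.1 (hgy a (k + 1))
  rw [pow_succ] at h1 h2
  simp only [ratVal_ratAdd, Rat.cast_add]
  rw [abs_lt]
  constructor <;> linarith

/-- The `(u / (v + 1))`-th power of `q` lies between `lo` and `hi`, expressed by integer powers. -/
def PowBetween (q lo hi : RatCode) (u v : ℕ) : Prop :=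
  ratVal (ratPow lo (v + 1)) ≤ ratVal (ratPow q u) ∧
    ratVal (ratPow q u) ≤ ratVal (ratPow hi (v + 1))

theorem primrec_powBetween :
    PrimrecPred fun z : (RatCode × RatCode × RatCode) × ℕ × ℕ =>
      PowBetween z.1.1 z.1.2.1 z.1.2.2 z.2.1 z.2.2 := by
  have hv : Primrec fun z : (RatCode × RatCode × RatCode) × ℕ × ℕ => z.2.2 + 1 :=
    Primrec.succ.comp (Primrec.snd.comp .snd)
  have hu : Primrec fun z : (RatCode × RatCode × RatCode) × ℕ × ℕ => z.2.1 :=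
    Primrec.fst.comp .snd
  have hq : Primrec fun z : (RatCode × RatCode × RatCode) × ℕ × ℕ => ratPow z.1.1 z.2.1 :=
    primrec_ratPow.comp (Primrec.fst.comp .fst) hu
  exact (primrec_ratVal_le.comp (primrec_ratPow.comp
      (Primrec.fst.comp (Primrec.snd.comp .fst)) hv) hq).and
    (primrec_ratVal_le.comp hq (primrec_ratPow.comp
      (Primrec.snd.comp (Primrec.snd.comp .fst)) hv))

/-- Raising to the power v + 1 is monotone on nonnegative numbers, so bounds on a rational power
become decidable inequalities between integer powers. -/
theorem powBetween_iff {q lo hi : RatCode} {u v : ℕ} (hq : 0 ≤ ratVal q) (hlo : 0 ≤ ratVal lo)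
    (hhi : 0 ≤ ratVal hi) : PowBetween q lo hi u v ↔
      (ratVal lo : ℝ) ≤ (ratVal q : ℝ) ^ ((u : ℝ) / (v + 1)) ∧
        (ratVal q : ℝ) ^ ((u : ℝ) / (v + 1)) ≤ ratVal hi := by
  have hv : (0 : ℝ) < (v : ℝ) + 1 := by positivity
  have hq' : (0 : ℝ) ≤ ratVal q := by exact_mod_cast hq
  have hpow : ((ratVal q : ℝ) ^ ((u : ℝ) / (v + 1))) ^ (v + 1) = (ratVal q : ℝ) ^ u := by
    rw [← Real.rpow_natCast, ← Real.rpow_mul hq']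
    push_cast
    rw [div_mul_cancel₀ _ hv.ne', Real.rpow_natCast]
  have hnn : 0 ≤ (ratVal q : ℝ) ^ ((u : ℝ) / (v + 1)) := Real.rpow_nonneg hq' _
  have hlo' : (0 : ℝ) ≤ ratVal lo := by exact_mod_cast hlo
  have hhi' : (0 : ℝ) ≤ ratVal hi := by exact_mod_cast hhi
  rw [PowBetween, ← pow_le_pow_iff_left₀ hlo' hnn (Nat.succ_ne_zero v),
    ← pow_le_pow_iff_left₀ hnn hhi' (Nat.succ_ne_zero v), hpow]
  simp only [ratVal_ratPow]
  constructor
  · rintro ⟨h1, h2⟩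
    exact ⟨by exact_mod_cast h1, by exact_mod_cast h2⟩
  · rintro ⟨h1, h2⟩
    exact ⟨by exact_mod_cast h1, by exact_mod_cast h2⟩

theorem exists_natRat_btwn {a b : ℝ} (ha : 0 ≤ a) (hab : a < b) :
    ∃ u v : ℕ, a < (u : ℝ) / (v + 1) ∧ (u : ℝ) / (v + 1) < b := by
  obtain ⟨q, hq1, hq2⟩ := exists_rat_btwn hab
  have hq : 0 < q := by exact_mod_cast ha.trans_lt hq1
  have hqe : (q : ℝ) = (q.num.toNat : ℝ) / ((q.den - 1 : ℕ) + 1) := by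
    have h1 : 1 ≤ q.den := q.pos
    have h2 : 0 < q.num := Rat.num_pos.2 hq
    rw [Nat.cast_sub h1]
    have h3 : ((q.num.toNat : ℕ) : ℝ) = (q.num : ℝ) := by
      exact_mod_cast Int.toNat_of_nonneg h2.le
    rw [h3]
    push_cast
    rw [sub_add_cancel]
    exact_mod_cast (Rat.num_div_den q).symm
  exact ⟨_, _, hqe ▸ hq1, hqe ▸ hq2⟩

/-- Powers of nonnegative rational numbers with a computable positive exponent are computable. -/
theorem CompReal.rpow {q : α → RatCode} (hq : Computable q)
    (hq0 : ∀ a, 0 ≤ CompBanach.ratVal (q a)) {ρ : ℝ} (hρ : CompReal fun _ : Unit => ρ)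
    (hρ0 : 0 < ρ) : CompReal fun a => (CompBanach.ratVal (q a) : ℝ) ^ ρ := by
  -- Real powers are monotone in the exponent, increasing or decreasing according to the base, so
  -- bounds valid at rational exponents on both sides of ρ are valid at ρ.
  let P : (α × RatCode × RatCode) × (ℕ × ℕ) × (ℕ × ℕ) → Prop := fun z =>
    ((CompBanach.ratVal (ratNat z.2.1.1 z.2.1.2) : ℝ) < ρ ∧
      ρ < (CompBanach.ratVal (ratNat z.2.2.1 z.2.2.2) : ℝ)) ∧
    (CompBanach.ratVal (0, 0) ≤ CompBanach.ratVal z.1.2.1 ∧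
      CompBanach.ratVal (0, 0) ≤ CompBanach.ratVal z.1.2.2) ∧
    PowBetween (q z.1.1) z.1.2.1 z.1.2.2 z.2.1.1 z.2.1.2 ∧
    PowBetween (q z.1.1) z.1.2.1 z.1.2.2 z.2.2.1 z.2.2.2
  have hP : Semi P := by
    have h1 : Computable fun z : (α × RatCode × RatCode) × (ℕ × ℕ) × (ℕ × ℕ) => z.2.1 :=
      Computable.fst.comp .snd
    have h2 : Computable fun z : (α × RatCode × RatCode) × (ℕ × ℕ) × (ℕ × ℕ) => z.2.2 :=
      Computable.snd.comp .snd
    have h3 : Computable fun z : (α × RatCode × RatCode) × (ℕ × ℕ) × (ℕ × ℕ) =>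
        (q z.1.1, z.1.2.1, z.1.2.2) :=
      (hq.comp (Computable.fst.comp .fst)).pair (Computable.snd.comp .fst)
    have hc : CompReal fun _ : (α × RatCode × RatCode) × (ℕ × ℕ) × (ℕ × ℕ) => ρ :=
      hρ.comp (Computable.const ())
    have h4 : Computable fun z : (α × RatCode × RatCode) × (ℕ × ℕ) × (ℕ × ℕ) => z.1.2.1 :=
      Computable.fst.comp (Computable.snd.comp .fst)
    have h5 : Computable fun z : (α × RatCode × RatCode) × (ℕ × ℕ) × (ℕ × ℕ) => z.1.2.2 :=
      Computable.snd.comp (Computable.snd.comp .fst)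
    have s1 := (CompReal.ratVal (primrec_ratNat.to_comp.comp
        (Computable.fst.comp h1) (Computable.snd.comp h1))).lt hc
    have s2 := hc.lt (CompReal.ratVal (primrec_ratNat.to_comp.comp
        (Computable.fst.comp h2) (Computable.snd.comp h2)))
    have s3 := (Semi.ratVal_le (Computable.const (0, 0)) h4).and
        (Semi.ratVal_le (Computable.const (0, 0)) h5)
    have s4 := (Semi.of_primrec primrec_powBetween).comp (h3.pair h1)
    have s5 := (Semi.of_primrec primrec_powBetween).comp (h3.pair h2)
    exact ((s1.and s2).and (s3.and (s4.and s5))).of_eq fun z => Iff.rfl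
  refine CompReal.of_enclosure hP.exists ?_ ?_
  · rintro a lo hi ⟨⟨⟨u, v⟩, u', v'⟩, ⟨h1, h2⟩, ⟨h3, h4⟩, h5, h6⟩
    simp only [ratVal_zero] at h3 h4
    rw [powBetween_iff (hq0 a) h3 h4] at h5 h6
    simp only [ratVal_ratNat] at h1 h2
    push_cast at h1 h2
    have hu : 0 ≤ (u : ℝ) / (v + 1) := by positivity
    rcases (show (0 : ℝ) ≤ CompBanach.ratVal (q a) by exact_mod_cast hq0 a).eq_or_lt with h0 | h0
    · dsimp only at h5 h6
      rw [← h0, Real.zero_rpow hρ0.ne']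
      -- For base 0 the upper exponent must be used: the lower one may be 0, and 0^0 = 1.
      rw [← h0, Real.zero_rpow (by linarith)] at h6
      exact h6
    · rcases le_total (CompBanach.ratVal (q a) : ℝ) 1 with h | h
      · exact ⟨h6.1.trans (Real.rpow_le_rpow_of_exponent_ge h0 h h2.le),
          (Real.rpow_le_rpow_of_exponent_ge h0 h h1.le).trans h5.2⟩
      · exact ⟨h5.1.trans (Real.rpow_le_rpow_of_exponent_le h h1.le),
          (Real.rpow_le_rpow_of_exponent_le h h2.le).trans h6.2⟩
  · intro a ε hε
    have hqa : (0 : ℝ) ≤ CompBanach.ratVal (q a) := by exact_mod_cast hq0 a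
    set y := (CompBanach.ratVal (q a) : ℝ) ^ ρ with hy
    have hy0 : 0 ≤ y := Real.rpow_nonneg hqa _
    have hcont : ContinuousAt (fun r : ℝ => (CompBanach.ratVal (q a) : ℝ) ^ r) ρ :=
      Real.continuousAt_const_rpow' hρ0.ne'
    obtain ⟨hi, hhi1, hhi2⟩ := exists_rat_btwn (show y < y + ε / 2 by linarith)
    -- If y = 0, no nonnegative rational lies below y; then lo = 0 is a lower bound at every
    -- exponent.
    obtain ⟨lo, hlo0, hlo1, hlo2⟩ : ∃ lo : ℚ, 0 ≤ lo ∧ y - ε / 2 < lo ∧ (lo < y ∨ lo = 0) := by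
      rcases hy0.eq_or_lt with h | h
      · exact ⟨0, le_rfl, by push_cast; linarith, Or.inr rfl⟩
      · obtain ⟨lo, h1, h2⟩ := exists_rat_btwn (show max 0 (y - ε / 2) < y from
          max_lt h (by linarith))
        exact ⟨lo, by exact_mod_cast (le_max_left _ _).trans h1.le,
          (le_max_right _ _).trans_lt h1, Or.inl h2⟩
    have hev : ∀ᶠ r in 𝓝 ρ, (lo : ℝ) ≤ (CompBanach.ratVal (q a) : ℝ) ^ r ∧
        (CompBanach.ratVal (q a) : ℝ) ^ r ≤ hi := by
      refine Filter.Eventually.and ?_ ?_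
      · rcases hlo2 with h | h
        · exact (hcont.eventually (lt_mem_nhds h)).mono fun _ h => h.le
        · exact Filter.Eventually.of_forall fun r => by
            rw [h]; push_cast; exact Real.rpow_nonneg hqa _
      · exact (hcont.eventually (gt_mem_nhds hhi1)).mono fun _ h => h.le
    obtain ⟨δ, hδ, hball⟩ := Metric.eventually_nhds_iff.1 hev
    obtain ⟨u, v, hu1, hu2⟩ := exists_natRat_btwn (a := max 0 (ρ - δ)) (b := ρ) (le_max_left _ _)
      (max_lt hρ0 (by linarith))
    obtain ⟨u', v', hv1, hv2⟩ := exists_natRat_btwn (a := ρ) (b := ρ + δ) hρ0.le (by linarith)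
    have hu3 := (le_max_right _ _).trans_lt hu1
    obtain ⟨lo, rfl⟩ := ratVal_surjective lo
    obtain ⟨hi, rfl⟩ := ratVal_surjective hi
    have hhi0 : 0 ≤ CompBanach.ratVal hi := by exact_mod_cast hy0.trans hhi1.le
    refine ⟨lo, hi, ⟨((u, v), (u', v')), ⟨?_, ?_⟩, ⟨?_, ?_⟩, ?_, ?_⟩, by linarith⟩
    · simpa using hu2
    · simpa using hv1
    · simpa using hlo0
    · simpa using hhi0
    · refine (powBetween_iff (hq0 a) hlo0 hhi0).2 (hball ?_)
      rw [Real.dist_eq, abs_lt]; constructor <;> linarith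
    · refine (powBetween_iff (hq0 a) hlo0 hhi0).2 (hball ?_)
      rw [Real.dist_eq, abs_lt]; constructor <;> linarith

end ComputableReals

/-! ### A real number with an enumerable upper cut whose lower cut decides a given set -/

section CutReal

/-- `k < s` has been seen to satisfy the predicate with stages `D` before stage `s`. -/
def seenBefore (D : ℕ × ℕ → Bool) (k s : ℕ) : Bool :=
  decide (k < s) && s.rec false fun t b => b || D (k, t)

theorem seenBefore_iff {D : ℕ × ℕ → Bool} {k s : ℕ} :
    seenBefore D k s = true ↔ k < s ∧ ∃ t < s, D (k, t) = true := by
  have h : ∀ s : ℕ, (s.rec false fun t b => b || D (k, t) : Bool) = true ↔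
      ∃ t < s, D (k, t) = true := by
    intro s
    induction s with
    | zero => simp
    | succ s ih =>
      simp only [Bool.or_eq_true, ih, Nat.lt_succ_iff_lt_or_eq]
      constructor
      · rintro (⟨t, h1, h2⟩ | h)
        · exact ⟨t, Or.inl h1, h2⟩
        · exact ⟨s, Or.inr rfl, h⟩
      · rintro ⟨t, h1 | rfl, h2⟩
        · exact Or.inl ⟨t, h1, h2⟩
        · exact Or.inr h2
  rw [seenBefore, Bool.and_eq_true, h, decide_eq_true_eq]

theorem computable_seenBefore {D : ℕ × ℕ → Bool} (hD : Computable D) :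
    Computable₂ (seenBefore D) := by
  have h1 : Computable fun x : ℕ × ℕ => decide (x.1 < x.2) := Primrec.nat_lt.decide.to_comp
  have h2 : Computable₂ fun (x : ℕ × ℕ) (y : ℕ × Bool) => y.2 || D (x.1, y.1) :=
    Primrec.or.to_comp.comp (Computable.snd.comp .snd)
      (hD.comp ((Computable.fst.comp .fst).pair (Computable.fst.comp .snd)))
  have h3 : Computable fun x : ℕ × ℕ =>
      (x.2.rec false fun t b => b || D (x.1, t) : Bool) :=
    Computable.nat_rec Computable.snd (Computable.const false) h2
  exact Primrec.and.to_comp.comp h1 h3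

/-- The approximations `3 / 4 - ∑ 2 ^ (-(k + 2))`, the sum over the `k` seen before stage `s`. -/
def cutApprox (D : ℕ × ℕ → Bool) (s : ℕ) : RatCode :=
  ratAdd (3, 3) (ratNeg (ratSum
    (fun k => cond (seenBefore D k s) (ratHalfPow (k + 2)) (0, 0)) s))

theorem computable_cutApprox {D : ℕ × ℕ → Bool} (hD : Computable D) :
    Computable (cutApprox D) := by
  have h : Computable₂ fun s k : ℕ => cond (seenBefore D k s) (ratHalfPow (k + 2)) (0, 0) :=
    Computable.cond ((computable_seenBefore hD).comp Computable.snd Computable.fst)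
      (primrec_ratHalfPow.to_comp.comp (Computable.succ.comp (Computable.succ.comp .snd)))
      (Computable.const _)
  exact primrec_ratAdd.to_comp.comp (Computable.const _)
    (primrec_ratNeg.to_comp.comp (computable_ratSum h Computable.id))

theorem ratVal_cutApprox (D : ℕ × ℕ → Bool) (s : ℕ) : ratVal (cutApprox D s) =
    3 / 4 - ∑ k ∈ Finset.range s, if seenBefore D k s then (2⁻¹ : ℚ) ^ (k + 2) else 0 := by
  rw [cutApprox, ratVal_ratAdd, ratVal_ratNeg, ratVal_ratSum, sub_eq_add_neg]
  congr 1
  · norm_num [ratVal]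
  · congr 1
    refine Finset.sum_congr rfl fun k _ => ?_
    cases seenBefore D k s <;> simp

/-- All weights together amount to less than 1/2. This keeps the limit m positive, so that the atom
has positive mass. -/
theorem quarter_le_cutApprox (D : ℕ × ℕ → Bool) (s : ℕ) : 1 / 4 ≤ ratVal (cutApprox D s) := by
  have h1 : ∀ s : ℕ, ∑ k ∈ Finset.range s, (2⁻¹ : ℚ) ^ (k + 2) = 1 / 2 - 2⁻¹ ^ (s + 1) := by
    intro s
    induction s with
    | zero => norm_num
    | succ s ih => rw [Finset.sum_range_succ, ih]; ring
  have h2 : ∑ k ∈ Finset.range s, (if seenBefore D k s then (2⁻¹ : ℚ) ^ (k + 2) else 0) ≤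
      ∑ k ∈ Finset.range s, (2⁻¹ : ℚ) ^ (k + 2) :=
    Finset.sum_le_sum fun k _ => by split_ifs <;> [exact le_rfl; positivity]
  have h3 : (0 : ℚ) < 2⁻¹ ^ (s + 1) := by positivity
  rw [ratVal_cutApprox]
  linarith [h1 s]

theorem seenBefore_mono {D : ℕ × ℕ → Bool} {k s s' : ℕ} (h : s ≤ s')
    (hs : seenBefore D k s = true) : seenBefore D k s' = true := by
  rw [seenBefore_iff] at hs ⊢
  obtain ⟨h1, t, h2, h3⟩ := hs
  exact ⟨by omega, t, by omega, h3⟩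

theorem antitone_cutApprox (D : ℕ × ℕ → Bool) : Antitone fun s => ratVal (cutApprox D s) := by
  intro s s' h
  simp only [ratVal_cutApprox]
  refine sub_le_sub_left ?_ _
  calc _ ≤ ∑ k ∈ Finset.range s, (if seenBefore D k s' then (2⁻¹ : ℚ) ^ (k + 2) else 0) := by
        refine Finset.sum_le_sum fun k _ => ?_
        by_cases hk : seenBefore D k s = true
        · rw [if_pos hk, if_pos (seenBefore_mono h hk)]
        · rw [if_neg hk]; positivity
    _ ≤ _ := Finset.sum_le_sum_of_subset_of_nonneg (Finset.range_mono h)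
        fun k _ _ => by positivity

/-- Stages only add terms, and the term of k, already within the range of summation at stage s,
changes from 0 to its full weight in between. -/
theorem cutApprox_drop {D : ℕ × ℕ → Bool} {k s s' : ℕ} (h : s ≤ s') (hk : k < s)
    (hs : ¬seenBefore D k s = true) (hs' : seenBefore D k s' = true) :
    ratVal (cutApprox D s') + 2⁻¹ ^ (k + 2) ≤ ratVal (cutApprox D s) := by
  simp only [ratVal_cutApprox]
  have h1 : (∑ j ∈ Finset.range s, if seenBefore D j s then (2⁻¹ : ℚ) ^ (j + 2) else 0) +
      2⁻¹ ^ (k + 2) ≤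
      ∑ j ∈ Finset.range s, (if seenBefore D j s' then (2⁻¹ : ℚ) ^ (j + 2) else 0) := by
    rw [← Finset.sum_erase_add _ _ (Finset.mem_range.2 hk),
      ← Finset.sum_erase_add (Finset.range s) (fun j => if seenBefore D j s' then
        (2⁻¹ : ℚ) ^ (j + 2) else 0) (Finset.mem_range.2 hk), if_neg hs, if_pos hs', add_zero]
    gcongr with j _
    by_cases hj : seenBefore D j s = true
    · rw [if_pos hj, if_pos (seenBefore_mono h hj)]
    · rw [if_neg hj]; positivity
  have h2 : ∑ j ∈ Finset.range s, (if seenBefore D j s' then (2⁻¹ : ℚ) ^ (j + 2) else 0) ≤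
      ∑ j ∈ Finset.range s', (if seenBefore D j s' then (2⁻¹ : ℚ) ^ (j + 2) else 0) :=
    Finset.sum_le_sum_of_subset_of_nonneg (Finset.range_mono h)
        fun k _ _ => by positivity
  linarith

/-- For a c.e. set `A` there is a real number `m` with approximations `μ s` from above, such that
membership of `k` in `A` is decided at any stage `s > k` with `μ s < m + 2 ^ (-(k + 2))`. -/
theorem exists_cutReal {A : Set ℕ} (hA : REPred fun n => n ∈ A) :
    ∃ (m : ℝ) (μ : ℕ → RatCode) (E : ℕ → ℕ → Bool), 0 < m ∧ m < 1 ∧ Computable μ ∧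
      Computable₂ E ∧ (∀ q : ℝ, m < q ↔ ∃ s, (ratVal (μ s) : ℝ) < q) ∧
      (∀ k, ∃ s, k < s ∧ (ratVal (μ s) : ℝ) < m + 2⁻¹ ^ (k + 2)) ∧
      ∀ k s, k < s → (ratVal (μ s) : ℝ) < m + 2⁻¹ ^ (k + 2) → (k ∈ A ↔ E k s = true) := by
  obtain ⟨D, hD, hAD⟩ := hA.semi
  have hbdd : BddBelow (Set.range fun s => (ratVal (cutApprox D s) : ℝ)) := by
    refine ⟨((1 / 4 : ℚ) : ℝ), ?_⟩
    rintro _ ⟨s, rfl⟩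
    exact Rat.cast_le.2 (quarter_le_cutApprox D s)
  set m := ⨅ s, (ratVal (cutApprox D s) : ℝ) with hm
  have hle : ∀ s, m ≤ (ratVal (cutApprox D s) : ℝ) := fun s => ciInf_le hbdd s
  have hlt : ∀ q : ℝ, m < q ↔ ∃ s, (ratVal (cutApprox D s) : ℝ) < q :=
    fun q => ⟨fun h => exists_lt_of_ciInf_lt h, fun ⟨s, hs⟩ => (hle s).trans_lt hs⟩
  refine ⟨m, cutApprox D, seenBefore D, ?_, ?_, computable_cutApprox hD, computable_seenBefore hD,
    hlt, ?_, ?_⟩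
  · have : ((1 / 4 : ℚ) : ℝ) ≤ m := le_ciInf fun s => Rat.cast_le.2 (quarter_le_cutApprox D s)
    push_cast at this
    linarith
  · refine (hle 0).trans_lt ?_
    rw [ratVal_cutApprox]
    norm_num
  · intro k
    obtain ⟨s, hs⟩ := (hlt (m + 2⁻¹ ^ (k + 2))).1 (by linarith [show (0 : ℝ) < 2⁻¹ ^ (k + 2) by positivity])
    refine ⟨max s (k + 1), by omega, lt_of_le_of_lt ?_ hs⟩
    exact Rat.cast_le.2 (antitone_cutApprox D (le_max_left _ _))
  · intro k s hk hs
    constructor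
    · intro hkA
      by_contra hE
      obtain ⟨t, ht⟩ := (hAD k).1 hkA
      have hE' : seenBefore D k (max s (t + 1)) = true :=
        seenBefore_iff.2 ⟨by omega, t, by omega, ht⟩
      -- A later entry of k costs 2^(-(k+2)), which would take the approximation strictly below its
      -- infimum m.
      have h1 := cutApprox_drop (le_max_left s (t + 1)) hk hE hE'
      rw [← Rat.cast_le (K := ℝ)] at h1
      push_cast at h1
      linarith [hle (max s (t + 1))]
    · intro hE
      obtain ⟨-, t, -, ht⟩ := seenBefore_iff.1 hE
      exact (hAD k).2 ⟨t, ht⟩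

/-- The rational numbers in the interval `(m, 1)` can be enumerated if those above `m` can. -/
theorem exists_enumeration_above {m : ℝ} (hm : m < 1) {μ : ℕ → RatCode} (hμ : Computable μ)
    (hcut : ∀ q : ℝ, m < q ↔ ∃ s, (ratVal (μ s) : ℝ) < q) :
    ∃ h : ℕ → RatCode, Computable h ∧
      ∀ q : RatCode, (m < (ratVal q : ℝ) ∧ ratVal q < 1) ↔ ∃ i, h i = q := by
  obtain ⟨q₀, h1, h2⟩ := exists_rat_btwn hm
  obtain ⟨q₀, rfl⟩ := ratVal_surjective q₀
  have hS : Semi fun q : RatCode => m < (ratVal q : ℝ) ∧ ratVal q < 1 := by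
    have s1 : Semi fun z : RatCode × ℕ => ratVal (μ z.2) < ratVal z.1 :=
      Semi.ratVal_lt (hμ.comp .snd) .fst
    have s2 : Semi fun q : RatCode => ratVal q < ratVal (1, 0) :=
      Semi.ratVal_lt .id (Computable.const _)
    refine (s1.exists.and s2).of_eq fun q => ?_
    rw [hcut, ratVal_one]
    simp only [Rat.cast_lt]
  exact hS.enumeration q₀ ⟨h1, by exact_mod_cast h2⟩

end CutReal

/-! ### Disjointness of vectors and isometries for `p ≠ 2` -/

section Clarkson

variable {𝕜 : Type*} [RCLike 𝕜]

/-- Since x^q = x · x^(q-1) with x^(q-1) strictly increasing, each summand grows when its second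
factor is replaced by (a+b)^(q-1). -/
theorem add_rpow_lt_rpow_add {a b q : ℝ} (ha : 0 < a) (hb : 0 < b) (hq : 1 < q) :
    a ^ q + b ^ q < (a + b) ^ q := by
  have h : ∀ x : ℝ, 0 < x → x ^ q = x * x ^ (q - 1) := fun x hx => by
    rw [← Real.rpow_one_add' hx.le (by linarith)]; congr 1; ring
  rw [h a ha, h b hb, h _ (add_pos ha hb), add_mul]
  refine add_lt_add ?_ ?_
  · exact mul_lt_mul_of_pos_left (Real.rpow_lt_rpow ha.le (by linarith) (by linarith)) ha
  · exact mul_lt_mul_of_pos_left (Real.rpow_lt_rpow hb.le (by linarith) (by linarith)) hb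

theorem rpow_add_lt_add_rpow {a b q : ℝ} (ha : 0 < a) (hb : 0 < b) (hq : q < 1) (hq0 : 0 < q) :
    (a + b) ^ q < a ^ q + b ^ q := by
  have h : ∀ x : ℝ, 0 < x → x ^ q = x * x ^ (q - 1) := fun x hx => by
    rw [← Real.rpow_one_add' hx.le (by linarith)]; congr 1; ring
  rw [h a ha, h b hb, h _ (add_pos ha hb), add_mul]
  refine add_lt_add ?_ ?_
  · exact mul_lt_mul_of_pos_left
      (Real.rpow_lt_rpow_of_neg ha (by linarith) (by linarith)) ha
  · exact mul_lt_mul_of_pos_left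
      (Real.rpow_lt_rpow_of_neg hb (by linarith) (by linarith)) hb

/-- The defect in Clarkson's equality. -/
noncomputable def clarksonDefect (r : ℝ) (a b : 𝕜) : ℝ :=
  ‖a + b‖ ^ r + ‖a - b‖ ^ r - 2 * (‖a‖ ^ r + ‖b‖ ^ r)

theorem norm_rpow_eq_sq_rpow (a : 𝕜) (r : ℝ) : ‖a‖ ^ r = (‖a‖ ^ 2) ^ (r / 2) := by
  rw [← Real.rpow_natCast, ← Real.rpow_mul (norm_nonneg _)]
  congr 1; push_cast; ring

theorem clarksonDefect_eq_zero {r : ℝ} (hr : 0 < r) {a b : 𝕜} (h : a * b = 0) :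
    clarksonDefect r a b = 0 := by
  rcases mul_eq_zero.1 h with rfl | rfl
  · simp [clarksonDefect, Real.zero_rpow hr.ne']; ring
  · simp [clarksonDefect, Real.zero_rpow hr.ne']; ring

/-- By the parallelogram law, |a+b|² and |a-b|² have mean |a|² + |b|². Convexity of t^(r/2) bounds
the mean of their powers below by (|a|² + |b|²)^(r/2), and strict superadditivity finishes. For r <
2 both inequalities are reversed. -/
theorem clarksonDefect_pos {r : ℝ} (hr : 2 < r) {a b : 𝕜} (h : a * b ≠ 0) :
    0 < clarksonDefect r a b := by
  have ha : 0 < ‖a‖ ^ 2 := by have := norm_pos_iff.2 (left_ne_zero_of_mul h); positivity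
  have hb : 0 < ‖b‖ ^ 2 := by have := norm_pos_iff.2 (right_ne_zero_of_mul h); positivity
  have hpar := parallelogram_law_with_norm 𝕜 a b
  have h1 := add_rpow_lt_rpow_add ha hb (show 1 < r / 2 by linarith)
  have h2 := (convexOn_rpow (show 1 ≤ r / 2 by linarith)).2
    (show ‖a + b‖ ^ 2 ∈ Set.Ici (0 : ℝ) from sq_nonneg ‖a + b‖)
    (show ‖a - b‖ ^ 2 ∈ Set.Ici (0 : ℝ) from sq_nonneg ‖a - b‖)
    (show (0 : ℝ) ≤ 1 / 2 by norm_num) (show (0 : ℝ) ≤ 1 / 2 by norm_num) (by norm_num)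
  have h3 : (1 / 2 : ℝ) • ‖a + b‖ ^ 2 + (1 / 2 : ℝ) • ‖a - b‖ ^ 2 = ‖a‖ ^ 2 + ‖b‖ ^ 2 := by
    simp only [smul_eq_mul]; linarith
  rw [h3] at h2
  simp only [smul_eq_mul] at h2
  simp only [clarksonDefect, norm_rpow_eq_sq_rpow _ r]
  linarith

theorem clarksonDefect_neg {r : ℝ} (hr0 : 0 < r) (hr : r < 2) {a b : 𝕜} (h : a * b ≠ 0) :
    clarksonDefect r a b < 0 := by
  have ha : 0 < ‖a‖ ^ 2 := by have := norm_pos_iff.2 (left_ne_zero_of_mul h); positivity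
  have hb : 0 < ‖b‖ ^ 2 := by have := norm_pos_iff.2 (right_ne_zero_of_mul h); positivity
  have hpar := parallelogram_law_with_norm 𝕜 a b
  have h1 := rpow_add_lt_add_rpow ha hb (show r / 2 < 1 by linarith) (by linarith)
  have h2 := (Real.concaveOn_rpow (show 0 ≤ r / 2 by linarith) (show r / 2 ≤ 1 by linarith)).2
    (show ‖a + b‖ ^ 2 ∈ Set.Ici (0 : ℝ) from sq_nonneg ‖a + b‖)
    (show ‖a - b‖ ^ 2 ∈ Set.Ici (0 : ℝ) from sq_nonneg ‖a - b‖)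
    (show (0 : ℝ) ≤ 1 / 2 by norm_num) (show (0 : ℝ) ≤ 1 / 2 by norm_num) (by norm_num)
  have h3 : (1 / 2 : ℝ) • ‖a + b‖ ^ 2 + (1 / 2 : ℝ) • ‖a - b‖ ^ 2 = ‖a‖ ^ 2 + ‖b‖ ^ 2 := by
    simp only [smul_eq_mul]; linarith
  rw [h3] at h2
  simp only [smul_eq_mul] at h2
  simp only [clarksonDefect, norm_rpow_eq_sq_rpow _ r]
  linarith

variable (𝕜) in
/-- For `r ≠ 2` the defect in Clarkson's equality has a constant sign and vanishes only for
disjoint arguments. -/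
theorem exists_sign_clarksonDefect {r : ℝ} (hr0 : 0 < r) (hr : r ≠ 2) : ∃ σ : ℝ, σ ≠ 0 ∧
    ∀ a b : 𝕜, 0 ≤ σ * clarksonDefect r a b ∧ (clarksonDefect r a b = 0 → a * b = 0) := by
  rcases lt_or_gt_of_ne hr with h | h
  · refine ⟨-1, by norm_num, fun a b => ?_⟩
    by_cases hab : a * b = 0
    · simp [clarksonDefect_eq_zero hr0 hab, hab]
    · have := clarksonDefect_neg hr0 h hab
      exact ⟨by linarith, fun h0 => absurd h0 this.ne⟩
  · refine ⟨1, by norm_num, fun a b => ?_⟩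
    by_cases hab : a * b = 0
    · simp [clarksonDefect_eq_zero hr0 hab, hab]
    · have := clarksonDefect_pos h hab
      exact ⟨by linarith, fun h0 => absurd h0 this.ne'⟩

end Clarkson

/-! ### Disjointness is determined by the norm -/

section Disjoint

variable {𝕜 : Type*} [RCLike 𝕜] {p : ℝ≥0∞} [hp1 : Fact (1 ≤ p)] {n : ℕ}

/-- Lebesgue measure on the unit interval. -/
noncomputable abbrev unitMeasure : Measure ℝ := volume.restrict (Set.Icc (0 : ℝ) 1)

theorem toReal_pos_of_ne_top (hp : p ≠ ∞) : 0 < p.toReal :=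
  ENNReal.toReal_pos (zero_lt_one.trans_le hp1.out).ne' hp

theorem integrable_norm_rpow_lp (hp : p ≠ ∞) (f : LpUnit 𝕜 p) :
    Integrable (fun y => ‖f y‖ ^ p.toReal) unitMeasure :=
  (Lp.memLp f).integrable_norm_rpow (zero_lt_one.trans_le hp1.out).ne' hp

theorem norm_rpow_lp (hp : p ≠ ∞) (f : LpUnit 𝕜 p) :
    ‖f‖ ^ p.toReal = ∫ y, ‖f y‖ ^ p.toReal ∂unitMeasure := by
  have h0 : 0 ≤ ∫ y, ‖f y‖ ^ p.toReal ∂unitMeasure :=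
    integral_nonneg fun y => Real.rpow_nonneg (norm_nonneg _) _
  rw [Lp.norm_def, (Lp.memLp f).eLpNorm_eq_integral_rpow_norm
    (zero_lt_one.trans_le hp1.out).ne' hp, ENNReal.toReal_ofReal (Real.rpow_nonneg h0 _),
    ← Real.rpow_mul h0, inv_mul_cancel₀ (toReal_pos_of_ne_top hp).ne', Real.rpow_one]

theorem norm_rpow_hybrid (hp : p ≠ ∞) (u : HybridLp 𝕜 p n) :
    ‖u‖ ^ p.toReal = ∑ i, ‖u.fst i‖ ^ p.toReal + ∫ y, ‖u.snd y‖ ^ p.toReal ∂unitMeasure := by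
  have hr := toReal_pos_of_ne_top hp
  have h1 : ‖u.fst‖ ^ p.toReal = ∑ i, ‖u.fst i‖ ^ p.toReal := by
    have h0 : 0 ≤ ∑ i, ‖u.fst i‖ ^ p.toReal :=
      Finset.sum_nonneg fun i _ => Real.rpow_nonneg (norm_nonneg _) _
    rw [PiLp.norm_eq_sum hr, ← Real.rpow_mul h0, one_div, inv_mul_cancel₀ hr.ne', Real.rpow_one]
  have h0 : 0 ≤ ‖u.fst‖ ^ p.toReal + ‖u.snd‖ ^ p.toReal := by positivity
  rw [WithLp.prod_norm_eq_add hr, ← Real.rpow_mul h0, one_div, inv_mul_cancel₀ hr.ne',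
    Real.rpow_one, h1, norm_rpow_lp hp]

/-- Two vectors are disjoint if their pointwise product vanishes. -/
def DisjointVec (u v : HybridLp 𝕜 p n) : Prop :=
  (∀ i, u.fst i * v.fst i = 0) ∧ ∀ᵐ y ∂unitMeasure, u.snd y * v.snd y = 0

/-- The p-th power of the norm is a sum over the atoms plus an integral, so the defect of two
vectors accumulates the pointwise defects. Integrability is needed to pass from a vanishing integral
to vanishing almost everywhere. -/
theorem sum_clarksonDefect (hp : p ≠ ∞) (u v : HybridLp 𝕜 p n) :
    Integrable (fun y => clarksonDefect p.toReal (u.snd y) (v.snd y)) unitMeasure ∧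
    ‖u + v‖ ^ p.toReal + ‖u - v‖ ^ p.toReal - 2 * (‖u‖ ^ p.toReal + ‖v‖ ^ p.toReal) =
      ∑ i, clarksonDefect p.toReal (u.fst i) (v.fst i) +
        ∫ y, clarksonDefect p.toReal (u.snd y) (v.snd y) ∂unitMeasure := by
  have hadd : (fun y => ‖(u.snd + v.snd) y‖ ^ p.toReal) =ᵐ[unitMeasure]
      fun y => ‖u.snd y + v.snd y‖ ^ p.toReal := by
    filter_upwards [Lp.coeFn_add u.snd v.snd] with y hy
    rw [hy]; rfl
  have hsub : (fun y => ‖(u.snd - v.snd) y‖ ^ p.toReal) =ᵐ[unitMeasure]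
      fun y => ‖u.snd y - v.snd y‖ ^ p.toReal := by
    filter_upwards [Lp.coeFn_sub u.snd v.snd] with y hy
    rw [hy]; rfl
  have i1 := (integrable_norm_rpow_lp hp (u.snd + v.snd)).congr hadd
  have i2 := (integrable_norm_rpow_lp hp (u.snd - v.snd)).congr hsub
  have i3 := integrable_norm_rpow_lp hp u.snd
  have i4 := integrable_norm_rpow_lp hp v.snd
  refine ⟨(i1.add i2).sub ((i3.add i4).const_mul 2), ?_⟩
  have hint : ∫ y, clarksonDefect p.toReal (u.snd y) (v.snd y) ∂unitMeasure =
      (∫ y, ‖u.snd y + v.snd y‖ ^ p.toReal ∂unitMeasure) +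
      (∫ y, ‖u.snd y - v.snd y‖ ^ p.toReal ∂unitMeasure) -
      2 * ((∫ y, ‖u.snd y‖ ^ p.toReal ∂unitMeasure) + ∫ y, ‖v.snd y‖ ^ p.toReal ∂unitMeasure) := by
    rw [← integral_add i1 i2, ← integral_add i3 i4, ← integral_const_mul, ← integral_sub]
    · rfl
    · exact i1.add i2
    · exact (i3.add i4).const_mul 2
  rw [hint, norm_rpow_hybrid hp, norm_rpow_hybrid hp, norm_rpow_hybrid hp u, norm_rpow_hybrid hp v]
  simp only [WithLp.add_snd, WithLp.sub_snd, WithLp.add_fst, WithLp.sub_fst, PiLp.add_apply,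
    PiLp.sub_apply, clarksonDefect, Finset.sum_sub_distrib, Finset.sum_add_distrib,
    ← Finset.mul_sum]
  rw [integral_congr_ae hadd, integral_congr_ae hsub]
  ring

/-- Clarkson's equality characterizes disjointness for `p ≠ 2`. -/
theorem disjointVec_iff (hp : p ≠ ∞) (hp2 : p ≠ 2) (u v : HybridLp 𝕜 p n) : DisjointVec u v ↔
    ‖u + v‖ ^ p.toReal + ‖u - v‖ ^ p.toReal = 2 * (‖u‖ ^ p.toReal + ‖v‖ ^ p.toReal) := by
  have hr := toReal_pos_of_ne_top hp
  have hr2 : p.toReal ≠ 2 := by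
    intro h
    apply hp2
    rw [← ENNReal.ofReal_toReal hp, h]
    norm_num
  obtain ⟨hint, hsum⟩ := sum_clarksonDefect hp u v
  rw [← sub_eq_zero, hsum]
  constructor
  · rintro ⟨h1, h2⟩
    rw [Finset.sum_eq_zero fun i _ => clarksonDefect_eq_zero hr (h1 i), zero_add,
      integral_eq_zero_of_ae (h2.mono fun y hy => clarksonDefect_eq_zero hr hy)]
  · intro h
    obtain ⟨σ, hσ, hdef⟩ := exists_sign_clarksonDefect 𝕜 hr hr2
    -- After multiplication by σ all pointwise defects are nonnegative, so a zero total forces every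
    -- one of them to vanish.
    have h' : ∑ i, σ * clarksonDefect p.toReal (u.fst i) (v.fst i) +
        ∫ y, σ * clarksonDefect p.toReal (u.snd y) (v.snd y) ∂unitMeasure = 0 := by
      rw [← Finset.mul_sum, integral_const_mul, ← mul_add, h, mul_zero]
    have hs : 0 ≤ ∑ i, σ * clarksonDefect p.toReal (u.fst i) (v.fst i) :=
      Finset.sum_nonneg fun i _ => (hdef _ _).1
    have hi : 0 ≤ ∫ y, σ * clarksonDefect p.toReal (u.snd y) (v.snd y) ∂unitMeasure :=
      integral_nonneg fun y => (hdef _ _).1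
    have hs0 : ∑ i, σ * clarksonDefect p.toReal (u.fst i) (v.fst i) = 0 := by linarith
    have hi0 : ∫ y, σ * clarksonDefect p.toReal (u.snd y) (v.snd y) ∂unitMeasure = 0 := by
      linarith
    refine ⟨fun i => ?_, ?_⟩
    · have := (Finset.sum_eq_zero_iff_of_nonneg fun i _ => (hdef _ _).1).1 hs0 i (Finset.mem_univ i)
      exact (hdef _ _).2 ((mul_eq_zero.1 this).resolve_left hσ)
    · have := (integral_eq_zero_iff_of_nonneg (fun y => (hdef _ _).1) (hint.const_mul σ)).1 hi0
      filter_upwards [this] with y hy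
      exact (hdef _ _).2 ((mul_eq_zero.1 hy).resolve_left hσ)

/-- Clarkson's equality involves only norms of linear combinations, which T preserves. -/
theorem DisjointVec.map (hp : p ≠ ∞) (hp2 : p ≠ 2) (T : HybridLp 𝕜 p n ≃ₗᵢ[𝕜] HybridLp 𝕜 p n)
    {u v : HybridLp 𝕜 p n} (h : DisjointVec u v) : DisjointVec (T u) (T v) := by
  rw [disjointVec_iff hp hp2] at h ⊢
  rwa [← map_add, ← map_sub, T.norm_map, T.norm_map, T.norm_map, T.norm_map]

end Disjoint

/-! ### Indivisible vectors, and the action of isometries on coordinates -/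

section Atoms

variable {𝕜 : Type*} [RCLike 𝕜] {p : ℝ≥0∞} [hp1 : Fact (1 ≤ p)] {n : ℕ}

variable (𝕜 p) in
/-- The standard basis vectors of the summand `ℓ^p_n`. -/
noncomputable def basisVec (i : Fin n) : HybridLp 𝕜 p n :=
  WithLp.toLp p (WithLp.toLp p (Pi.single i (1 : 𝕜)), 0)

omit hp1 in
theorem basisVec_fst (i k : Fin n) :
    (basisVec 𝕜 p i).fst k = if k = i then (1 : 𝕜) else 0 := by
  simp [basisVec]

omit hp1 in
theorem basisVec_snd (i : Fin n) : (basisVec 𝕜 p i).snd = 0 := rfl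

theorem norm_basisVec (i : Fin n) : ‖basisVec 𝕜 p i‖ = 1 := by
  rw [basisVec, WithLp.norm_toLp_fst]
  exact (PiLp.norm_single p (fun _ : Fin n => 𝕜) i 1).trans norm_one

omit hp1 in
theorem hybrid_ext {u v : HybridLp 𝕜 p n} (h1 : ∀ i, u.fst i = v.fst i) (h2 : u.snd = v.snd) :
    u = v := by
  apply (WithLp.ofLp_injective p)
  exact Prod.ext (PiLp.ext h1) h2

omit hp1 in
theorem disjointVec_of_snd_eq_zero {u v : HybridLp 𝕜 p n} (h : ∀ i, u.fst i * v.fst i = 0)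
    (hu : u.snd = 0) : DisjointVec u v := by
  refine ⟨h, ?_⟩
  rw [hu]
  filter_upwards [Lp.coeFn_zero 𝕜 p unitMeasure] with y hy
  rw [hy, Pi.zero_apply, zero_mul]

omit hp1 in
/-- A basis vector is not the sum of two disjoint nonzero vectors. -/
theorem eq_zero_or_eq_zero_of_disjointVec {u v : HybridLp 𝕜 p n} {i : Fin n} (h : DisjointVec u v)
    (huv : u + v = basisVec 𝕜 p i) : u = 0 ∨ v = 0 := by
  have h1 : ∀ k, k ≠ i → u.fst k = 0 ∧ v.fst k = 0 := by
    intro k hk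
    have hs : u.fst k + v.fst k = 0 := by
      rw [← PiLp.add_apply, ← WithLp.add_fst, huv, basisVec_fst, if_neg hk]
    rcases mul_eq_zero.1 (h.1 k) with h0 | h0
    · exact ⟨h0, by simpa [h0] using hs⟩
    · exact ⟨by simpa [h0] using hs, h0⟩
  have h2 : u.snd = 0 ∧ v.snd = 0 := by
    have hs : u.snd + v.snd = 0 := by rw [← WithLp.add_snd, huv, basisVec_snd]
    -- The second components are opposite and have product zero, so the square of the first vanishes
    -- almost everywhere.
    have hv : v.snd = -u.snd := eq_neg_of_add_eq_zero_right hs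
    have hu : u.snd = 0 := by
      rw [Lp.eq_zero_iff_ae_eq_zero]
      have h3 := h.2
      rw [hv] at h3
      filter_upwards [h3, Lp.coeFn_neg u.snd] with y hy hn
      rw [hn] at hy
      simpa using hy
    exact ⟨hu, by rw [hv, hu, neg_zero]⟩
  rcases mul_eq_zero.1 (h.1 i) with h0 | h0
  · left
    refine hybrid_ext (fun k => ?_) h2.1
    by_cases hk : k = i
    · rw [hk, h0]; rfl
    · rw [(h1 k hk).1]; rfl
  · right
    refine hybrid_ext (fun k => ?_) h2.2
    by_cases hk : k = i
    · rw [hk, h0]; rfl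
    · rw [(h1 k hk).2]; rfl

/-- The restriction of a vector of `L^p[0,1]` to a measurable set. -/
noncomputable def restrictLp (f : LpUnit 𝕜 p) {s : Set ℝ} (hs : MeasurableSet s) : LpUnit 𝕜 p :=
  ((Lp.memLp f).indicator hs).toLp (s.indicator f)

omit hp1 in
theorem restrictLp_coe (f : LpUnit 𝕜 p) {s : Set ℝ} (hs : MeasurableSet s) :
    restrictLp f hs =ᵐ[unitMeasure] s.indicator f := MemLp.coeFn_toLp _

theorem integral_restrictLp (hp : p ≠ ∞) (f : LpUnit 𝕜 p) {s : Set ℝ} (hs : MeasurableSet s) :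
    ∫ y, ‖restrictLp f hs y‖ ^ p.toReal ∂unitMeasure =
      ∫ y in s, ‖f y‖ ^ p.toReal ∂unitMeasure := by
  rw [← integral_indicator hs]
  refine integral_congr_ae ?_
  filter_upwards [restrictLp_coe f hs] with y hy
  rw [hy]
  by_cases hys : y ∈ s
  · simp [hys]
  · simp [hys, Real.zero_rpow (toReal_pos_of_ne_top hp).ne']

/-- A nonzero vector of `L^p[0,1]` is the sum of two disjoint nonzero vectors. -/
theorem exists_disjoint_split (hp : p ≠ ∞) {f : LpUnit 𝕜 p} (hf : f ≠ 0) :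
    ∃ g h : LpUnit 𝕜 p, g ≠ 0 ∧ h ≠ 0 ∧ g + h = f ∧ ∀ᵐ y ∂unitMeasure, g y * h y = 0 := by
  have hr := toReal_pos_of_ne_top hp
  have hint := integrable_norm_rpow_lp hp f
  set G : ℝ → ℝ := fun y => ‖f y‖ ^ p.toReal with hG
  have hcont := intervalIntegral.continuousOn_primitive_Icc (μ := volume) (f := G) (a := 0) (b := 1)
    hint
  have hI : 0 < ∫ t in Set.Icc 0 1, G t := by
    rw [← norm_rpow_lp hp f]
    exact Real.rpow_pos_of_pos (norm_pos_iff.2 hf) _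
  -- Lebesgue measure has no atoms, so the primitive of |f|^p is continuous and takes half of its
  -- total at some x; cutting there leaves equal nonzero halves.
  obtain ⟨x, hx, hxe⟩ := intermediate_value_Icc (zero_le_one' ℝ) hcont
    (show (∫ t in Set.Icc 0 1, G t) / 2 ∈ _ by
      constructor
      · rw [Set.Icc_self, Measure.restrict_singleton]
        simp
        linarith
      · linarith)
  have hsx : MeasurableSet (Set.Iic x) := measurableSet_Iic
  have h1 : ∫ y in Set.Iic x, G y ∂unitMeasure = (∫ t in Set.Icc 0 1, G t) / 2 := by
    rw [← hxe, Measure.restrict_restrict hsx]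
    congr 2
    ext y
    simp only [Set.mem_inter_iff, Set.mem_Iic, Set.mem_Icc]
    exact ⟨fun h => ⟨h.2.1, h.1⟩, fun h => ⟨h.2, h.1, h.2.trans hx.2⟩⟩
  have h2 : ∫ y in (Set.Iic x)ᶜ, G y ∂unitMeasure = (∫ t in Set.Icc 0 1, G t) / 2 := by
    have := integral_add_compl hsx hint
    linarith
  have hne : ∀ {s : Set ℝ} (hs : MeasurableSet s),
      ∫ y in s, G y ∂unitMeasure = (∫ t in Set.Icc 0 1, G t) / 2 → restrictLp f hs ≠ 0 := by
    intro s hs h h0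
    rw [← integral_restrictLp hp f hs, ← norm_rpow_lp hp, h0, norm_zero,
      Real.zero_rpow hr.ne'] at h
    linarith
  refine ⟨restrictLp f hsx, restrictLp f hsx.compl, hne hsx h1, hne hsx.compl h2, ?_, ?_⟩
  · apply Lp.ext
    filter_upwards [Lp.coeFn_add (restrictLp f hsx) (restrictLp f hsx.compl),
      restrictLp_coe f hsx, restrictLp_coe f hsx.compl] with y h3 h4 h5
    rw [h3, Pi.add_apply, h4, h5]
    exact Set.indicator_self_add_compl_apply (Set.Iic x) f y
  · filter_upwards [restrictLp_coe f hsx, restrictLp_coe f hsx.compl] with y h4 h5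
    rw [h4, h5]
    by_cases hy : y ∈ Set.Iic x
    · rw [Set.indicator_of_notMem (Set.notMem_compl_iff.2 hy), mul_zero]
    · rw [Set.indicator_of_notMem hy, zero_mul]

/-- For `p ≠ 2`, every coordinate functional of the summand `ℓ^p_n`, composed with a linear
isometric isomorphism, is a unimodular multiple of a coordinate functional. -/
theorem exists_coordinate_of_isometry (hp : p ≠ ∞) (hp2 : p ≠ 2)
    (T : HybridLp 𝕜 p n ≃ₗᵢ[𝕜] HybridLp 𝕜 p n) (i : Fin n) :
    ∃ (j : Fin n) (θ : 𝕜), ‖θ‖ = 1 ∧ T (basisVec 𝕜 p j) = θ • basisVec 𝕜 p i ∧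
      ∀ u, (T u).fst i = θ * u.fst j := by
  obtain ⟨g, hg⟩ : ∃ g, T g = basisVec 𝕜 p i := T.surjective _
  -- The preimage g of e_i inherits its indivisibility, because T preserves disjointness.
  have hsplit : ∀ u v, DisjointVec u v → u + v = g → u = 0 ∨ v = 0 := by
    intro u v huv h
    have := eq_zero_or_eq_zero_of_disjointVec (huv.map hp hp2 T) (by rw [← map_add, h, hg])
    simpa using this
  have hg0 : g ≠ 0 := by
    rintro rfl
    have := norm_basisVec (𝕜 := 𝕜) (p := p) i
    rw [← hg, map_zero, norm_zero] at this
    norm_num at this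
  -- A nonzero second component would force the first to vanish, and would then itself split.
  have hsnd : g.snd = 0 := by
    by_contra hne
    obtain ⟨f, h, hf, hh, hfh, hd⟩ := exists_disjoint_split hp hne
    have hfst : g.fst = 0 := by
      rcases hsplit (WithLp.toLp p (g.fst, 0)) (WithLp.toLp p (0, g.snd))
        (disjointVec_of_snd_eq_zero (fun i => by simp) rfl) (by apply hybrid_ext <;> simp) with h0 | h0
      · exact congrArg WithLp.fst h0
      · exact absurd (congrArg WithLp.snd h0) hne
    rcases hsplit (WithLp.toLp p (0, f)) (WithLp.toLp p (0, h)) ⟨fun i => by simp, hd⟩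
      (by apply hybrid_ext <;> simp [hfst, hfh]) with h0 | h0
    · exact hf (congrArg WithLp.snd h0)
    · exact hh (congrArg WithLp.snd h0)
  obtain ⟨j, hj⟩ : ∃ j, g.fst j ≠ 0 := by
    by_contra! hall
    exact hg0 (hybrid_ext (fun k => by rw [hall k]; rfl) hsnd)
  -- Removing the j-th coordinate of u leaves a vector disjoint from e_j. For u = g this shows that
  -- g is a multiple of e_j.
  have hdis : ∀ (u : HybridLp 𝕜 p n) (c : 𝕜),
      DisjointVec (c • basisVec 𝕜 p j) (u - u.fst j • basisVec 𝕜 p j) := by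
    intro u c
    refine disjointVec_of_snd_eq_zero (fun k => ?_) (by simp [basisVec_snd])
    by_cases hk : k = j
    · subst hk; simp [basisVec_fst]
    · simp [basisVec_fst, hk]
  have hgj : g = g.fst j • basisVec 𝕜 p j := by
    rcases hsplit _ _ (hdis g (g.fst j)) (by abel) with h0 | h0
    · have := congrArg (fun u : HybridLp 𝕜 p n => u.fst j) h0
      simp [basisVec_fst] at this
      exact absurd this hj
    · exact sub_eq_zero.1 h0
  set c := g.fst j with hc
  have hT : T (basisVec 𝕜 p j) = c⁻¹ • basisVec 𝕜 p i := by
    rw [← hg, hgj, map_smul, smul_smul, inv_mul_cancel₀ hj, one_smul]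
  refine ⟨j, c⁻¹, ?_, hT, fun u => ?_⟩
  · have := T.norm_map (basisVec 𝕜 p j)
    rw [hT, norm_smul, norm_basisVec, norm_basisVec, mul_one] at this
    exact this
  -- T e_j is nonzero at coordinate i, so the image of the disjoint remainder u - u_j e_j vanishes
  -- there.
  · have h1 := ((hdis u 1).map hp hp2 T).1 i
    rw [one_smul, hT, map_sub, map_smul, hT] at h1
    simp only [WithLp.smul_fst, WithLp.sub_fst, PiLp.smul_apply, PiLp.sub_apply, basisVec_fst,
      if_true, smul_eq_mul, mul_one] at h1
    have := (mul_eq_zero.1 h1).resolve_left (inv_ne_zero hj)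
    rw [sub_eq_zero] at this
    rw [this, mul_comm]

end Atoms

/-! ### A presentation whose atom has a prescribed measure -/

section Density

variable {𝕜 : Type*} [RCLike 𝕜] {p : ℝ≥0∞} [hp1 : Fact (1 ≤ p)]

variable (𝕜 p) in
/-- The indicator function of a measurable set, as a vector of `L^p[0,1]`. -/
noncomputable def indLp {s : Set ℝ} (hs : MeasurableSet s) : LpUnit 𝕜 p :=
  indicatorConstLp p hs (measure_ne_top _ _) (1 : 𝕜)

/-- The half-lines from y and x differ by a set of measure at most |y - x|. Continuity serves to
pass from a dense set of breakpoints to all of them. -/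
theorem continuous_indLp_Ioi (hp : p ≠ ∞) :
    Continuous fun y : ℝ => indLp 𝕜 p (measurableSet_Ioi (a := y)) := by
  refine continuous_indicatorConstLp_set hp fun x => ?_
  have h : ∀ y, unitMeasure (symmDiff (Set.Ioi y) (Set.Ioi x)) ≤ ENNReal.ofReal |y - x| := by
    intro y
    refine (Measure.restrict_apply_le _ _).trans ?_
    have : symmDiff (Set.Ioi y) (Set.Ioi x) ⊆ Set.Ioc (min y x) (max y x) := by
      intro z hz
      rcases hz with ⟨h1, h2⟩ | ⟨h1, h2⟩
      · simp only [Set.mem_Ioi, not_lt] at h1 h2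
        exact ⟨(min_le_left _ _).trans_lt h1, h2.trans (le_max_right _ _)⟩
      · simp only [Set.mem_Ioi, not_lt] at h1 h2
        exact ⟨(min_le_right _ _).trans_lt h1, h2.trans (le_max_left _ _)⟩
    refine (measure_mono this).trans ?_
    rw [Real.volume_Ioc, max_sub_min_eq_abs']
  refine tendsto_of_tendsto_of_tendsto_of_le_of_le tendsto_const_nhds ?_ (fun _ => zero_le)
    h
  have hc : Continuous fun y : ℝ => ENNReal.ofReal |y - x| :=
    ENNReal.continuous_ofReal.comp (by fun_prop)
  simpa using hc.tendsto x

/-- A closed subspace of `L^p[0,1]` that contains the indicator functions of all half-lines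
contains all vectors. -/
theorem mem_of_indLp_Ioi_mem (hp : p ≠ ∞) {V : Submodule 𝕜 (LpUnit 𝕜 p)}
    (hV : IsClosed (V : Set (LpUnit 𝕜 p)))
    (h : ∀ y ∈ Set.Icc (0 : ℝ) 1, indLp 𝕜 p (measurableSet_Ioi (a := y)) ∈ V)
    (f : LpUnit 𝕜 p) : f ∈ V := by
  -- Only the trace on (0,1] matters, as the point 0 is null; thus (0,∞) represents the whole
  -- interval.
  have hae : ∀ {s t : Set ℝ} (hs : MeasurableSet s) (ht : MeasurableSet t),
      s ∩ Set.Ioc 0 1 = t ∩ Set.Ioc 0 1 → indLp 𝕜 p hs = indLp 𝕜 p ht := by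
    intro s t hs ht hst
    apply Lp.ext
    have h0 : ∀ᵐ y ∂unitMeasure, y ∈ Set.Ioc (0 : ℝ) 1 := by
      rw [unitMeasure, Measure.restrict_congr_set Ioc_ae_eq_Icc.symm]
      exact ae_restrict_mem measurableSet_Ioc
    have h1 : indLp 𝕜 p hs =ᵐ[unitMeasure] s.indicator fun _ => (1 : 𝕜) := indicatorConstLp_coeFn
    have h2 : indLp 𝕜 p ht =ᵐ[unitMeasure] t.indicator fun _ => (1 : 𝕜) := indicatorConstLp_coeFn
    filter_upwards [h0, h1, h2] with y hy h3 h4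
    rw [h3, h4]
    have : y ∈ s ↔ y ∈ t := by
      have := Set.ext_iff.1 hst y
      simpa [hy.1, hy.2] using this
    by_cases hys : y ∈ s
    · rw [Set.indicator_of_mem hys, Set.indicator_of_mem (this.1 hys)]
    · rw [Set.indicator_of_notMem hys, Set.indicator_of_notMem (fun h => hys (this.2 h))]
  have hempty : indLp 𝕜 p MeasurableSet.empty ∈ V := by
    have : indLp 𝕜 p MeasurableSet.empty = 0 := by
      rw [indLp]; exact indicatorConstLp_empty
    rw [this]; exact V.zero_mem
  have huniv : indLp 𝕜 p MeasurableSet.univ ∈ V := by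
    rw [hae MeasurableSet.univ (measurableSet_Ioi (a := (0 : ℝ)))]
    · exact h 0 ⟨le_rfl, zero_le_one⟩
    · ext y; simp only [Set.mem_inter_iff, Set.mem_univ, Set.mem_Ioi, Set.mem_Ioc]; tauto
  have hdisj : ∀ {s t : Set ℝ} (hs : MeasurableSet s) (ht : MeasurableSet t), Disjoint s t →
      indLp 𝕜 p (hs.union ht) = indLp 𝕜 p hs + indLp 𝕜 p ht := fun hs ht hst =>
    indicatorConstLp_disjoint_union hs ht _ _ hst _
  -- Half-lines form a π-system generating the Borel sets, so it suffices to check complements and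
  -- countable disjoint unions.
  have hind : ∀ (s : Set ℝ) (hs : MeasurableSet s), indLp 𝕜 p hs ∈ V := by
    refine MeasurableSpace.induction_on_inter
      (h_eq := BorelSpace.measurable_eq.trans (borel_eq_generateFrom_Ioi ℝ))
      isPiSystem_Ioi hempty ?_ ?_ ?_
    · rintro _ ⟨y, rfl⟩
      rcases lt_or_ge y 0 with hy | hy
      · rw [hae measurableSet_Ioi (measurableSet_Ioi (a := (0 : ℝ)))]
        · exact h 0 ⟨le_rfl, zero_le_one⟩
        · ext z; simp only [Set.mem_inter_iff, Set.mem_Ioi, Set.mem_Ioc]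
          exact ⟨fun h => ⟨h.2.1, h.2⟩, fun h => ⟨hy.trans h.2.1, h.2⟩⟩
      · rcases le_or_gt y 1 with hy1 | hy1
        · exact h y ⟨hy, hy1⟩
        · rw [hae measurableSet_Ioi MeasurableSet.empty]
          · exact hempty
          · ext z; simp only [Set.mem_inter_iff, Set.mem_Ioi, Set.mem_Ioc, Set.mem_empty_iff_false,
              false_and, iff_false]
            rintro ⟨h1, -, h2⟩; linarith
    · intro t ht hmem
      have h1 := hdisj ht ht.compl disjoint_compl_right
      have h2 : indLp 𝕜 p (ht.union ht.compl) = indLp 𝕜 p MeasurableSet.univ :=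
        hae _ _ (by rw [Set.union_compl_self])
      rw [h2] at h1
      rw [← add_sub_cancel_left (indLp 𝕜 p ht) (indLp 𝕜 p ht.compl), ← h1]
      exact V.sub_mem huniv hmem
    · intro f hd hf hmem
      let t : ℕ → Set ℝ := fun N => ⋃ i ∈ Finset.range N, f i
      have ht : ∀ N, MeasurableSet (t N) := fun N => Finset.measurableSet_biUnion _ fun i _ => hf i
      have htV : ∀ N, indLp 𝕜 p (ht N) ∈ V := by
        intro N
        induction N with
        | zero =>
          rw [hae (ht 0) MeasurableSet.empty (by simp [t])]
          exact hempty
        | succ N ih =>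
          have hdN : Disjoint (t N) (f N) := by
            simp only [t, Set.disjoint_iUnion_left, Finset.mem_range]
            exact fun i hi => hd (by omega)
          rw [hae (ht (N + 1)) ((ht N).union (hf N)) (by
            simp only [t]; rw [Finset.range_add_one, Finset.set_biUnion_insert, Set.union_comm]),
            hdisj (ht N) (hf N) hdN]
          exact V.add_mem ih (hmem N)
      -- The finite partial unions converge in measure, hence their indicators converge in L^p
      -- because p is finite, and V is closed.
      suffices hlim : Filter.Tendsto (fun N => unitMeasure (symmDiff (t N) (⋃ i, f i)))
          Filter.atTop (𝓝 0) by
        have : Filter.Tendsto (fun N => indLp 𝕜 p (ht N)) Filter.atTop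
            (𝓝 (indLp 𝕜 p (MeasurableSet.iUnion hf))) := tendsto_indicatorConstLp_set hp hlim
        exact hV.mem_of_tendsto this (Filter.Eventually.of_forall htV)
      have hmono : Monotone t := by
        intro a b hab x hx
        simp only [t, Set.mem_iUnion, Finset.mem_range] at hx ⊢
        obtain ⟨i, hi, hx⟩ := hx
        exact ⟨i, by omega, hx⟩
      have hsub : ∀ N, t N ⊆ ⋃ i, f i := fun N => Set.iUnion₂_subset fun i _ =>
        Set.subset_iUnion f i
      have heq : ∀ N, symmDiff (t N) (⋃ i, f i) = (⋃ i, f i) \ t N := by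
        intro N
        rw [Set.symmDiff_def, Set.sdiff_eq_empty.2 (hsub N), Set.empty_union]
      simp only [heq]
      have hlim := tendsto_measure_iInter_atTop (μ := unitMeasure)
        (s := fun N => (⋃ i, f i) \ t N)
        (fun N => ((MeasurableSet.iUnion hf).diff (ht N)).nullMeasurableSet)
        (fun a b hab => Set.sdiff_subset_sdiff_right (hmono hab)) ⟨0, measure_ne_top _ _⟩
      have hinter : ⋂ N, (⋃ i, f i) \ t N = ∅ := by
        ext x
        simp only [Set.mem_iInter, Set.mem_sdiff, Set.mem_iUnion, Set.mem_empty_iff_false, iff_false,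
          not_forall, t, Finset.mem_range]
        by_cases hx : ∃ i, x ∈ f i
        · obtain ⟨i, hi⟩ := hx
          exact ⟨i + 1, fun h => h.2 ⟨i, by omega, hi⟩⟩
        · exact ⟨0, fun h => hx h.1⟩
      rw [hinter, measure_empty] at hlim
      exact hlim
  refine Lp.induction hp (motive := fun f => f ∈ V) ?_ ?_ hV f
  · intro c s hs hμs
    have : (Lp.simpleFunc.indicatorConst p hs hμs.ne c : LpUnit 𝕜 p) = c • indLp 𝕜 p hs := by
      rw [Lp.simpleFunc.coe_indicatorConst]
      apply Lp.ext
      have h1 : indLp 𝕜 p hs =ᵐ[unitMeasure] s.indicator fun _ => (1 : 𝕜) :=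
        indicatorConstLp_coeFn
      filter_upwards [indicatorConstLp_coeFn (p := p) (hs := hs) (hμs := hμs.ne) (c := c), h1,
        Lp.coeFn_smul c (indLp 𝕜 p hs)] with y h2 h3 h4
      rw [h2, h4, Pi.smul_apply, h3]
      by_cases hy : y ∈ s <;> simp [hy]
    rw [this]
    exact V.smul_mem c (hind s hs)
  · exact fun f g _ _ _ hf hg => V.add_mem hf hg

end Density

/-! ### The structure with a hidden atom, and its linear density -/

section Structure

variable {𝕜 : Type*} [RCLike 𝕜] {p : ℝ≥0∞} [hp1 : Fact (1 ≤ p)] {n : ℕ}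

variable (𝕜 p n) in
/-- The inclusion of the summand `L^p[0,1]`. -/
noncomputable def inclLp (f : LpUnit 𝕜 p) : HybridLp 𝕜 p n := WithLp.toLp p (0, f)

variable (𝕜 p) in
/-- After identification of `[0,1]` with the interval `[m,1]`, the indicator function of `(x,1]`,
scaled so that the `p`-th power of the norm is multiplied by `1 - m`. -/
noncomputable def cutLp (m x : ℝ) : LpUnit 𝕜 p :=
  (((1 - m) ^ p.toReal⁻¹ : ℝ) : 𝕜) • indLp 𝕜 p (measurableSet_Ioi (a := (x - m) / (1 - m)))

variable (𝕜 p n) in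
/-- The structure on `ℓ^p_{n+1} ⊕ L^p[0,1]` that consists of the function `1` and the indicator
functions of the intervals `(h j, 1]`, when the interval `[0,m]` is contracted to the atom `e_0`,
and of the other basis vectors of `ℓ^p_{n+1}`. -/
noncomputable def cutStructure (m : ℝ) (h : ℕ → ℝ) (i : ℕ) : HybridLp 𝕜 p (n + 1) :=
  if i = 0 then ((m ^ p.toReal⁻¹ : ℝ) : 𝕜) • basisVec 𝕜 p 0 + inclLp 𝕜 p (n + 1) (cutLp 𝕜 p m m)
  else if hi : i < n + 1 then basisVec 𝕜 p ⟨i, hi⟩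
  else inclLp 𝕜 p (n + 1) (cutLp 𝕜 p m (h (i - (n + 1))))

/-- Rational breakpoints are dense in (m,1), so the indicators generate all of the L^p summand;
subtracting the L^p part of the vector with index 0 then isolates the atom. -/
theorem isPresentation_cutStructure (hp : p ≠ ∞) {m : ℝ} (hm0 : 0 < m) (hm1 : m < 1) {h : ℕ → ℝ}
    (hh : ∀ q : ℚ, m < q → q < 1 → ∃ i, h i = q) :
    IsPresentation 𝕜 (cutStructure 𝕜 p n m h) := by
  set R := cutStructure 𝕜 p n m h with hR
  set M := (Submodule.span 𝕜 (Set.range R)).topologicalClosure with hM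
  have hRM : ∀ i, R i ∈ M := fun i =>
    Submodule.le_topologicalClosure _ (Submodule.subset_span ⟨i, rfl⟩)
  let ι : LpUnit 𝕜 p →ₗ[𝕜] HybridLp 𝕜 p (n + 1) :=
    { toFun := inclLp 𝕜 p (n + 1)
      map_add' := fun f g => by apply hybrid_ext <;> simp [inclLp]
      map_smul' := fun c f => by apply hybrid_ext <;> simp [inclLp] }
  have hι : Continuous ι :=
    (AddMonoidHomClass.isometry_of_norm ι fun f => WithLp.norm_toLp_snd p _ _ f).continuous
  have hV : IsClosed ((M.comap ι : Submodule 𝕜 (LpUnit 𝕜 p)) : Set (LpUnit 𝕜 p)) :=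
    (Submodule.isClosed_topologicalClosure _).preimage hι
  have hκ : (((1 - m) ^ p.toReal⁻¹ : ℝ) : 𝕜) ≠ 0 := by
    rw [Ne, RCLike.ofReal_eq_zero]
    exact (Real.rpow_pos_of_pos (by linarith) _).ne'
  have hmem : ∀ q : ℚ, m < q → q < 1 →
      indLp 𝕜 p (measurableSet_Ioi (a := ((q : ℝ) - m) / (1 - m))) ∈ M.comap ι := by
    intro q h1 h2
    obtain ⟨i, hi⟩ := hh q h1 h2
    have h3 := hRM (n + 1 + i)
    have h4 : R (n + 1 + i) = ι (cutLp 𝕜 p m q) := by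
      rw [hR, cutStructure, if_neg (by omega), dif_neg (by omega), Nat.add_sub_cancel_left, hi]
      rfl
    rw [h4, ← Submodule.mem_comap, cutLp] at h3
    exact (Submodule.smul_mem_iff _ hκ).1 h3
  have hsnd : ∀ f, ι f ∈ M := by
    intro f
    rw [← Submodule.mem_comap]
    refine mem_of_indLp_Ioi_mem hp hV (fun y hy => ?_) f
    -- Admissible breakpoints y form a closed set, and it contains the points (q - m)/(1 - m), which
    -- are dense in [0,1].
    have hcl : IsClosed {y : ℝ | indLp 𝕜 p (measurableSet_Ioi (a := y)) ∈ M.comap ι} :=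
      hV.preimage (continuous_indLp_Ioi hp)
    refine hcl.closure_subset_iff.2 subset_rfl (Metric.mem_closure_iff.2 fun ε hε => ?_)
    have hm' : 0 < 1 - m := by linarith
    obtain ⟨z, hz1, hz2⟩ := exists_between (show max 0 (y - ε) < min 1 (y + ε) by
      rw [max_lt_iff, lt_min_iff, lt_min_iff]
      exact ⟨⟨zero_lt_one, by linarith [hy.1]⟩, by linarith [hy.2], by linarith⟩)
    obtain ⟨q, hq1, hq2⟩ := exists_rat_btwn
      (show m + (1 - m) * max 0 (y - ε) < m + (1 - m) * z by gcongr)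
    have hz3 : z < 1 := hz2.trans_le (min_le_left _ _)
    have hq3 : m < q := lt_of_le_of_lt
      (by nlinarith [mul_nonneg hm'.le (le_max_left 0 (y - ε))]) hq1
    have hq4 : (q : ℝ) < 1 := by nlinarith
    refine ⟨_, hmem q hq3 (by exact_mod_cast hq4), ?_⟩
    rw [Real.dist_eq, abs_lt]
    have h1 : max 0 (y - ε) < (q - m) / (1 - m) := by
      rw [lt_div_iff₀ hm']; linarith
    have h2 : (q - m) / (1 - m) < z := by
      rw [div_lt_iff₀ hm']; linarith
    have h3 := (le_max_right 0 (y - ε)).trans_lt h1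
    have h4 := h2.trans (hz2.trans_le (min_le_right _ _))
    constructor <;> linarith
  have hbasis : ∀ i, basisVec 𝕜 p i ∈ M := by
    intro i
    by_cases hi : i = 0
    · have hc : ((m ^ p.toReal⁻¹ : ℝ) : 𝕜) ≠ 0 := by
        rw [Ne, RCLike.ofReal_eq_zero]
        exact (Real.rpow_pos_of_pos hm0 _).ne'
      have h0 : R 0 = ((m ^ p.toReal⁻¹ : ℝ) : 𝕜) • basisVec 𝕜 p 0 + ι (cutLp 𝕜 p m m) := by
        rw [hR, cutStructure, if_pos rfl]; rfl
      -- What remains is m^(1/p) e_0, and the scalar is nonzero because m > 0.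
      have h1 := M.sub_mem (hRM 0) (hsnd (cutLp 𝕜 p m m))
      rw [h0, add_sub_cancel_right, Submodule.smul_mem_iff _ hc] at h1
      rwa [hi]
    · have h1 := hRM i
      rwa [hR, cutStructure, if_neg (by rwa [Fin.val_eq_zero_iff]), dif_pos i.isLt] at h1
  intro u
  have hu : u = ∑ i, u.fst i • basisVec 𝕜 p i + ι u.snd := by
    apply hybrid_ext
    · intro k
      have : (∑ i, u.fst i • basisVec 𝕜 p i : HybridLp 𝕜 p (n + 1)).fst k =
          ∑ i, u.fst i * if k = i then 1 else 0 := by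
        rw [← WithLp.fstₗ_apply p 𝕜, map_sum]
        simp [basisVec_fst]
      rw [WithLp.add_fst, PiLp.add_apply, this]
      simp [ι, inclLp]
    · have : (∑ i, u.fst i • basisVec 𝕜 p i : HybridLp 𝕜 p (n + 1)).snd = 0 := by
        rw [← WithLp.sndₗ_apply p 𝕜, map_sum]
        simp [basisVec_snd]
      rw [WithLp.add_snd, this, zero_add]
      rfl
  have : u ∈ M := by
    rw [hu]
    exact M.add_mem (M.sum_mem fun i _ => M.smul_mem _ (hbasis i)) (hsnd _)
  rwa [hM, ← SetLike.mem_coe, Submodule.topologicalClosure_coe] at this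

end Structure

/-! ### Norms of rational vectors as integrals of step functions -/

section NormFormula

variable {𝕜 : Type*} [RCLike 𝕜] {p : ℝ≥0∞} [hp1 : Fact (1 ≤ p)] {n : ℕ}

/-- The coefficient with index `j` in a list of scalar codes, the code of `0` beyond the list. -/
def coeffCode (l : List ScalarCode) (j : ℕ) : ScalarCode := l.getD j ((0, 0), (0, 0))

variable (𝕜) in
theorem scalarVal_zero : scalarVal 𝕜 ((0, 0), (0, 0)) = 0 := by simp [scalarVal]

/-- Padding with zero coefficients allows the range of summation to be chosen large enough to
include every index of interest, even for short lists. -/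
theorem ratVec_eq_sum {B : Type*} [NormedAddCommGroup B] [NormedSpace 𝕜 B] (R : ℕ → B)
    {l : List ScalarCode} {L : ℕ} (hL : l.length ≤ L) :
    ratVec 𝕜 R l = ∑ j ∈ Finset.range L, scalarVal 𝕜 (coeffCode l j) • R j := by
  rw [← Finset.sum_subset (Finset.range_mono hL), Finset.sum_range]
  · refine Finset.sum_congr rfl fun j _ => ?_
    rw [coeffCode, List.getD_eq_getElem _ _ j.isLt]
    rfl
  · intro j _ hj
    rw [Finset.mem_range, not_lt] at hj
    rw [coeffCode, List.getD_eq_default _ _ hj, scalarVal_zero, zero_smul]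

omit hp1 in
theorem fst_sum_apply (s : Finset ℕ) (u : ℕ → HybridLp 𝕜 p n) (k : Fin n) :
    (∑ j ∈ s, u j).fst k = ∑ j ∈ s, (u j).fst k := by
  rw [← WithLp.fstₗ_apply p 𝕜, map_sum]
  simp

omit hp1 in
theorem snd_sum (s : Finset ℕ) (u : ℕ → HybridLp 𝕜 p n) :
    (∑ j ∈ s, u j).snd = ∑ j ∈ s, (u j).snd := by
  rw [← WithLp.sndₗ_apply p 𝕜, map_sum]
  simp

omit hp1 in
theorem standardHybrid_fst (i : ℕ) (k : Fin n) :
    (standardHybrid 𝕜 p n i).fst k = if i = k then 1 else 0 := by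
  rw [standardHybrid]
  by_cases hi : i < n
  · rw [dif_pos hi]
    change (basisVec 𝕜 p ⟨i, hi⟩).fst k = _
    rw [basisVec_fst]
    simp [Fin.ext_iff, eq_comm]
  · rw [dif_neg hi, if_neg (by omega)]
    rfl

theorem ratVec_standardHybrid_fst (l : List ScalarCode) (k : Fin n) :
    (ratVec 𝕜 (standardHybrid 𝕜 p n) l).fst k = scalarVal 𝕜 (coeffCode l k) := by
  rw [ratVec_eq_sum (L := l.length + n) _ (by omega), fst_sum_apply]
  simp only [WithLp.smul_fst, PiLp.smul_apply, standardHybrid_fst, smul_eq_mul, mul_ite, mul_one,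
    mul_zero]
  rw [Finset.sum_ite_eq' (Finset.range (l.length + n)), if_pos (Finset.mem_range.2 (by omega))]

omit hp1 in
theorem cutStructure_fst (m : ℝ) (h : ℕ → ℝ) (i : ℕ) (k : Fin (n + 1)) :
    (cutStructure 𝕜 p n m h i).fst k =
      if i = k then (if k = 0 then ((m ^ p.toReal⁻¹ : ℝ) : 𝕜) else 1) else 0 := by
  rw [cutStructure]
  by_cases h1 : i = 0
  · rw [if_pos h1, WithLp.add_fst, PiLp.add_apply, WithLp.smul_fst, PiLp.smul_apply, basisVec_fst]
    change _ + (0 : 𝕜) = _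
    by_cases hk : k = 0
    · simp [hk, h1]
    · have : i ≠ (k : ℕ) := by
        rw [h1]; exact fun h => hk (Fin.ext h.symm)
      simp [hk, this]
  · rw [if_neg h1]
    by_cases h2 : i < n + 1
    · rw [dif_pos h2, basisVec_fst]
      by_cases hk : i = k
      · have hk0 : k ≠ 0 := by rintro rfl; exact h1 hk
        rw [if_pos hk, if_neg hk0, if_pos (Fin.ext hk.symm)]
      · rw [if_neg hk, if_neg fun h => hk (by rw [h])]
    · rw [dif_neg h2, if_neg (by omega)]
      rfl

omit hp1 in
theorem cutStructure_snd_zero (m : ℝ) (h : ℕ → ℝ) :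
    (cutStructure 𝕜 p n m h 0).snd = cutLp 𝕜 p m m := by
  simp [cutStructure, inclLp, basisVec_snd]

omit hp1 in
theorem cutStructure_snd_of_lt (m : ℝ) (h : ℕ → ℝ) {i : ℕ} (hi0 : i ≠ 0) (hi : i < n + 1) :
    (cutStructure 𝕜 p n m h i).snd = 0 := by
  rw [cutStructure, if_neg hi0, dif_pos hi, basisVec_snd]

omit hp1 in
theorem cutStructure_snd_add (m : ℝ) (h : ℕ → ℝ) (j : ℕ) :
    (cutStructure 𝕜 p n m h (n + 1 + j)).snd = cutLp 𝕜 p m (h j) := by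
  rw [cutStructure, if_neg (by omega), dif_neg (by omega), Nat.add_sub_cancel_left]
  rfl

theorem ratVec_cutStructure_fst (m : ℝ) (h : ℕ → ℝ) (l : List ScalarCode) (k : Fin (n + 1)) :
    (ratVec 𝕜 (cutStructure 𝕜 p n m h) l).fst k = scalarVal 𝕜 (coeffCode l k) *
      if k = 0 then ((m ^ p.toReal⁻¹ : ℝ) : 𝕜) else 1 := by
  rw [ratVec_eq_sum (L := l.length + (n + 1)) _ (by omega), fst_sum_apply]
  simp only [WithLp.smul_fst, PiLp.smul_apply, cutStructure_fst, smul_eq_mul]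
  rw [Finset.sum_eq_single (k : ℕ)]
  · rw [if_pos rfl]
  · intro j _ hj; rw [if_neg hj, mul_zero]
  · intro hk
    rw [Finset.mem_range] at hk
    omega

theorem ratVec_cutStructure_snd (m : ℝ) (h : ℕ → ℝ) (l : List ScalarCode) :
    (ratVec 𝕜 (cutStructure 𝕜 p n m h) l).snd = scalarVal 𝕜 (coeffCode l 0) • cutLp 𝕜 p m m +
      ∑ j ∈ Finset.range l.length,
        scalarVal 𝕜 (coeffCode l (n + 1 + j)) • cutLp 𝕜 p m (h j) := by
  -- The indices split into 0, then 1, …, n, which have no L^p part, and then those of the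
  -- indicators. Indices beyond the list carry coefficient 0.
  rw [ratVec_eq_sum (L := n + 1 + l.length) _ (by omega), snd_sum, Finset.sum_range_add,
    Finset.sum_range_succ']
  simp only [WithLp.smul_snd, cutStructure_snd_add, cutStructure_snd_zero]
  rw [Finset.sum_eq_zero fun i hi => ?_, zero_add]
  rw [cutStructure_snd_of_lt m h (by omega) (by have := Finset.mem_range.1 hi; omega), smul_zero]

variable (𝕜 n) in
/-- The step function represented by a rational vector of `cutStructure`. -/
noncomputable def stepVal (h : ℕ → ℝ) (l : List ScalarCode) (x : ℝ) : 𝕜 :=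
  scalarVal 𝕜 (coeffCode l 0) + ∑ j ∈ Finset.range l.length,
    if h j < x then scalarVal 𝕜 (coeffCode l (n + 1 + j)) else 0

/-- The substitution x = m + (1 - m) y identifies [0,1] with [m,1] and turns the rescaled
breakpoints back into the original ones. The equality may fail at y = 0, where the indicator of
(m,1] vanishes. -/
theorem ratVec_cutStructure_snd_ae {m : ℝ} (hm1 : m < 1) (h : ℕ → ℝ) (l : List ScalarCode) :
    (ratVec 𝕜 (cutStructure 𝕜 p n m h) l).snd =ᵐ[unitMeasure] fun y =>
      (((1 - m) ^ p.toReal⁻¹ : ℝ) : 𝕜) * stepVal 𝕜 n h l (m + (1 - m) * y) := by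
  have hm' : 0 < 1 - m := by linarith
  have hcut : ∀ x, cutLp 𝕜 p m x =ᵐ[unitMeasure] fun y =>
      (((1 - m) ^ p.toReal⁻¹ : ℝ) : 𝕜) * if x < m + (1 - m) * y then 1 else 0 := by
    intro x
    have h1 : indLp 𝕜 p (measurableSet_Ioi (a := (x - m) / (1 - m))) =ᵐ[unitMeasure]
      (Set.Ioi ((x - m) / (1 - m))).indicator fun _ => (1 : 𝕜) := indicatorConstLp_coeFn
    filter_upwards [h1, Lp.coeFn_smul (((1 - m) ^ p.toReal⁻¹ : ℝ) : 𝕜)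
      (indLp 𝕜 p (measurableSet_Ioi (a := (x - m) / (1 - m))))] with y h2 h3
    rw [cutLp, h3, Pi.smul_apply, h2, smul_eq_mul, Set.indicator_apply]
    congr 2
    rw [Set.mem_Ioi, div_lt_iff₀ hm', sub_lt_iff_lt_add', mul_comm y]
  rw [ratVec_cutStructure_snd]
  have h0 : ∀ᵐ y ∂unitMeasure, y ∈ Set.Ioc (0 : ℝ) 1 := by
    rw [unitMeasure, Measure.restrict_congr_set Ioc_ae_eq_Icc.symm]
    exact ae_restrict_mem measurableSet_Ioc
  have hall : ∀ᵐ y ∂unitMeasure, ∀ j, cutLp 𝕜 p m (h j) y =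
      (((1 - m) ^ p.toReal⁻¹ : ℝ) : 𝕜) * if h j < m + (1 - m) * y then 1 else 0 :=
    ae_all_iff.2 fun j => hcut (h j)
  have hsm : ∀ᵐ y ∂unitMeasure, ∀ j,
      (scalarVal 𝕜 (coeffCode l (n + 1 + j)) • cutLp 𝕜 p m (h j) : LpUnit 𝕜 p) y =
        scalarVal 𝕜 (coeffCode l (n + 1 + j)) * cutLp 𝕜 p m (h j) y :=
    ae_all_iff.2 fun j => Lp.coeFn_smul _ _
  filter_upwards [h0, hall, hsm, hcut m, Lp.coeFn_smul (scalarVal 𝕜 (coeffCode l 0)) (cutLp 𝕜 p m m),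
    Lp.coeFn_add (scalarVal 𝕜 (coeffCode l 0) • cutLp 𝕜 p m m) (∑ j ∈ Finset.range l.length,
      scalarVal 𝕜 (coeffCode l (n + 1 + j)) • cutLp 𝕜 p m (h j)),
    Lp.coeFn_fun_finsetSum (Finset.range l.length) fun j =>
      (scalarVal 𝕜 (coeffCode l (n + 1 + j)) • cutLp 𝕜 p m (h j) : LpUnit 𝕜 p)]
    with y hy h1 h2 h3 h4 h5 h6
  rw [h5, Pi.add_apply, h4, Pi.smul_apply, h3, h6, stepVal,
    if_pos (by nlinarith [mul_pos hm' hy.1]), mul_add, Finset.mul_sum, smul_eq_mul, mul_one,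
    mul_comm]
  congr 1
  refine Finset.sum_congr rfl fun j _ => ?_
  rw [h2, h1]
  split_ifs
  · ring
  · ring

/-- All breakpoints lie above m. This constancy on [0,m] is what lets the interval be replaced by an
atom of the same mass. -/
theorem stepVal_of_le {m : ℝ} {h : ℕ → ℝ} (hh : ∀ j, m < h j) (l : List ScalarCode) {x : ℝ}
    (hx : x ≤ m) : stepVal 𝕜 n h l x = scalarVal 𝕜 (coeffCode l 0) := by
  rw [stepVal, Finset.sum_eq_zero fun j _ => if_neg (by linarith [hh j]), add_zero]

theorem measurable_stepVal (h : ℕ → ℝ) (l : List ScalarCode) :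
    Measurable (stepVal 𝕜 n h l) := by
  refine measurable_const.add (Finset.measurable_fun_sum _ fun j _ => ?_)
  exact Measurable.ite measurableSet_Ioi measurable_const measurable_const

theorem norm_stepVal_le (h : ℕ → ℝ) (l : List ScalarCode) (x : ℝ) :
    ‖stepVal 𝕜 n h l x‖ ≤ ‖scalarVal 𝕜 (coeffCode l 0)‖ +
      ∑ j ∈ Finset.range l.length, ‖scalarVal 𝕜 (coeffCode l (n + 1 + j))‖ := by
  refine (norm_add_le _ _).trans (add_le_add le_rfl ((norm_sum_le _ _).trans ?_))
  refine Finset.sum_le_sum fun j _ => ?_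
  split_ifs
  · exact le_rfl
  · rw [norm_zero]; exact norm_nonneg _

theorem intervalIntegrable_norm_stepVal {r : ℝ} (hr : 0 ≤ r) (h : ℕ → ℝ) (l : List ScalarCode)
    (a b : ℝ) : IntervalIntegrable (fun x => ‖stepVal 𝕜 n h l x‖ ^ r) volume a b := by
  rw [intervalIntegrable_iff]
  refine Measure.integrableOn_of_bounded (M := (‖scalarVal 𝕜 (coeffCode l 0)‖ +
      ∑ j ∈ Finset.range l.length, ‖scalarVal 𝕜 (coeffCode l (n + 1 + j))‖) ^ r)
    (by simp) ?_ ?_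
  · exact ((measurable_stepVal h l).norm.pow_const r).aestronglyMeasurable
  · refine Filter.Eventually.of_forall fun x => ?_
    rw [Real.norm_of_nonneg (Real.rpow_nonneg (norm_nonneg _) _)]
    exact Real.rpow_le_rpow (norm_nonneg _) (norm_stepVal_le h l x) hr

/-- The `p`-th power of the norm of a rational vector is an integral over `[0,1]`. -/
theorem norm_rpow_ratVec_cutStructure (hp : p ≠ ∞) {m : ℝ} (hm0 : 0 < m) (hm1 : m < 1)
    {h : ℕ → ℝ} (hh : ∀ j, m < h j) (l : List ScalarCode) :
    ‖ratVec 𝕜 (cutStructure 𝕜 p n m h) l‖ ^ p.toReal =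
      (∫ x in (0 : ℝ)..1, ‖stepVal 𝕜 n h l x‖ ^ p.toReal) +
        ∑ k ∈ Finset.range n, ‖scalarVal 𝕜 (coeffCode l (k + 1))‖ ^ p.toReal := by
  have hr := toReal_pos_of_ne_top hp
  have hm' : 0 < 1 - m := by linarith
  have hroot : ∀ {x : ℝ}, 0 < x → ‖((x ^ p.toReal⁻¹ : ℝ) : 𝕜)‖ ^ p.toReal = x := by
    intro x hx
    rw [RCLike.norm_ofReal, abs_of_pos (Real.rpow_pos_of_pos hx _), ← Real.rpow_mul hx.le,
      inv_mul_cancel₀ hr.ne', Real.rpow_one]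
  rw [norm_rpow_hybrid hp]
  -- The coordinate α m^(1/p) of the atom contributes m |α|^p, the integral of the step function
  -- over [0,m]. Joined to the integral over [m,1], this removes m from the formula.
  have hfst : ∑ i, ‖(ratVec 𝕜 (cutStructure 𝕜 p n m h) l).fst i‖ ^ p.toReal =
      (∫ x in (0 : ℝ)..m, ‖stepVal 𝕜 n h l x‖ ^ p.toReal) +
        ∑ k ∈ Finset.range n, ‖scalarVal 𝕜 (coeffCode l (k + 1))‖ ^ p.toReal := by
    rw [Fin.sum_univ_succ]
    congr 1
    · rw [ratVec_cutStructure_fst, if_pos rfl, norm_mul,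
        Real.mul_rpow (norm_nonneg _) (norm_nonneg _), hroot hm0]
      have : ∫ x in (0 : ℝ)..m, ‖stepVal 𝕜 n h l x‖ ^ p.toReal =
          ∫ _ in (0 : ℝ)..m, ‖scalarVal 𝕜 (coeffCode l 0)‖ ^ p.toReal := by
        refine intervalIntegral.integral_congr fun x hx => ?_
        rw [Set.uIcc_of_le hm0.le] at hx
        simp only [stepVal_of_le hh l hx.2]
      rw [this, intervalIntegral.integral_const, sub_zero, smul_eq_mul, mul_comm]
      rfl
    · rw [Finset.sum_range]
      refine Finset.sum_congr rfl fun k _ => ?_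
      rw [ratVec_cutStructure_fst, if_neg (Fin.succ_ne_zero k), mul_one, Fin.val_succ]
  have hsnd : ∫ y, ‖(ratVec 𝕜 (cutStructure 𝕜 p n m h) l).snd y‖ ^ p.toReal ∂unitMeasure =
      ∫ x in m..1, ‖stepVal 𝕜 n h l x‖ ^ p.toReal := by
    -- The Jacobian 1 - m of the substitution is matched by the scaling factor in `cutLp`.
    have h1 := intervalIntegral.mul_integral_comp_add_mul (a := 0) (b := 1)
      (f := fun x => ‖stepVal 𝕜 n h l x‖ ^ p.toReal) (1 - m) m
    rw [mul_zero, add_zero, mul_one, add_sub_cancel] at h1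
    rw [← h1, ← intervalIntegral.integral_const_mul,
      intervalIntegral.integral_of_le zero_le_one, ← integral_Icc_eq_integral_Ioc]
    refine integral_congr_ae ?_
    filter_upwards [ratVec_cutStructure_snd_ae (𝕜 := 𝕜) (p := p) (n := n) hm1 h l] with y hy
    rw [hy, norm_mul, Real.mul_rpow (norm_nonneg _) (norm_nonneg _), hroot hm']
  rw [hfst, hsnd, add_right_comm, intervalIntegral.integral_add_adjacent_intervals
    (intervalIntegrable_norm_stepVal hr.le h l _ _) (intervalIntegrable_norm_stepVal hr.le h l _ _)]

/-- The integral of a step function with breakpoints in `N⁻¹ ℤ` is a finite sum. -/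
theorem integral_norm_stepVal {r : ℝ} (hr : 0 ≤ r) {h : ℕ → ℝ} {l : List ScalarCode} {N : ℕ}
    (hN : 0 < N) (hh : ∀ j < l.length, ∃ b : ℤ, h j = b / N) :
    N * ∫ x in (0 : ℝ)..1, ‖stepVal 𝕜 n h l x‖ ^ r =
      ∑ i ∈ Finset.range N, ‖stepVal 𝕜 n h l (((i : ℝ) + 1) / N)‖ ^ r := by
  have hN' : (0 : ℝ) < N := by exact_mod_cast hN
  have h1 := intervalIntegral.sum_integral_adjacent_intervals (μ := volume) (n := N)
    (a := fun i : ℕ => (i : ℝ) / N) (f := fun x => ‖stepVal 𝕜 n h l x‖ ^ r)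
    fun k _ => intervalIntegrable_norm_stepVal hr h l _ _
  simp only [Nat.cast_zero, zero_div, div_self hN'.ne'] at h1
  rw [← h1, Finset.mul_sum]
  refine Finset.sum_congr rfl fun i _ => ?_
  have hle : (i : ℝ) / N ≤ ((i + 1 : ℕ) : ℝ) / N := by
    gcongr; exact_mod_cast Nat.le_succ i
  have h2 : ∫ x in (i : ℝ) / N..((i + 1 : ℕ) : ℝ) / N, ‖stepVal 𝕜 n h l x‖ ^ r =
      ∫ _ in (i : ℝ) / N..((i + 1 : ℕ) : ℝ) / N, ‖stepVal 𝕜 n h l (((i : ℝ) + 1) / N)‖ ^ r := by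
    refine intervalIntegral.integral_congr_ae (Filter.Eventually.of_forall fun x hx => ?_)
    rw [Set.uIoc_of_le hle] at hx
    congr 2
    simp only [stepVal]
    congr 1
    refine Finset.sum_congr rfl fun j hj => ?_
    obtain ⟨b, hb⟩ := hh j (Finset.mem_range.1 hj)
    -- No breakpoint lies strictly inside a cell (i/N, (i+1)/N], so the right end point gives the
    -- value on the whole cell.
    have h3 : h j < x ↔ h j < ((i : ℝ) + 1) / N := by
      constructor
      · intro hlt
        have := hx.2
        push_cast at this
        linarith
      · intro hlt
        rw [hb, div_lt_div_iff_of_pos_right hN'] at hlt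
        have hbi : b ≤ i := by
          have : b < (i : ℤ) + 1 := by exact_mod_cast hlt
          omega
        have : h j ≤ (i : ℝ) / N := by
          rw [hb]; gcongr; exact_mod_cast hbi
        exact this.trans_lt hx.1
    simp only [h3]
  rw [h2, intervalIntegral.integral_const, smul_eq_mul]
  push_cast
  field_simp
  ring

end NormFormula

/-! ### Computability of the norm -/

section Computability

variable {𝕜 : Type*} [RCLike 𝕜] {p : ℝ≥0∞} [hp1 : Fact (1 ≤ p)] {n : ℕ}

theorem Semi.or {α : Type*} [Primcodable α] {P Q : α → Prop} (hP : Semi P) (hQ : Semi Q) :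
    Semi fun a => P a ∨ Q a := by
  obtain ⟨D, hD, h⟩ := hP
  obtain ⟨E, hE, h'⟩ := hQ
  refine ⟨fun x => D x || E x, Primrec.or.to_comp.comp hD hE, fun a => ?_⟩
  simp only [h, h', Bool.or_eq_true, exists_or]

/-- The maximum of `0` and a rational number. -/
def ratPosPart (q : RatCode) : RatCode := ratNat q.1.toNat q.2

theorem primrec_ratPosPart : Primrec ratPosPart :=
  primrec_ratNat.comp (primrec_int_toNat.comp .fst) .snd

theorem ratPosPart_nonneg (q : RatCode) : 0 ≤ ratVal (ratPosPart q) := by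
  rw [ratPosPart, ratVal_ratNat]; positivity

theorem ratVal_ratPosPart {q : RatCode} (hq : 0 ≤ ratVal q) :
    ratVal (ratPosPart q) = ratVal q := by
  have h1 : (0 : ℚ) < (q.2 : ℚ) + 1 := by positivity
  have h2 : 0 ≤ q.1 := by
    rw [ratVal, le_div_iff₀ h1, zero_mul] at hq
    exact_mod_cast hq
  rw [ratPosPart, ratVal_ratNat, ratVal]
  congr 1
  exact_mod_cast Int.toNat_of_nonneg h2

theorem CompReal.half {α : Type*} [Primcodable α] {x : α → ℝ} (hx : CompReal x) :
    CompReal fun a => x a / 2 := by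
  obtain ⟨f, hf, h⟩ := hx
  refine ⟨fun z => ratMul (1, 1) (f z), primrec_ratMul.to_comp.comp (Computable.const _) hf,
    fun a k => ?_⟩
  have h1 := abs_lt.1 (h a k)
  have h2 : (CompBanach.ratVal (1, 1) : ℝ) = 1 / 2 := by norm_num [CompBanach.ratVal]
  rw [ratVal_ratMul, Rat.cast_mul, h2, abs_lt]
  have : (0 : ℝ) < 2⁻¹ ^ k := by positivity
  constructor <;> linarith

/-- The code of the square of the norm of a rational scalar, where `ι` is the code of the square of
the norm of the imaginary unit. -/
def normSqCode (ι : RatCode) (c : ScalarCode) : RatCode :=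
  ratAdd (ratMul c.1 c.1) (ratMul ι (ratMul c.2 c.2))

theorem primrec_normSqCode (ι : RatCode) : Primrec (normSqCode ι) :=
  primrec_ratAdd.comp (primrec_ratMul.comp .fst .fst)
    (primrec_ratMul.comp (Primrec.const ι) (primrec_ratMul.comp .snd .snd))

variable (𝕜) in
-- The imaginary unit is 0 in the real case and has norm 1 otherwise; the code ι of 0 or 1 lets both
-- fields share one formula.
theorem exists_normSqCode : ∃ ι : RatCode, ∀ c : ScalarCode,
    ‖scalarVal 𝕜 c‖ ^ 2 = (ratVal (normSqCode ι c) : ℝ) := by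
  have hcast : ∀ q : ℚ, ((q : ℚ) : 𝕜) = ((q : ℝ) : 𝕜) := fun q => (RCLike.ofReal_ratCast q).symm
  rcases RCLike.I_eq_zero_or_im_I_eq_one (K := 𝕜) with h | h
  · refine ⟨(0, 0), fun c => ?_⟩
    rw [RCLike.norm_sq_eq_def, scalarVal, h, hcast, hcast]
    simp [normSqCode]
  · refine ⟨(1, 0), fun c => ?_⟩
    rw [RCLike.norm_sq_eq_def, scalarVal, hcast, hcast]
    simp [normSqCode, h]

theorem normSqCode_nonneg {ι : RatCode} (hι : ∀ c : ScalarCode,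
    ‖scalarVal 𝕜 c‖ ^ 2 = (ratVal (normSqCode ι c) : ℝ)) (c : ScalarCode) :
    0 ≤ ratVal (normSqCode ι c) := by
  have := hι c ▸ sq_nonneg ‖scalarVal 𝕜 c‖
  exact_mod_cast this

theorem primrec_coeffCode : Primrec₂ coeffCode := Primrec.list_getD _

/-- The norm of computable rational scalars, to a computable power, is computable. -/
theorem CompReal.norm_rpow {α : Type*} [Primcodable α] {c : α → ScalarCode} (hc : Computable c)
    {r : ℝ} (hr : IsComputableReal r) (hr0 : 0 < r) :
    CompReal fun a => ‖scalarVal 𝕜 (c a)‖ ^ r := by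
  obtain ⟨ι, hι⟩ := exists_normSqCode 𝕜
  -- The square of the norm is rational, so its power r/2 is computed and no square root is needed.
  have h := CompReal.rpow (q := fun a => normSqCode ι (c a))
    ((primrec_normSqCode ι).to_comp.comp hc) (fun a => normSqCode_nonneg hι _)
    (CompReal.const hr).half (half_pos hr0)
  simpa only [norm_rpow_eq_sq_rpow _ r, hι] using h

/-- The product of the denominators of the first `L` members of a sequence. -/
def denProd (h : ℕ → RatCode) (L : ℕ) : ℕ := L.rec 1 fun j P => P * ((h j).2 + 1)

theorem computable_denProd {h : ℕ → RatCode} (hh : Computable h) : Computable (denProd h) := by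
  have : Computable₂ fun (_ : ℕ) (y : ℕ × ℕ) => y.2 * ((h y.1).2 + 1) :=
    Primrec.nat_mul.to_comp.comp (Computable.snd.comp .snd)
      (Computable.succ.comp (Computable.snd.comp (hh.comp (Computable.fst.comp .snd))))
  exact Computable.nat_rec Computable.id (Computable.const 1) this

theorem denProd_pos (h : ℕ → RatCode) (L : ℕ) : 0 < denProd h L := by
  induction L with
  | zero => exact one_pos
  | succ L ih => exact Nat.mul_pos ih (Nat.succ_pos _)

theorem dvd_denProd (h : ℕ → RatCode) {L j : ℕ} (hj : j < L) : (h j).2 + 1 ∣ denProd h L := by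
  induction L with
  | zero => omega
  | succ L ih =>
    rcases Nat.lt_succ_iff_lt_or_eq.1 hj with h1 | rfl
    · exact (ih h1).mul_right _
    · exact Dvd.intro_left _ rfl

theorem exists_eq_div_denProd (h : ℕ → RatCode) {L j : ℕ} (hj : j < L) :
    ∃ b : ℤ, (ratVal (h j) : ℝ) = b / denProd h L := by
  obtain ⟨c, hc⟩ := dvd_denProd h hj
  have hc0 : (c : ℝ) ≠ 0 := by
    rintro h0
    have h0 : c = 0 := by exact_mod_cast h0
    have := denProd_pos h L
    rw [hc, h0] at this
    omega
  refine ⟨(h j).1 * c, ?_⟩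
  have h1 : ((h j).2 : ℝ) + 1 ≠ 0 := by positivity
  rw [hc, ratVal]
  push_cast
  field_simp

/-- The code of the right end point of the `i`-th interval of the partition of `[0,1]` adapted to a
rational vector. -/
def gridCode (h : ℕ → RatCode) (L i : ℕ) : RatCode := ratNat (i + 1) (denProd h L - 1)

theorem ratVal_gridCode (h : ℕ → RatCode) (L i : ℕ) :
    (ratVal (gridCode h L i) : ℝ) = ((i : ℝ) + 1) / denProd h L := by
  rw [gridCode, ratVal_ratNat, Nat.cast_sub (denProd_pos h L)]
  push_cast
  rw [sub_add_cancel]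

/-- The real or the imaginary part of the value of a step function, selected by `f`. -/
def stepPart (n : ℕ) (h : ℕ → RatCode) (f : ScalarCode → RatCode) (l : List ScalarCode) (i : ℕ) :
    RatCode :=
  ratAdd (f (coeffCode l 0)) (ratSum (fun j => cond
    (decide (ratVal (h j) < ratVal (gridCode h l.length i))) (f (coeffCode l (n + 1 + j))) (0, 0))
    l.length)

theorem computable_stepPart (n : ℕ) {h : ℕ → RatCode} (hh : Computable h)
    {f : ScalarCode → RatCode} (hf : Computable f) : Computable₂ (stepPart n h f) := by
  have hlen : Computable fun x : (List ScalarCode × ℕ) × ℕ => x.1.1.length :=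
    Computable.list_length.comp (Computable.fst.comp .fst)
  have hgrid : Computable fun x : (List ScalarCode × ℕ) × ℕ => gridCode h x.1.1.length x.1.2 :=
    primrec_ratNat.to_comp.comp (Computable.succ.comp (Computable.snd.comp .fst))
      (Computable.pred.comp ((computable_denProd hh).comp hlen))
  have hdec : Computable fun x : (List ScalarCode × ℕ) × ℕ =>
      decide (ratVal (h x.2) < ratVal (gridCode h x.1.1.length x.1.2)) :=
    (primrec_ratVal_lt.decide.to_comp).comp (hh.comp .snd) hgrid
  have hcoef : Computable fun x : (List ScalarCode × ℕ) × ℕ =>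
      f (coeffCode x.1.1 (n + 1 + x.2)) :=
    hf.comp (primrec_coeffCode.to_comp.comp (Computable.fst.comp .fst)
      (Primrec.nat_add.to_comp.comp (Computable.const (n + 1)) .snd))
  have hterm : Computable₂ fun (x : List ScalarCode × ℕ) (j : ℕ) => cond
      (decide (ratVal (h j) < ratVal (gridCode h x.1.length x.2)))
      (f (coeffCode x.1 (n + 1 + j))) (0, 0) :=
    Computable.cond hdec hcoef (Computable.const (0, 0))
  have hzero : Computable fun x : List ScalarCode × ℕ => f (coeffCode x.1 0) :=
    hf.comp (primrec_coeffCode.to_comp.comp .fst (Computable.const 0))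
  exact primrec_ratAdd.to_comp.comp hzero
    (computable_ratSum hterm (Computable.list_length.comp .fst))

/-- The code of the value of a step function on an interval of the partition. -/
def stepCode (n : ℕ) (h : ℕ → RatCode) (l : List ScalarCode) (i : ℕ) : ScalarCode :=
  (stepPart n h Prod.fst l i, stepPart n h Prod.snd l i)

theorem computable_stepCode (n : ℕ) {h : ℕ → RatCode} (hh : Computable h) :
    Computable₂ (stepCode n h) :=
  Computable.pair (computable_stepPart n hh Computable.fst)
    (computable_stepPart n hh Computable.snd)

theorem scalarVal_stepCode (h : ℕ → RatCode) (l : List ScalarCode) (i : ℕ) :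
    scalarVal 𝕜 (stepCode n h l i) = stepVal 𝕜 n (fun j => (ratVal (h j) : ℝ)) l
      (((i : ℝ) + 1) / denProd h l.length) := by
  have hpart : ∀ f : ScalarCode → RatCode, ((ratVal (stepPart n h f l i) : ℚ) : 𝕜) =
      ((ratVal (f (coeffCode l 0)) : ℚ) : 𝕜) + ∑ j ∈ Finset.range l.length,
        if (ratVal (h j) : ℝ) < ((i : ℝ) + 1) / denProd h l.length then
          ((ratVal (f (coeffCode l (n + 1 + j))) : ℚ) : 𝕜) else 0 := by
    intro f
    rw [stepPart, ratVal_ratAdd, ratVal_ratSum]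
    push_cast
    congr 1
    refine Finset.sum_congr rfl fun j _ => ?_
    rw [← ratVal_gridCode]
    by_cases hj : ratVal (h j) < ratVal (gridCode h l.length i)
    · rw [if_pos (by exact_mod_cast hj), decide_eq_true hj, cond_true]
    · rw [if_neg (by exact_mod_cast hj), decide_eq_false hj, cond_false, ratVal_zero,
        Rat.cast_zero]
  rw [stepVal, scalarVal, stepCode, hpart, hpart, add_mul, add_add_add_comm, Finset.sum_mul,
    ← Finset.sum_add_distrib]
  congr 1
  refine Finset.sum_congr rfl fun j _ => ?_
  split_ifs
  · rfl
  · simp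

/-- No roots have to be extracted. To compare the norm with a rational q ≥ 0, compare N ‖u‖^p, a
finite sum of computable powers, with N q^p. Thus both cuts of the norm are semidecidable. -/
theorem compReal_norm_ratVec (hp : p ≠ ∞) (hpc : IsComputableReal p.toReal) {m : ℝ} (hm0 : 0 < m)
    (hm1 : m < 1) {h : ℕ → RatCode} (hh : Computable h) (hmh : ∀ j, m < (ratVal (h j) : ℝ)) :
    CompReal fun l : List ScalarCode =>
      ‖ratVec 𝕜 (cutStructure 𝕜 p n m fun j => (ratVal (h j) : ℝ)) l‖ := by
  have hr := toReal_pos_of_ne_top hp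
  set r := p.toReal with hrdef
  let N : List ScalarCode → ℕ := fun l => denProd h l.length
  have hN : Computable N := (computable_denProd hh).comp Computable.list_length
  let Y : List ScalarCode → ℝ := fun l => ∑ i ∈ Finset.range (N l),
    (‖scalarVal 𝕜 (stepCode n h l i)‖ ^ r +
      ∑ k ∈ Finset.range n, ‖scalarVal 𝕜 (coeffCode l (k + 1))‖ ^ r)
  have hY : CompReal Y := by
    refine CompReal.sum (CompReal.add (CompReal.norm_rpow (computable_stepCode n hh) hpc hr) ?_) hN
    refine CompReal.sum (x := fun (z : List ScalarCode × ℕ) k =>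
      ‖scalarVal 𝕜 (coeffCode z.1 (k + 1))‖ ^ r) (CompReal.norm_rpow ?_ hpc hr)
      (Computable.const n)
    exact primrec_coeffCode.to_comp.comp (Computable.fst.comp .fst) (Computable.succ.comp .snd)
  let Z : List ScalarCode × RatCode → ℝ := fun z => ∑ _i ∈ Finset.range (N z.1),
    (ratVal (ratPosPart z.2) : ℝ) ^ r
  have hZ : CompReal Z := by
    refine CompReal.sum (CompReal.rpow (q := fun w : (List ScalarCode × RatCode) × ℕ =>
      ratPosPart w.1.2) (primrec_ratPosPart.to_comp.comp (Computable.snd.comp .fst))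
      (fun _ => ratPosPart_nonneg _) (CompReal.const hpc) hr) (hN.comp .fst)
  have hYZ : ∀ l q, (Y l < Z (l, q) ↔ ‖ratVec 𝕜 (cutStructure 𝕜 p n m
        fun j => (ratVal (h j) : ℝ)) l‖ < ratVal (ratPosPart q)) ∧
      (Z (l, q) < Y l ↔ (ratVal (ratPosPart q) : ℝ) < ‖ratVec 𝕜 (cutStructure 𝕜 p n m
        fun j => (ratVal (h j) : ℝ)) l‖) := by
    intro l q
    have hNl : (0 : ℝ) < N l := by exact_mod_cast denProd_pos h l.length
    have h1 : Y l = N l * ‖ratVec 𝕜 (cutStructure 𝕜 p n m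
        fun j => (ratVal (h j) : ℝ)) l‖ ^ r := by
      rw [norm_rpow_ratVec_cutStructure hp hm0 hm1 hmh, mul_add,
        integral_norm_stepVal hr.le (denProd_pos h l.length)
          fun j hj => exists_eq_div_denProd h hj]
      simp only [Y, Finset.sum_add_distrib, scalarVal_stepCode, Finset.sum_const,
        Finset.card_range, nsmul_eq_mul, N]
      rfl
    have h2 : Z (l, q) = N l * (ratVal (ratPosPart q) : ℝ) ^ r := by
      simp only [Z, Finset.sum_const, Finset.card_range, nsmul_eq_mul]
    have h3 : (0 : ℝ) ≤ ratVal (ratPosPart q) := by exact_mod_cast ratPosPart_nonneg q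
    rw [h1, h2, mul_lt_mul_iff_right₀ hNl, mul_lt_mul_iff_right₀ hNl,
      Real.rpow_lt_rpow_iff (norm_nonneg _) h3 hr, Real.rpow_lt_rpow_iff h3 (norm_nonneg _) hr]
    exact ⟨Iff.rfl, Iff.rfl⟩
  have s1 : Semi fun z : List ScalarCode × RatCode => ratVal z.2 < ratVal (0, 0) :=
    Semi.ratVal_lt .snd (Computable.const _)
  have s2 : Semi fun z : List ScalarCode × RatCode => ratVal (0, 0) ≤ ratVal z.2 :=
    Semi.ratVal_le (Computable.const _) .snd
  have hYf : CompReal fun z : List ScalarCode × RatCode => Y z.1 := hY.comp .fst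
  refine CompReal.of_cuts ?_ ?_
  -- Negative rationals are below the norm outright; the comparison of powers is meaningful only for
  -- q ≥ 0, where q equals its positive part.
  · refine (s1.or (s2.and (hZ.lt hYf))).of_eq fun z => ?_
    rw [ratVal_zero]
    have h2 := (hYZ z.1 z.2).2
    constructor
    · rintro (h0 | ⟨h0, h1⟩)
      · exact lt_of_lt_of_le (by exact_mod_cast h0) (norm_nonneg _)
      · rw [← ratVal_ratPosPart h0]; exact h2.1 h1
    · intro hz
      rcases lt_or_ge (ratVal z.2) 0 with h0 | h0
      · exact Or.inl h0
      · exact Or.inr ⟨h0, h2.2 (by rwa [ratVal_ratPosPart h0])⟩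
  · refine (s2.and (hYf.lt hZ)).of_eq fun z => ?_
    rw [ratVal_zero]
    have h2 := (hYZ z.1 z.2).1
    constructor
    · rintro ⟨h0, h1⟩
      rw [← ratVal_ratPosPart h0]; exact h2.1 h1
    · intro hz
      have h0 : 0 ≤ ratVal z.2 := by exact_mod_cast (norm_nonneg _).trans hz.le
      exact ⟨h0, h2.2 (by rwa [ratVal_ratPosPart h0])⟩

theorem isComputablePresentation_cutStructure (hp : p ≠ ∞) (hpc : IsComputableReal p.toReal)
    {m : ℝ} (hm0 : 0 < m) (hm1 : m < 1) {h : ℕ → RatCode} (hh : Computable h)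
    (hmh : ∀ q : RatCode, (m < (ratVal q : ℝ) ∧ ratVal q < 1) ↔ ∃ i, h i = q) :
    IsComputablePresentation 𝕜 (cutStructure 𝕜 p n m fun j => (ratVal (h j) : ℝ)) := by
  refine ⟨isPresentation_cutStructure hp hm0 hm1 fun q h1 h2 => ?_, compReal_norm_ratVec hp hpc hm0
    hm1 hh fun j => ((hmh (h j)).2 ⟨j, rfl⟩).1⟩
  obtain ⟨q, rfl⟩ := ratVal_surjective q
  obtain ⟨i, hi⟩ := (hmh q).1 ⟨h1, h2⟩
  exact ⟨i, by rw [hi]⟩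

end Computability

/-! ### Decoding an isometric isomorphism -/

section Decoding

variable {𝕜 : Type*} [RCLike 𝕜] {p : ℝ≥0∞} [hp1 : Fact (1 ≤ p)] {n : ℕ}

theorem norm_fst_apply_le (u : HybridLp 𝕜 p n) (i : Fin n) : ‖u.fst i‖ ≤ ‖u‖ :=
  (PiLp.norm_apply_le u.fst i).trans (WithLp.norm_fst_le _ u)

/-- The radius of the ball with a given code. -/
def radiusCode (c : BallCode) : RatCode := ratNat (c.2.1 + 1) c.2.2

theorem ratVal_radiusCode (c : BallCode) :
    (ratVal (radiusCode c) : ℝ) = ((c.2.1 : ℝ) + 1) / ((c.2.2 : ℝ) + 1) := by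
  rw [radiusCode, ratVal_ratNat]; push_cast; rfl

theorem radiusCode_pos (c : BallCode) : (0 : ℝ) < ratVal (radiusCode c) := by
  rw [ratVal_radiusCode]; positivity

theorem ratVec_mem_ratBall (R : ℕ → HybridLp 𝕜 p n) (c : BallCode) :
    ratVec 𝕜 R c.1 ∈ ratBall 𝕜 R c := by
  rw [ratBall, ← ratVal_radiusCode]
  exact Metric.mem_ball_self (radiusCode_pos c)

/-- If an isometry maps one rational ball into another one, then the coefficients of the centres
that belong to corresponding atoms are related. -/
theorem abs_sub_lt_of_image_subset {m : ℝ} (hm0 : 0 < m) {h : ℕ → ℝ}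
    {T : HybridLp 𝕜 p (n + 1) → HybridLp 𝕜 p (n + 1)} {j : Fin (n + 1)} {θ : 𝕜} (hθ : ‖θ‖ = 1)
    (hT : ∀ u, (T u).fst 0 = θ * u.fst j) {c c' : BallCode}
    (hc : T '' ratBall 𝕜 (standardHybrid 𝕜 p (n + 1)) c ⊆ ratBall 𝕜 (cutStructure 𝕜 p n m h) c') :
    |‖scalarVal 𝕜 (coeffCode c.1 j)‖ - ‖scalarVal 𝕜 (coeffCode c'.1 0)‖ * m ^ p.toReal⁻¹| <
      ratVal (radiusCode c') := by
  -- Only the image of the centre is used. Coordinates are bounded by the norm, and coordinate 0 of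
  -- the target centre is α' m^(1/p).
  have h1 := hc ⟨_, ratVec_mem_ratBall _ c, rfl⟩
  rw [ratBall, ← ratVal_radiusCode, Metric.mem_ball, dist_eq_norm] at h1
  refine lt_of_le_of_lt ?_ ((norm_fst_apply_le _ 0).trans_lt h1)
  rw [WithLp.sub_fst, PiLp.sub_apply, hT, ratVec_standardHybrid_fst, ratVec_cutStructure_fst,
    if_pos rfl]
  refine le_trans (le_of_eq ?_) (abs_norm_sub_norm_le _ _)
  rw [norm_mul, norm_mul, hθ, one_mul, RCLike.norm_ofReal,
    abs_of_pos (Real.rpow_pos_of_pos hm0 _)]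
  rfl

/-- The inequalities `|α'| ≤ y` and `x y + r' ≤ |α|` between the coefficients `α` and `α'` of the
centres of two rational balls, the radius `r'` of the second ball, and `x ≥ 0` and `y > 0`. -/
def BallsCertify (ι : RatCode) (j : ℕ) (z : (BallCode × BallCode) × RatCode × RatCode) : Prop :=
  ratVal (0, 0) < ratVal z.2.2 ∧
    ratVal (normSqCode ι (coeffCode z.1.2.1 0)) ≤ ratVal (ratMul z.2.2 z.2.2) ∧
    ratVal (ratMul (ratAdd (ratMul (ratPosPart z.2.1) z.2.2) (radiusCode z.1.2))
      (ratAdd (ratMul (ratPosPart z.2.1) z.2.2) (radiusCode z.1.2))) ≤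
      ratVal (normSqCode ι (coeffCode z.1.1.1 j))

theorem semi_ballsCertify (ι : RatCode) (j : ℕ) : Semi (BallsCertify ι j) := by
  have hy : Computable fun z : (BallCode × BallCode) × RatCode × RatCode => z.2.2 :=
    Computable.snd.comp .snd
  have hx : Computable fun z : (BallCode × BallCode) × RatCode × RatCode => ratPosPart z.2.1 :=
    primrec_ratPosPart.to_comp.comp (Computable.fst.comp .snd)
  have hc' : Computable fun z : (BallCode × BallCode) × RatCode × RatCode => z.1.2 :=
    Computable.snd.comp .fst
  have hr : Computable fun z : (BallCode × BallCode) × RatCode × RatCode => radiusCode z.1.2 :=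
    primrec_ratNat.to_comp.comp
      (Computable.succ.comp (Computable.fst.comp (Computable.snd.comp hc')))
      (Computable.snd.comp (Computable.snd.comp hc'))
  have ha : Computable fun z : (BallCode × BallCode) × RatCode × RatCode =>
      normSqCode ι (coeffCode z.1.2.1 0) :=
    (primrec_normSqCode ι).to_comp.comp
      (primrec_coeffCode.to_comp.comp (Computable.fst.comp hc') (Computable.const 0))
  have hu : Computable fun z : (BallCode × BallCode) × RatCode × RatCode =>
      normSqCode ι (coeffCode z.1.1.1 j) :=
    (primrec_normSqCode ι).to_comp.comp (primrec_coeffCode.to_comp.comp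
      (Computable.fst.comp (Computable.fst.comp .fst)) (Computable.const j))
  have hs : Computable fun z : (BallCode × BallCode) × RatCode × RatCode =>
      ratAdd (ratMul (ratPosPart z.2.1) z.2.2) (radiusCode z.1.2) :=
    primrec_ratAdd.to_comp.comp (primrec_ratMul.to_comp.comp hx hy) hr
  exact ((Semi.ratVal_lt (Computable.const (0, 0)) hy).and
    ((Semi.ratVal_le ha (primrec_ratMul.to_comp.comp hy hy)).and
      (Semi.ratVal_le (primrec_ratMul.to_comp.comp hs hs) hu))).of_eq fun z => Iff.rfl

/-- Both sides are nonnegative, so squaring loses nothing and leaves comparisons of rationals. -/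
theorem ballsCertify_iff {ι : RatCode} (hι : ∀ c : ScalarCode,
    ‖scalarVal 𝕜 c‖ ^ 2 = (ratVal (normSqCode ι c) : ℝ)) {j : ℕ} {c c' : BallCode}
    {x y : RatCode} (hy : (0 : ℝ) < ratVal y) :
    BallsCertify ι j ((c, c'), x, y) ↔ ‖scalarVal 𝕜 (coeffCode c'.1 0)‖ ≤ ratVal y ∧
      (ratVal (ratPosPart x) : ℝ) * ratVal y + ratVal (radiusCode c') ≤
        ‖scalarVal 𝕜 (coeffCode c.1 j)‖ := by
  have hx : (0 : ℝ) ≤ ratVal (ratPosPart x) := by exact_mod_cast ratPosPart_nonneg x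
  have hr := radiusCode_pos c'
  have h0 : (0 : ℝ) ≤ (ratVal (ratPosPart x) : ℝ) * ratVal y + ratVal (radiusCode c') := by
    positivity
  rw [BallsCertify, ← pow_le_pow_iff_left₀ (norm_nonneg _) hy.le two_ne_zero,
    ← pow_le_pow_iff_left₀ h0 (norm_nonneg _) two_ne_zero, hι, hι, ratVal_zero]
  simp only [ratVal_ratMul, ratVal_ratAdd]
  rw [← Rat.cast_le (K := ℝ), ← Rat.cast_le (K := ℝ), and_iff_right (by exact_mod_cast hy)]
  push_cast
  rw [sq, sq]

/-- Soundness of the certificates: x y ≤ |α| - r' < |α'| m^(1/p) ≤ y m^(1/p), with y > 0. -/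
theorem lt_root_of_ballsCertify {ι : RatCode} (hι : ∀ c : ScalarCode,
    ‖scalarVal 𝕜 c‖ ^ 2 = (ratVal (normSqCode ι c) : ℝ)) {m : ℝ} (hm0 : 0 < m) {h : ℕ → ℝ}
    {T : HybridLp 𝕜 p (n + 1) → HybridLp 𝕜 p (n + 1)} {j : Fin (n + 1)} {θ : 𝕜} (hθ : ‖θ‖ = 1)
    (hT : ∀ u, (T u).fst 0 = θ * u.fst j) {c c' : BallCode}
    (hc : T '' ratBall 𝕜 (standardHybrid 𝕜 p (n + 1)) c ⊆ ratBall 𝕜 (cutStructure 𝕜 p n m h) c')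
    {x y : RatCode} (hb : BallsCertify ι j ((c, c'), x, y)) :
    (ratVal (ratPosPart x) : ℝ) < m ^ p.toReal⁻¹ := by
  have hy : (0 : ℝ) < ratVal y := by
    have := hb.1
    rw [ratVal_zero] at this
    exact_mod_cast this
  obtain ⟨h1, h2⟩ := (ballsCertify_iff hι hy).1 hb
  have h3 := (abs_lt.1 (abs_sub_lt_of_image_subset hm0 hθ hT hc)).2
  have hM : 0 < m ^ p.toReal⁻¹ := Real.rpow_pos_of_pos hm0 _
  have h4 := mul_le_mul_of_nonneg_right h1 hM.le
  have h5 : (ratVal (ratPosPart x) : ℝ) * ratVal y < m ^ p.toReal⁻¹ * ratVal y := by linarith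
  exact lt_of_mul_lt_mul_right h5 hy.le

/-- Completeness of the certificates: a target ball inside a small neighbourhood of T e_j has |α'|
m^(1/p) close to 1 and a small radius, so the bound read off from it is as close to m^(1/p) as
desired. -/
theorem exists_ballsCertify {ι : RatCode} (hι : ∀ c : ScalarCode,
    ‖scalarVal 𝕜 c‖ ^ 2 = (ratVal (normSqCode ι c) : ℝ)) {m : ℝ} (hm0 : 0 < m) (hm1 : m < 1)
    (hp : p ≠ ∞) {h : ℕ → ℝ}
    {T : HybridLp 𝕜 p (n + 1) → HybridLp 𝕜 p (n + 1)} {j : Fin (n + 1)} {θ : 𝕜} (hθ : ‖θ‖ = 1)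
    (hT : ∀ u, (T u).fst 0 = θ * u.fst j) {P : BallCode →. BallCode}
    (hP : ∀ c c' : BallCode, c' ∈ P c → T '' ratBall 𝕜 (standardHybrid 𝕜 p (n + 1)) c ⊆
      ratBall 𝕜 (cutStructure 𝕜 p n m h) c')
    (hP' : ∀ v, ∀ U ∈ 𝓝 (T v), ∃ c c' : BallCode, c' ∈ P c ∧
      v ∈ ratBall 𝕜 (standardHybrid 𝕜 p (n + 1)) c ∧ ratBall 𝕜 (cutStructure 𝕜 p n m h) c' ⊆ U)
    {x : RatCode} (hx : (ratVal (ratPosPart x) : ℝ) < m ^ p.toReal⁻¹) :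
    ∃ c c' y, c' ∈ P c ∧ BallsCertify ι j ((c, c'), x, y) := by
  have hr := toReal_pos_of_ne_top hp
  set M := m ^ p.toReal⁻¹ with hM
  set ξ : ℝ := (ratVal (ratPosPart x) : ℝ) with hξ
  have hξ0 : 0 ≤ ξ := by rw [hξ]; exact_mod_cast ratPosPart_nonneg x
  have hM1 : M < 1 := Real.rpow_lt_one hm0.le hm1 (inv_pos.2 hr)
  have hM0 : 0 < M := Real.rpow_pos_of_pos hm0 _
  -- The certificate needs (M - ξ) a' ≥ 4ξε + 2r'. The right side is at most 8ε, and a' ≥ 1/2,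
  -- whence the factor 16.
  set ε := (M - ξ) / 16 with hε
  have hε0 : 0 < ε := by rw [hε]; linarith
  obtain ⟨c, c', hcc, -, hsub⟩ := hP' (basisVec 𝕜 p j) _ (Metric.ball_mem_nhds _ hε0)
  have h1 := abs_sub_lt_of_image_subset hm0 hθ hT (hP c c' hcc)
  set a := ‖scalarVal 𝕜 (coeffCode c.1 j)‖ with ha
  set a' := ‖scalarVal 𝕜 (coeffCode c'.1 0)‖ with ha'
  set u' := ratVec 𝕜 (cutStructure 𝕜 p n m h) c'.1 with hu'
  have hcen := hsub (ratVec_mem_ratBall _ c')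
  rw [Metric.mem_ball, dist_eq_norm] at hcen
  have h2 : 1 - ε < a' * M := by
    have h3 := (norm_fst_apply_le (u' - T (basisVec 𝕜 p j)) 0).trans_lt hcen
    rw [WithLp.sub_fst, PiLp.sub_apply, hT, ratVec_cutStructure_fst, if_pos rfl, basisVec_fst,
      if_pos rfl, mul_one] at h3
    have h4 := (abs_lt.1 ((abs_norm_sub_norm_le _ _).trans_lt h3)).1
    rw [hθ, norm_mul, RCLike.norm_ofReal, abs_of_pos (Real.rpow_pos_of_pos hm0 _)] at h4
    have h5 : ‖scalarVal 𝕜 (coeffCode c'.1 ((0 : Fin (n + 1)) : ℕ))‖ = a' := rfl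
    rw [h5, ← hM] at h4
    linarith
  -- Move from the centre by t e_0 for every t below the radius: both points stay within ε of T e_j,
  -- so t < 2ε.
  have hrad : (ratVal (radiusCode c') : ℝ) ≤ 2 * ε := by
    refine le_of_forall_lt_imp_le_of_dense fun t ht => ?_
    rcases le_or_gt t 0 with ht0 | ht0
    · linarith
    have hmem : u' + (t : 𝕜) • basisVec 𝕜 p 0 ∈ ratBall 𝕜 (cutStructure 𝕜 p n m h) c' := by
      rw [ratBall, ← ratVal_radiusCode, Metric.mem_ball, dist_eq_norm, add_sub_cancel_left,
        norm_smul, norm_basisVec, mul_one, RCLike.norm_ofReal, abs_of_pos ht0]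
      exact ht
    have h3 := hsub hmem
    rw [Metric.mem_ball, dist_eq_norm] at h3
    have h4 : t = ‖(t : 𝕜) • basisVec (n := n + 1) 𝕜 p 0‖ := by
      rw [norm_smul, norm_basisVec, mul_one, RCLike.norm_ofReal, abs_of_pos ht0]
    have h5 : (t : 𝕜) • basisVec 𝕜 p 0 = (u' + (t : 𝕜) • basisVec 𝕜 p 0 - T (basisVec 𝕜 p j)) -
        (u' - T (basisVec 𝕜 p j)) := by abel
    rw [h4, h5]
    refine (norm_sub_le _ _).trans ?_
    linarith
  have ha'0 : 0 ≤ a' := norm_nonneg _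
  -- The norm a' may be irrational, so a rational y slightly above it replaces it in the
  -- certificate.
  obtain ⟨y, hy1, hy2⟩ := exists_rat_btwn (show a' < a' + 4 * ε by linarith)
  obtain ⟨y, rfl⟩ := ratVal_surjective y
  refine ⟨c, c', y, hcc, (ballsCertify_iff hι (ha'0.trans_lt hy1)).2 ⟨hy1.le, ?_⟩⟩
  have h6 := (abs_lt.1 h1).1
  have h7 : a' * M ≤ a' := mul_le_of_le_one_right ha'0 hM1.le
  have h8 : ξ * ratVal y ≤ ξ * (a' + 4 * ε) := mul_le_mul_of_nonneg_left hy2.le hξ0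
  have h9 : ξ * (4 * ε) ≤ 4 * ε := mul_le_of_le_one_left (by linarith) (by linarith)
  have h10 : 1 / 2 ≤ a' := by linarith
  have h11 : 16 * ε * (1 / 2) ≤ (M - ξ) * a' := by
    have : M - ξ = 16 * ε := by rw [hε]; ring
    rw [this]
    exact mul_le_mul_of_nonneg_left h10 (by linarith)
  nlinarith

/-- Any oracle that computes an isometric isomorphism onto `cutStructure` decides the set that is
coded by the lower cut of the measure of the atom. -/
theorem turingReducible_of_isComputableMapIn (hp : p ≠ ∞) (hp2 : p ≠ 2)
    (hpc : IsComputableReal p.toReal) {m : ℝ} (hm0 : 0 < m) (hm1 : m < 1) {h : ℕ → ℝ}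
    {A X : Set ℕ} {μ : ℕ → RatCode} (hμ : Computable μ) {E : ℕ → ℕ → Bool} (hE : Computable₂ E)
    (hex : ∀ k, ∃ s, k < s ∧ (ratVal (μ s) : ℝ) < m + 2⁻¹ ^ (k + 2))
    (hdec : ∀ k s, k < s → (ratVal (μ s) : ℝ) < m + 2⁻¹ ^ (k + 2) → (k ∈ A ↔ E k s = true))
    (T : HybridLp 𝕜 p (n + 1) ≃ₗᵢ[𝕜] HybridLp 𝕜 p (n + 1))
    (hT : IsComputableMapIn 𝕜 X (standardHybrid 𝕜 p (n + 1)) (cutStructure 𝕜 p n m h) T) :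
    TuringReducible (charFun A) (charFun X) := by
  have hr := toReal_pos_of_ne_top hp
  -- The index j and the code ι are finite information, fixed once and built into the algorithm; θ
  -- enters only through its norm 1.
  obtain ⟨j, θ, hθ, -, hTj⟩ := exists_coordinate_of_isometry hp hp2 T 0
  obtain ⟨ι, hι⟩ := exists_normSqCode 𝕜
  obtain ⟨P, hP, hP1, hP2⟩ := hT
  rw [charFun_eq] at hP
  obtain ⟨S, hS, hSP⟩ := exists_semi_graph _ hP
  have hmr : (m ^ p.toReal⁻¹) ^ p.toReal = m := by
    rw [← Real.rpow_mul hm0.le, inv_mul_cancel₀ hr.ne', Real.rpow_one]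
  have hM0 : 0 < m ^ p.toReal⁻¹ := Real.rpow_pos_of_pos hm0 _
  -- Stage s decides k as soon as `low k s` < m. The search looks for a certified x with `low k s` <
  -- x^p, where certification ensures x^p < m.
  let low : ℕ → ℕ → RatCode := fun k s => ratAdd (μ s) (ratNeg (ratHalfPow (k + 2)))
  have hlow : ∀ k s, (ratVal (low k s) : ℝ) = ratVal (μ s) - 2⁻¹ ^ (k + 2) := by
    intro k s; simp [low, sub_eq_add_neg]
  let Q : (List ℕ × ℕ × ℕ) × ((BallCode × BallCode) × RatCode × RatCode) → Prop := fun z =>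
    (S (z.1.1, z.2.1) ∧ BallsCertify ι j z.2) ∧ (z.1.2.1 < z.1.2.2 ∧
      (ratVal (low z.1.2.1 z.1.2.2) : ℝ) < (ratVal (ratPosPart z.2.2.1) : ℝ) ^ p.toReal)
  have hQ : Semi Q := by
    have s1 := hS.comp (f := fun z : (List ℕ × ℕ × ℕ) ×
      ((BallCode × BallCode) × RatCode × RatCode) => (z.1.1, z.2.1))
      ((Computable.fst.comp .fst).pair (Computable.fst.comp .snd))
    have s2 := (semi_ballsCertify ι j).comp (f := fun z : (List ℕ × ℕ × ℕ) ×
      ((BallCode × BallCode) × RatCode × RatCode) => z.2) Computable.snd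
    have hk : Computable fun z : (List ℕ × ℕ × ℕ) ×
      ((BallCode × BallCode) × RatCode × RatCode) => z.1.2.1 :=
      Computable.fst.comp (Computable.snd.comp .fst)
    have hs : Computable fun z : (List ℕ × ℕ × ℕ) ×
      ((BallCode × BallCode) × RatCode × RatCode) => z.1.2.2 :=
      Computable.snd.comp (Computable.snd.comp .fst)
    have s3 : Semi fun z : (List ℕ × ℕ × ℕ) ×
      ((BallCode × BallCode) × RatCode × RatCode) => z.1.2.1 < z.1.2.2 :=
      (Semi.of_primrec (P := fun w : ℕ × ℕ => w.1 < w.2) Primrec.nat_lt).comp (hk.pair hs)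
    have c1 : CompReal fun z : (List ℕ × ℕ × ℕ) ×
        ((BallCode × BallCode) × RatCode × RatCode) =>
        (ratVal (low z.1.2.1 z.1.2.2) : ℝ) :=
      CompReal.ratVal (primrec_ratAdd.to_comp.comp (hμ.comp hs) (primrec_ratNeg.to_comp.comp
        (primrec_ratHalfPow.to_comp.comp (Computable.succ.comp (Computable.succ.comp hk)))))
    have c2 : CompReal fun z : (List ℕ × ℕ × ℕ) ×
        ((BallCode × BallCode) × RatCode × RatCode) =>
        (ratVal (ratPosPart z.2.2.1) : ℝ) ^ p.toReal :=
      CompReal.rpow (primrec_ratPosPart.to_comp.comp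
        (Computable.fst.comp (Computable.snd.comp .snd))) (fun _ => ratPosPart_nonneg _)
        (CompReal.const hpc) hr
    exact (s1.and s2).and (s3.and (c1.lt c2))
  refine turingReducible_of_search hQ.exists hE (fun k => ?_) fun k l s hks => ?_
  · obtain ⟨s, hks, hs⟩ := hex k
    -- The number `low k s` may be negative; truncation at 0 makes its p-th root meaningful and
    -- keeps it below m.
    have hlt : max 0 (ratVal (low k s) : ℝ) < m := by
      rw [max_lt_iff, hlow]
      exact ⟨hm0, by linarith⟩
    have hroot : (max 0 (ratVal (low k s) : ℝ)) ^ p.toReal⁻¹ < m ^ p.toReal⁻¹ :=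
      Real.rpow_lt_rpow (le_max_left _ _) hlt (inv_pos.2 hr)
    have hroot0 : 0 ≤ (max 0 (ratVal (low k s) : ℝ)) ^ p.toReal⁻¹ :=
      Real.rpow_nonneg (le_max_left _ _) _
    obtain ⟨x, hx1, hx2⟩ := exists_rat_btwn hroot
    obtain ⟨x, rfl⟩ := ratVal_surjective x
    have hx0 : 0 ≤ ratVal x := by exact_mod_cast hroot0.trans hx1.le
    rw [← ratVal_ratPosPart hx0] at hx1 hx2
    obtain ⟨c, c', y, hcc, hb⟩ := exists_ballsCertify hι hm0 hm1 hp hθ hTj hP1 hP2 hx2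
    obtain ⟨l, hl⟩ := (hSP c c').1 hcc
    refine ⟨l, s, ((c, c'), x, y), ⟨hl, hb⟩, hks, ?_⟩
    have h1 := Real.rpow_lt_rpow hroot0 hx1 hr
    rw [← Real.rpow_mul (le_max_left _ _), inv_mul_cancel₀ hr.ne', Real.rpow_one] at h1
    exact (le_max_right _ _).trans_lt h1
  · obtain ⟨⟨⟨c, c'⟩, x, y⟩, ⟨hl, hb⟩, hlt, hlx⟩ := hks
    refine hdec k s hlt ?_
    have h1 := lt_root_of_ballsCertify hι hm0 hθ hTj (hP1 c c' ((hSP c c').2 ⟨l, hl⟩)) hb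
    have h2 := Real.rpow_lt_rpow (by exact_mod_cast ratPosPart_nonneg x) h1 hr
    rw [hmr] at h2
    have h3 := hlx.trans h2
    simp only [hlow] at h3
    linarith

end Decoding

end CompBanach

theorem theorem6p1 (𝕜 : Type*) [RCLike 𝕜] (p : ℝ≥0∞) [Fact (1 ≤ p)] (hp_top : p ≠ ∞)
    (hp_two : p ≠ 2) (hp : CompBanach.IsComputableReal p.toReal) (n : ℕ) (hn : 1 ≤ n)
    (d : TuringDegree) (hd : CompBanach.IsCEDegree d) :
    ∃ R : ℕ → CompBanach.HybridLp 𝕜 p n,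
      CompBanach.IsComputablePresentation 𝕜 R ∧
      ∀ x : TuringDegree,
        (∃ T : CompBanach.HybridLp 𝕜 p n ≃ₗᵢ[𝕜] CompBanach.HybridLp 𝕜 p n,
          CompBanach.DegreeComputes 𝕜 x (CompBanach.standardHybrid 𝕜 p n) R T) →
        d ≤ x := by
  -- Since n ≥ 1, there is an atom e_0 in which to hide m.
  obtain ⟨n, rfl⟩ : ∃ k, n = k + 1 := ⟨n - 1, by omega⟩
  obtain ⟨A, hA, rfl⟩ := hd
  obtain ⟨m, μ, E, hm0, hm1, hμ, hE, hcut, hex, hdec⟩ := CompBanach.exists_cutReal hA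
  obtain ⟨h, hh, hmh⟩ := CompBanach.exists_enumeration_above hm1 hμ hcut
  refine ⟨CompBanach.cutStructure 𝕜 p n m fun j => (CompBanach.ratVal (h j) : ℝ),
    CompBanach.isComputablePresentation_cutStructure hp_top hp hm0 hm1 hh hmh, ?_⟩
  rintro _ ⟨T, X, rfl, hT⟩
  -- The order on degrees is Turing reducibility of the representatives A and X.
  exact CompBanach.turingReducible_of_isComputableMapIn hp_top hp_two hp hm0 hm1 hμ hE hex hdec T hT
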